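/- Let $R\in\mathbb R$ and let $H:(R,\infty)\to(0,\infty)$ be a $C^\infty$, monotone decreasing function with $H'(y)\to0$ as $y\to+\infty$ and $H''$ bounded. Let $\Omega\subset\mathbb R^2$ be a domain with $C^\infty$ boundary such that $$\Omega\cap\{x_1>R\}=\{x: x_1>R,\ -H(x_1)<x_2<H(x_1)\}$$ and $\Omega\cap\{x_1\le R\}$ is bounded. Let $\Gamma_D,\Gamma_N,\Gamma_M$ (any of which may be empty) be pairwise disjoint finite unions of open curves in $\partial\Omega$ with $\partial\Omega=\overline{\Gamma_D}\cup\overline{\Gamma_N}\cup\overline{\Gamma_M}$, and let $\nu\in[0,1/2)$. Let $\mathbb H$ be the space of all $u\in H^2(\Omega)$ with $u=\partial_nu=0$ on $\Gamma_D$ and $u=0$ on $\Gamma_M$ in the sense of traces, and let $$a(u,v)=\int_\Omega\Big(\partial_1^2u\,\overline{\partial_1^2v}+\partial_2^2u\,\overline{\partial_2^2v}+2(1-\nu)\,\partial_1\partial_2u\,\overline{\partial_1\partial_2v}+\nu\big(\partial_1^2u\,\overline{\partial_2^2v}+\partial_2^2u\,\overline{\partial_1^2v}\big)\Big)dx,\qquad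 u,v\in\mathbb H.$$ The operator of the plate problem ($\Delta^2u=\lambda u$ in $\Omega$, clamped on $\Gamma_D$, traction-free on $\Gamma_N$, hinged on $\Gamma_M$) is the self-adjoint operator $A$ in $L^2(\Omega)$ associated with the closure of the form $a$. Assume that the boundary conditions include $u=0$ on one side of the peak: for some $\rho\ge R$, one of the curves $\Sigma_\rho^{\pm}=\{x:x_1>\rho,\ x_2=\pm H(x_1)\}$ is contained in $\Gamma_M\cup\Gamma_D$ (nothing is required on the other side; in particular one side may be hinged and the other traction-free). Put $$G_H(y)=\frac1{4H(y)}\Big(\int_R^y\frac{d\tau}{H(\tau)}\Big)^{-2}.$$ If $H(y)^{-3}G_H(y)\to+\infty$ as $y\to+\infty$, then the spectrum of $A$ is discrete, that is, it consists of isolated eigenvalues of finite multiplicity. Moreover, for all $\alpha>0$ and $R>0$, the function $H(y)=y^{-1-\alpha}$ on $(R,\infty)$ satisfies all the above requirements on $H$, including $H(y)^{-3}G_H(y)\to+\infty$. -/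

import Mathlib

open Set Filter Topology MeasureTheory
open scoped ENNReal ContDiff

namespace Plate

noncomputable section

/-! ### Spectrum of an unbounded operator -/

section Spectral

variable {X : Type*} [NormedAddCommGroup X] [NormedSpace ℂ X]

/-- Resolvent set: the `z` for which `A - z` maps the domain of `A` bijectively onto the whole
space, with a bounded everywhere defined inverse `S`. -/
def resolventSet (A : X →ₗ.[ℂ] X) : Set ℂ :=
  {z | ∃ S : X →L[ℂ] X,
    (∀ f : X, ∃ h : S f ∈ A.domain, A ⟨S f, h⟩ - z • S f = f) ∧
    ∀ u : A.domain, S (A u - z • (u : X)) = u}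

/-- The spectrum of an unbounded operator. -/
def spectrum (A : X →ₗ.[ℂ] X) : Set ℂ := (resolventSet A)ᶜ

/-- The eigenspace `ker (A - z)`, as a subspace of the domain of `A`. -/
def eigenspace (A : X →ₗ.[ℂ] X) (z : ℂ) : Submodule ℂ A.domain :=
  LinearMap.ker (A.toFun - z • A.domain.subtype)

/-- The spectrum consists of isolated eigenvalues of finite multiplicity. -/
def HasDiscreteSpectrum (A : X →ₗ.[ℂ] X) : Prop :=
  ∀ z ∈ spectrum A,
    (∃ ε > 0, ∀ w ∈ spectrum A, dist w z < ε → w = z) ∧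
    eigenspace A z ≠ ⊥ ∧ FiniteDimensional ℂ (eigenspace A z)

end Spectral

/-! ### The peak and the plate -/

/-- The Euclidean plane; the coordinates are `x 0` (called `y`) and `x 1` (called `z`). -/
abbrev Plane : Type := EuclideanSpace ℝ (Fin 2)

/-- Profile of an infinite peak `{x | R < x 0, |x 1| < H (x 0)}`. -/
structure IsPeakProfile (R : ℝ) (H : ℝ → ℝ) : Prop where
  smooth : ContDiffOn ℝ ∞ H (Ioi R)
  pos : ∀ y, R < y → 0 < H y
  antitone : AntitoneOn H (Ioi R)
  deriv_tendsto : Tendsto (deriv H) atTop (𝓝 0)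
  deriv2_bounded : ∃ C : ℝ, ∀ y, R < y → |deriv (deriv H) y| ≤ C

/-- The peak `Π_R`. -/
def peak (R : ℝ) (H : ℝ → ℝ) : Set Plane :=
  {x | R < x 0 ∧ -H (x 0) < x 1 ∧ x 1 < H (x 0)}

/-- The upper side of the peak beyond `ρ`. -/
def upperSide (ρ : ℝ) (H : ℝ → ℝ) : Set Plane := {x | ρ < x 0 ∧ x 1 = H (x 0)}

/-- The lower side of the peak beyond `ρ`. -/
def lowerSide (ρ : ℝ) (H : ℝ → ℝ) : Set Plane := {x | ρ < x 0 ∧ x 1 = -H (x 0)}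

/-- The set has boundary of class `C^∞`: near each boundary point, after relabelling and
reorienting the coordinate axes, it is the region above the graph of a smooth function. -/
def HasSmoothBoundary (Ω : Set Plane) : Prop :=
  ∀ p ∈ frontier Ω, ∃ r > 0, ∃ i j : Fin 2, i ≠ j ∧ ∃ s : ℝ, (s = 1 ∨ s = -1) ∧
    ∃ γ : ℝ → ℝ, ContDiff ℝ ∞ γ ∧
      Ω ∩ Metric.ball p r = {x | x ∈ Metric.ball p r ∧ 0 < s * (x j - γ (x i))}

/-- A plane domain with smooth boundary that coincides with the peak in the half-plane
`{x | R < x 0}` and is bounded outside of it. -/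
structure IsPeakDomain (R : ℝ) (H : ℝ → ℝ) (Ω : TopologicalSpace.Opens Plane) : Prop where
  connected : IsConnected (Ω : Set Plane)
  smooth_boundary : HasSmoothBoundary (Ω : Set Plane)
  peak_eq : (Ω : Set Plane) ∩ {x | R < x 0} = peak R H
  bounded : Bornology.IsBounded ((Ω : Set Plane) ∩ {x | x 0 ≤ R})

/-- `S` is the union of a finite family of open curves in the boundary of `Ω` (connected
relatively open pieces of the boundary curve). The family may be empty. -/
def IsFiniteUnionOfCurves (Ω S : Set Plane) : Prop :=
  ∃ F : Set (Set Plane), F.Finite ∧ S = ⋃₀ F ∧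
    ∀ c ∈ F, IsConnected c ∧ ∃ U : Set Plane, IsOpen U ∧ c = U ∩ frontier Ω

/-- Decomposition of the boundary into clamped (`ΓD`), traction-free (`ΓN`) and hinged (`ΓM`)
parts. -/
structure IsBoundaryDecomposition (Ω ΓD ΓN ΓM : Set Plane) : Prop where
  curvesD : IsFiniteUnionOfCurves Ω ΓD
  curvesN : IsFiniteUnionOfCurves Ω ΓN
  curvesM : IsFiniteUnionOfCurves Ω ΓM
  disjointDN : Disjoint ΓD ΓN
  disjointDM : Disjoint ΓD ΓM
  disjointNM : Disjoint ΓN ΓM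
  cover : frontier Ω = closure ΓD ∪ closure ΓN ∪ closure ΓM

/-- The Hardy weight `G_H(y) = (4 H(y))⁻¹ (∫_R^y H(τ)⁻¹ dτ)⁻²`. -/
def hardyWeight (R : ℝ) (H : ℝ → ℝ) (y : ℝ) : ℝ :=
  1 / (4 * H y) * ((∫ τ in R..y, (H τ)⁻¹) ^ 2)⁻¹

/-! ### Weak derivatives and traces -/

/-- Smooth compactly supported complex functions on the plane. -/
structure IsTest (φ : Plane → ℂ) : Prop where
  smooth : ContDiff ℝ ∞ φ
  supp : HasCompactSupport φ

/-- Classical partial derivative. -/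
def partialD (i : Fin 2) (φ : Plane → ℂ) (x : Plane) : ℂ :=
  fderiv ℝ φ x (EuclideanSpace.single i 1)

/-- The complex Hilbert space `L²(Ω)`. -/
abbrev L2 (Ω : TopologicalSpace.Opens Plane) : Type :=
  Lp ℂ 2 (volume.restrict (Ω : Set Plane))

variable {Ω : TopologicalSpace.Opens Plane}

/-- `g` is the weak partial derivative `∂ᵢ u` in `Ω`. -/
def HasWeakDeriv (i : Fin 2) (u g : L2 Ω) : Prop :=
  ∀ φ : Plane → ℂ, IsTest φ → tsupport φ ⊆ (Ω : Set Plane) →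
    ∫ x in (Ω : Set Plane), u x * partialD i φ x = -∫ x in (Ω : Set Plane), g x * φ x

open Classical in
/-- The weak partial derivative `∂ᵢ u`, with value `0` if it does not exist in `L²(Ω)`. -/
def pd (i : Fin 2) (u : L2 Ω) : L2 Ω :=
  if h : ∃ g, HasWeakDeriv i u g then h.choose else 0

/-- Membership in the Sobolev space `H¹(Ω)`. -/
def MemH1 (u : L2 Ω) : Prop := ∀ i, ∃ g, HasWeakDeriv i u g

/-- Membership in the Sobolev space `H²(Ω)`. -/
def MemH2 (u : L2 Ω) : Prop := MemH1 u ∧ ∀ i, MemH1 (pd i u)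

/-- The trace of `u ∈ H¹(Ω)` on the boundary piece `Γ` vanishes. The trace operator is the
extension by continuity, from `H¹(Ω)` to `L²` of compact boundary pieces with respect to arc
length, of the restriction of functions that are smooth up to the boundary. -/
def ZeroTrace (Γ : Set Plane) (u : L2 Ω) : Prop :=
  ∀ K ⊆ Γ, IsCompact K → ∀ ε : ℝ≥0∞, 0 < ε → ∃ φ : Plane → ℂ, IsTest φ ∧
    eLpNorm (fun x => u x - φ x) 2 (volume.restrict (Ω : Set Plane)) < ε ∧
    (∀ i, eLpNorm (fun x => pd i u x - partialD i φ x) 2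
      (volume.restrict (Ω : Set Plane)) < ε) ∧
    eLpNorm φ 2 ((Measure.hausdorffMeasure 1).restrict K) < ε

/-! ### Helper facts: the weak derivative is unique and linear -/

theorem IsTest.ofReal {g : Plane → ℝ} (hg : ContDiff ℝ ∞ g) (hs : HasCompactSupport g) :
    IsTest (fun x => (g x : ℂ)) :=
  ⟨Complex.ofRealCLM.contDiff.comp hg, hs.comp_left Complex.ofReal_zero⟩

theorem tsupport_ofReal_subset (g : Plane → ℝ) :
    tsupport (fun x => (g x : ℂ)) ⊆ tsupport g :=
  closure_mono fun x hx h => hx (by simp [h])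

theorem IsTest.partialD {φ : Plane → ℂ} (h : IsTest φ) (i : Fin 2) : IsTest (partialD i φ) :=
  ⟨(h.smooth.fderiv_right (m := ∞) (by simp)).clm_apply contDiff_const,
    h.supp.fderiv_apply (𝕜 := ℝ) _⟩

theorem tsupport_partialD_subset (i : Fin 2) (φ : Plane → ℂ) :
    tsupport (partialD i φ) ⊆ tsupport φ :=
  tsupport_fderiv_apply_subset ℝ _

theorem IsTest.memLp {φ : Plane → ℂ} (h : IsTest φ) (μ : Measure Plane)
    [IsFiniteMeasureOnCompacts μ] : MemLp φ 2 μ :=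
  h.smooth.continuous.memLp_of_hasCompactSupport h.supp

theorem IsTest.add {φ ψ : Plane → ℂ} (h : IsTest φ) (h' : IsTest ψ) :
    IsTest (fun x => φ x + ψ x) :=
  ⟨h.smooth.add h'.smooth, h.supp.add h'.supp⟩

theorem IsTest.const_mul {φ : Plane → ℂ} (h : IsTest φ) (c : ℂ) : IsTest (fun x => c * φ x) :=
  ⟨contDiff_const.mul h.smooth, h.supp.mul_left⟩

theorem IsTest.integrable_mul {φ : Plane → ℂ} (h : IsTest φ) (u : L2 Ω) :
    Integrable (fun x => u x * φ x) (volume.restrict (Ω : Set Plane)) :=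
  (Lp.memLp u).integrable_mul (h.memLp _)

theorem partialD_add {φ ψ : Plane → ℂ} (h : IsTest φ) (h' : IsTest ψ) (i : Fin 2) (x : Plane) :
    partialD i (fun x => φ x + ψ x) x = partialD i φ x + partialD i ψ x := by
  have h1 := (h.smooth.differentiable (by simp)) x
  have h2 := (h'.smooth.differentiable (by simp)) x
  simp only [Plate.partialD]
  rw [fderiv_fun_add h1 h2]
  rfl

theorem partialD_const_mul {φ : Plane → ℂ} (h : IsTest φ) (c : ℂ) (i : Fin 2) (x : Plane) :
    partialD i (fun x => c * φ x) x = c * partialD i φ x := by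
  have h1 := (h.smooth.differentiable (by simp)) x
  simp only [Plate.partialD]
  rw [fderiv_const_mul h1]
  rfl

/-- An `L²(Ω)` function is determined by its integrals against test functions. -/
theorem eq_of_forall_test {f g : L2 Ω}
    (h : ∀ φ : Plane → ℂ, IsTest φ → tsupport φ ⊆ (Ω : Set Plane) →
      ∫ x in (Ω : Set Plane), f x * φ x = ∫ x in (Ω : Set Plane), g x * φ x) : f = g := by
  have hloc : LocallyIntegrableOn (fun x => f x - g x) (Ω : Set Plane)
      (volume.restrict (Ω : Set Plane)) :=
    (((Lp.memLp f).sub (Lp.memLp g)).locallyIntegrable (by norm_num)).locallyIntegrableOn _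
  have key := Ω.isOpen.ae_eq_zero_of_integral_contDiff_smul_eq_zero hloc (by
    intro φ h1 h2 h3
    have ht := IsTest.ofReal h1 h2
    have := h _ ht ((tsupport_ofReal_subset φ).trans h3)
    rw [← sub_eq_zero, ← integral_sub (ht.integrable_mul f) (ht.integrable_mul g)] at this
    rw [← this]
    refine integral_congr_ae (ae_of_all _ fun x => ?_)
    simp only [Complex.real_smul]
    ring)
  refine Lp.ext ?_
  filter_upwards [key, ae_restrict_mem Ω.isOpen.measurableSet] with x hx hm
  exact sub_eq_zero.1 (hx hm)

theorem HasWeakDeriv.unique {i : Fin 2} {u g g' : L2 Ω} (h : HasWeakDeriv i u g)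
    (h' : HasWeakDeriv i u g') : g = g' :=
  eq_of_forall_test fun φ hφ hs => neg_injective ((h φ hφ hs).symm.trans (h' φ hφ hs))

theorem HasWeakDeriv.pd_eq {i : Fin 2} {u g : L2 Ω} (h : HasWeakDeriv i u g) : pd i u = g := by
  have hex : ∃ g, HasWeakDeriv i u g := ⟨g, h⟩
  rw [pd, dif_pos hex]
  exact hex.choose_spec.unique h

theorem MemH1.hasWeakDeriv {u : L2 Ω} (h : MemH1 u) (i : Fin 2) :
    HasWeakDeriv i u (pd i u) := by
  obtain ⟨g, hg⟩ := h i
  rwa [hg.pd_eq]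

theorem HasWeakDeriv.add {i : Fin 2} {u v g k : L2 Ω} (h : HasWeakDeriv i u g)
    (h' : HasWeakDeriv i v k) : HasWeakDeriv i (u + v) (g + k) := by
  intro φ hφ hs
  have e : ∀ (a b : L2 Ω) (ψ : Plane → ℂ), IsTest ψ →
      ∫ x in (Ω : Set Plane), (a + b : L2 Ω) x * ψ x =
        (∫ x in (Ω : Set Plane), a x * ψ x) + ∫ x in (Ω : Set Plane), b x * ψ x := by
    intro a b ψ hψ
    rw [← integral_add (hψ.integrable_mul a) (hψ.integrable_mul b)]
    refine integral_congr_ae ?_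
    filter_upwards [Lp.coeFn_add a b] with x hx
    rw [hx, Pi.add_apply, add_mul]
  rw [e _ _ _ (hφ.partialD i), e _ _ _ hφ, h φ hφ hs, h' φ hφ hs]
  ring

theorem HasWeakDeriv.smul {i : Fin 2} {u g : L2 Ω} (h : HasWeakDeriv i u g) (c : ℂ) :
    HasWeakDeriv i (c • u) (c • g) := by
  intro φ hφ hs
  have e : ∀ (a : L2 Ω) (ψ : Plane → ℂ),
      ∫ x in (Ω : Set Plane), (c • a : L2 Ω) x * ψ x =
        c * ∫ x in (Ω : Set Plane), a x * ψ x := by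
    intro a ψ
    rw [← integral_const_mul]
    refine integral_congr_ae ?_
    filter_upwards [Lp.coeFn_smul c a] with x hx
    rw [hx, Pi.smul_apply, smul_eq_mul, mul_assoc]
  rw [e, e, h φ hφ hs]
  ring

theorem MemH1.add {u v : L2 Ω} (hu : MemH1 u) (hv : MemH1 v) : MemH1 (u + v) :=
  fun i => ⟨_, (hu.hasWeakDeriv i).add (hv.hasWeakDeriv i)⟩

theorem MemH1.smul {u : L2 Ω} (hu : MemH1 u) (c : ℂ) : MemH1 (c • u) :=
  fun i => ⟨_, (hu.hasWeakDeriv i).smul c⟩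

theorem MemH1.pd_add {u v : L2 Ω} (hu : MemH1 u) (hv : MemH1 v) (i : Fin 2) :
    pd i (u + v) = pd i u + pd i v :=
  ((hu.hasWeakDeriv i).add (hv.hasWeakDeriv i)).pd_eq

theorem MemH1.pd_smul {u : L2 Ω} (hu : MemH1 u) (c : ℂ) (i : Fin 2) :
    pd i (c • u) = c • pd i u :=
  ((hu.hasWeakDeriv i).smul c).pd_eq

theorem MemH2.add {u v : L2 Ω} (hu : MemH2 u) (hv : MemH2 v) : MemH2 (u + v) :=
  ⟨hu.1.add hv.1, fun i => by rw [hu.1.pd_add hv.1]; exact (hu.2 i).add (hv.2 i)⟩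

theorem MemH2.smul {u : L2 Ω} (hu : MemH2 u) (c : ℂ) : MemH2 (c • u) :=
  ⟨hu.1.smul c, fun i => by rw [hu.1.pd_smul]; exact (hu.2 i).smul c⟩

/-- For a test function supported in `Ω` the weak derivative is the classical one. -/
theorem hasWeakDeriv_test {φ : Plane → ℂ} (h : IsTest φ) (i : Fin 2) :
    HasWeakDeriv i ((h.memLp (volume.restrict (Ω : Set Plane))).toLp φ)
      (((h.partialD i).memLp (volume.restrict (Ω : Set Plane))).toLp (partialD i φ)) := by
  intro ψ hψ hs
  have e1 : ∀ (a b : Plane → ℂ) (ha : MemLp a 2 (volume.restrict (Ω : Set Plane))),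
      tsupport b ⊆ (Ω : Set Plane) →
      ∫ x in (Ω : Set Plane), (ha.toLp a) x * b x = ∫ x, a x * b x := by
    intro a b ha hb
    rw [← setIntegral_eq_integral_of_forall_compl_eq_zero (s := (Ω : Set Plane))
      (f := fun x => a x * b x)]
    · refine integral_congr_ae ?_
      filter_upwards [ha.coeFn_toLp] with x hx
      rw [hx]
    · intro x hx
      rw [image_eq_zero_of_notMem_tsupport fun hm => hx (hb hm), mul_zero]
  rw [e1 _ _ _ ((tsupport_partialD_subset i ψ).trans hs), e1 _ _ _ hs]
  have hi : ∀ {a b : Plane → ℂ}, IsTest a → IsTest b → Integrable (fun x => a x * b x) :=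
    fun ha hb => (ha.memLp volume).integrable_mul (hb.memLp volume)
  exact integral_mul_fderiv_eq_neg_fderiv_mul_of_integrable (hi (h.partialD i) hψ)
    (hi h (hψ.partialD i)) (hi h hψ)
    (fun x _ => (h.smooth.differentiable (by simp)) x)
    (fun x _ => (hψ.smooth.differentiable (by simp)) x)

theorem memH1_test {φ : Plane → ℂ} (h : IsTest φ) :
    MemH1 ((h.memLp (volume.restrict (Ω : Set Plane))).toLp φ) :=
  fun i => ⟨_, hasWeakDeriv_test h i⟩

theorem pd_test {φ : Plane → ℂ} (h : IsTest φ) (i : Fin 2) :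
    pd i ((h.memLp (volume.restrict (Ω : Set Plane))).toLp φ) =
      ((h.partialD i).memLp (volume.restrict (Ω : Set Plane))).toLp (partialD i φ) :=
  (hasWeakDeriv_test h i).pd_eq

theorem memH2_test {φ : Plane → ℂ} (h : IsTest φ) :
    MemH2 ((h.memLp (volume.restrict (Ω : Set Plane))).toLp φ) :=
  ⟨memH1_test h, fun i => by rw [pd_test h]; exact memH1_test (h.partialD i)⟩

theorem zeroTrace_test {φ : Plane → ℂ} (h : IsTest φ) {Γ : Set Plane}
    (hΓ : ∀ x ∈ Γ, φ x = 0) :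
    ZeroTrace Γ ((h.memLp (volume.restrict (Ω : Set Plane))).toLp φ) := by
  intro K hK hc ε hε
  refine ⟨φ, h, ?_, fun i => ?_, ?_⟩
  · rw [eLpNorm_congr_ae (g := fun _ => (0 : ℂ))]
    · simpa using hε
    · filter_upwards [(h.memLp (volume.restrict (Ω : Set Plane))).coeFn_toLp] with x hx
      rw [hx, sub_self]
  · rw [pd_test h, eLpNorm_congr_ae (g := fun _ => (0 : ℂ))]
    · simpa using hε
    · filter_upwards [((h.partialD i).memLp (volume.restrict (Ω : Set Plane))).coeFn_toLp]
        with x hx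
      rw [hx, sub_self]
  · rw [eLpNorm_congr_ae (g := fun _ => (0 : ℂ))]
    · simpa using hε
    · filter_upwards [ae_restrict_mem hc.measurableSet] with x hx
      exact hΓ x (hK hx)

theorem ZeroTrace.add {Γ : Set Plane} {u v : L2 Ω} (hu1 : MemH1 u) (hv1 : MemH1 v)
    (hu : ZeroTrace Γ u) (hv : ZeroTrace Γ v) : ZeroTrace Γ (u + v) := by
  intro K hK hc ε hε
  have hε2 : 0 < ε / 2 := ENNReal.half_pos hε.ne'
  obtain ⟨φ, hφ, a0, a1, a2⟩ := hu K hK hc _ hε2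
  obtain ⟨ψ, hψ, b0, b1, b2⟩ := hv K hK hc _ hε2
  have key : ∀ (a b : L2 Ω) (f g k : Plane → ℂ), IsTest f → IsTest g →
      (∀ x, k x = f x + g x) →
      eLpNorm (fun x => a x - f x) 2 (volume.restrict (Ω : Set Plane)) < ε / 2 →
      eLpNorm (fun x => b x - g x) 2 (volume.restrict (Ω : Set Plane)) < ε / 2 →
      eLpNorm (fun x => (a + b : L2 Ω) x - k x) 2 (volume.restrict (Ω : Set Plane)) < ε := by
    intro a b f g k hf hg hk h1 h2
    have e : (fun x => (a + b : L2 Ω) x - k x) =ᵐ[volume.restrict (Ω : Set Plane)]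
        (fun x => a x - f x) + fun x => b x - g x := by
      filter_upwards [Lp.coeFn_add a b] with x hx
      rw [hx, hk, Pi.add_apply, Pi.add_apply]
      ring
    rw [eLpNorm_congr_ae e]
    calc _ ≤ _ := eLpNorm_add_le ((Lp.aestronglyMeasurable a).sub (hf.memLp _).1)
          ((Lp.aestronglyMeasurable b).sub (hg.memLp _).1) (by norm_num)
      _ < ε / 2 + ε / 2 := ENNReal.add_lt_add h1 h2
      _ = ε := ENNReal.add_halves ε
  refine ⟨fun x => φ x + ψ x, hφ.add hψ, key _ _ _ _ _ hφ hψ (fun _ => rfl) a0 b0,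
    fun i => ?_, ?_⟩
  · rw [hu1.pd_add hv1]
    exact key _ _ _ _ _ (hφ.partialD i) (hψ.partialD i)
      (fun x => partialD_add hφ hψ i x) (a1 i) (b1 i)
  · calc _ ≤ _ := eLpNorm_add_le hφ.smooth.continuous.aestronglyMeasurable
          hψ.smooth.continuous.aestronglyMeasurable (by norm_num)
      _ < ε / 2 + ε / 2 := ENNReal.add_lt_add a2 b2
      _ = ε := ENNReal.add_halves ε

theorem ZeroTrace.smul {Γ : Set Plane} {u : L2 Ω} (hu1 : MemH1 u)
    (hu : ZeroTrace Γ u) (c : ℂ) : ZeroTrace Γ (c • u) := by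
  intro K hK hc ε hε
  have hn : (‖c‖ₑ + 1) ≠ ⊤ := by simp
  have hn0 : (‖c‖ₑ + 1) ≠ 0 := by simp
  obtain ⟨φ, hφ, a0, a1, a2⟩ := hu K hK hc (ε / (‖c‖ₑ + 1)) (ENNReal.div_pos hε.ne' hn)
  have fin : ∀ t : ℝ≥0∞, t < ε / (‖c‖ₑ + 1) → ‖c‖ₑ * t < ε := by
    intro t ht
    calc ‖c‖ₑ * t ≤ t * (‖c‖ₑ + 1) := by rw [mul_comm]; gcongr; exact le_self_add
      _ < ε := (ENNReal.lt_div_iff_mul_lt (Or.inl hn0) (Or.inl hn)).1 ht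
  have key : ∀ (a : L2 Ω) (f k : Plane → ℂ), (∀ x, k x = c * f x) →
      eLpNorm (fun x => a x - f x) 2 (volume.restrict (Ω : Set Plane)) < ε / (‖c‖ₑ + 1) →
      eLpNorm (fun x => (c • a : L2 Ω) x - k x) 2 (volume.restrict (Ω : Set Plane)) < ε := by
    intro a f k hk h1
    have e : (fun x => (c • a : L2 Ω) x - k x) =ᵐ[volume.restrict (Ω : Set Plane)]
        c • fun x => a x - f x := by
      filter_upwards [Lp.coeFn_smul c a] with x hx
      rw [hx, hk, Pi.smul_apply, Pi.smul_apply, smul_eq_mul, smul_eq_mul]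
      ring
    rw [eLpNorm_congr_ae e, eLpNorm_const_smul]
    exact fin _ h1
  refine ⟨fun x => c * φ x, hφ.const_mul c, key _ _ _ (fun _ => rfl) a0, fun i => ?_, ?_⟩
  · rw [hu1.pd_smul]
    exact key _ _ _ (fun x => partialD_const_mul hφ c i x) (a1 i)
  · have : (fun x => c * φ x) = c • φ := rfl
    rw [this, eLpNorm_const_smul]
    exact fin _ a2

/-! ### The energy space, the energy form and the operator of the plate -/

/-- The energy space: all `u ∈ H²(Ω)` with `u = ∂ₙu = 0` on `ΓD` and `u = 0` on `ΓM` in the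
sense of traces. Where `u = 0` along the boundary the tangential derivative vanishes, so that
`u = ∂ₙu = 0` on `ΓD` says that `u` and both its partial derivatives have zero trace there. -/
def energySpace (Ω : TopologicalSpace.Opens Plane) (ΓD ΓM : Set Plane) :
    Submodule ℂ (L2 Ω) where
  carrier := {u | MemH2 u ∧ ZeroTrace ΓD u ∧ (∀ i, ZeroTrace ΓD (pd i u)) ∧ ZeroTrace ΓM u}
  add_mem' := by
    rintro u v ⟨hu, u1, u2, u3⟩ ⟨hv, v1, v2, v3⟩
    refine ⟨hu.add hv, u1.add hu.1 hv.1 v1, fun i => ?_, u3.add hu.1 hv.1 v3⟩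
    rw [hu.1.pd_add hv.1]
    exact (u2 i).add (hu.2 i) (hv.2 i) (v2 i)
  zero_mem' := by
    have h0 : IsTest (fun _ => (0 : ℂ)) := ⟨contDiff_const, HasCompactSupport.zero⟩
    have e : (h0.memLp (volume.restrict (Ω : Set Plane))).toLp (fun _ => (0 : ℂ)) = 0 :=
      MemLp.toLp_zero _
    have hz : ∀ Γ, ZeroTrace Γ (0 : L2 Ω) := fun Γ => e ▸ zeroTrace_test h0 fun _ _ => rfl
    have hp : ∀ i, pd i (0 : L2 Ω) = 0 := fun i =>
      HasWeakDeriv.pd_eq (by simpa using (memH1_test (Ω := Ω) h0).hasWeakDeriv i |>.smul 0)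
    exact ⟨e ▸ memH2_test h0, hz _, fun i => (hp i).symm ▸ hz _, hz _⟩
  smul_mem' := by
    rintro c u ⟨hu, u1, u2, u3⟩
    refine ⟨hu.smul c, u1.smul hu.1 c, fun i => ?_, u3.smul hu.1 c⟩
    rw [hu.1.pd_smul]
    exact (u2 i).smul (hu.2 i) c

/-- The sesquilinear energy form
`a(u,v) = ∫_Ω (u₁₁ v̄₁₁ + u₂₂ v̄₂₂ + 2(1-ν) u₁₂ v̄₁₂ + ν (u₁₁ v̄₂₂ + u₂₂ v̄₁₁)) dx`,
where `inner ℂ f g = ∫_Ω f̄ g dx`. -/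
def energyForm (ν : ℝ) (u v : L2 Ω) : ℂ :=
  inner ℂ (pd 0 (pd 0 v)) (pd 0 (pd 0 u)) + inner ℂ (pd 1 (pd 1 v)) (pd 1 (pd 1 u)) +
    2 * (1 - ν) * inner ℂ (pd 0 (pd 1 v)) (pd 0 (pd 1 u)) +
    ν * (inner ℂ (pd 1 (pd 1 v)) (pd 0 (pd 0 u)) + inner ℂ (pd 0 (pd 0 v)) (pd 1 (pd 1 u)))

theorem MemH2.pd2_add {u v : L2 Ω} (hu : MemH2 u) (hv : MemH2 v) (i j : Fin 2) :
    pd i (pd j (u + v)) = pd i (pd j u) + pd i (pd j v) := by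
  rw [hu.1.pd_add hv.1, (hu.2 j).pd_add (hv.2 j)]

theorem MemH2.pd2_smul {u : L2 Ω} (hu : MemH2 u) (c : ℂ) (i j : Fin 2) :
    pd i (pd j (c • u)) = c • pd i (pd j u) := by
  rw [hu.1.pd_smul, (hu.2 j).pd_smul]

theorem energyForm_add {ν : ℝ} {u v w : L2 Ω} (hu : MemH2 u) (hv : MemH2 v) :
    energyForm ν (u + v) w = energyForm ν u w + energyForm ν v w := by
  simp only [energyForm, hu.pd2_add hv, inner_add_right]
  ring

theorem energyForm_smul {ν : ℝ} {u w : L2 Ω} (hu : MemH2 u) (c : ℂ) :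
    energyForm ν (c • u) w = c * energyForm ν u w := by
  simp only [energyForm, hu.pd2_smul, inner_smul_right]
  ring

/-- The elastic energy `a(u,u)`; this is a nonnegative real number. -/
def energy (ν : ℝ) (u : L2 Ω) : ℝ := (energyForm ν u u).re

theorem energy_eq (ν : ℝ) (u : L2 Ω) :
    energy ν u = ‖pd 0 (pd 0 u)‖ ^ 2 + ‖pd 1 (pd 1 u)‖ ^ 2 +
      2 * (1 - ν) * ‖pd 0 (pd 1 u)‖ ^ 2 +
      2 * ν * (inner ℂ (pd 0 (pd 0 u)) (pd 1 (pd 1 u))).re := by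
  have h1 : ∀ f : L2 Ω, inner ℂ f f = ((‖f‖ ^ 2 : ℝ) : ℂ) := fun f => by
    rw [inner_self_eq_norm_sq_to_K]; norm_cast
  have h2 : (inner ℂ (pd 1 (pd 1 u)) (pd 0 (pd 0 u))).re =
      (inner ℂ (pd 0 (pd 0 u)) (pd 1 (pd 1 u))).re := inner_re_symm (𝕜 := ℂ) _ _
  have h3 : (2 * (1 - (ν : ℂ))) = ((2 * (1 - ν) : ℝ) : ℂ) := by push_cast; ring
  simp only [energy, energyForm, h1, h3, Complex.add_re, Complex.re_ofReal_mul,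
    Complex.ofReal_re, h2]
  ring

theorem energy_nonneg {ν : ℝ} (hν : ν ∈ Ico (0 : ℝ) (1 / 2)) (u : L2 Ω) : 0 ≤ energy ν u := by
  rw [energy_eq]
  have h := (abs_le.1 ((Complex.abs_re_le_norm _).trans
    (norm_inner_le_norm (𝕜 := ℂ) (pd 0 (pd 0 u)) (pd 1 (pd 1 u))))).1
  have h1 : 2 * ν * -(‖pd 0 (pd 0 u)‖ * ‖pd 1 (pd 1 u)‖) ≤
      2 * ν * (inner ℂ (pd 0 (pd 0 u)) (pd 1 (pd 1 u))).re :=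
    mul_le_mul_of_nonneg_left h (by linarith [hν.1])
  have h2 : 0 ≤ 2 * (1 - ν) * ‖pd 0 (pd 1 u)‖ ^ 2 :=
    mul_nonneg (by linarith [hν.2]) (sq_nonneg _)
  have h3 : 0 ≤ (1 - ν) * (‖pd 0 (pd 0 u)‖ * ‖pd 1 (pd 1 u)‖) :=
    mul_nonneg (by linarith [hν.2]) (by positivity)
  nlinarith [sq_nonneg (‖pd 0 (pd 0 u)‖ - ‖pd 1 (pd 1 u)‖)]

theorem energy_smul {ν : ℝ} {u : L2 Ω} (hu : MemH2 u) (c : ℂ) :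
    energy ν (c • u) = ‖c‖ ^ 2 * energy ν u := by
  simp only [energy_eq, hu.pd2_smul, norm_smul, inner_smul_left, inner_smul_right, mul_pow]
  rw [← mul_assoc c, Complex.mul_conj', ← Complex.ofReal_pow, Complex.re_ofReal_mul]
  ring

theorem energy_add_le {ν : ℝ} (hν : ν ∈ Ico (0 : ℝ) (1 / 2)) {u v : L2 Ω} (hu : MemH2 u)
    (hv : MemH2 v) : energy ν (u + v) ≤ 2 * energy ν u + 2 * energy ν v := by
  have hv' : MemH2 ((-1 : ℂ) • v) := hv.smul _
  have h := energy_nonneg hν (u + (-1 : ℂ) • v)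
  have e : energy ν (u + v) + energy ν (u + (-1 : ℂ) • v) =
      2 * energy ν u + 2 * energy ν v := by
    simp only [energy, energyForm, hu.pd2_add hv, hu.pd2_add hv', hv.pd2_smul, inner_add_left,
      inner_add_right, inner_smul_left, inner_smul_right, ← Complex.add_re]
    have h2 : ∀ z : ℂ, 2 * z.re = (2 * z).re := fun z => by simp
    rw [h2, h2, ← Complex.add_re]
    congr 1
    simp only [map_neg, map_one]
    ring
  linarith

/-- Convergence in the sense of the closure of the form: the `w n` lie in the energy space,
converge to `u` in `L²(Ω)`, and are a Cauchy sequence for the elastic energy. The `u` that are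
limits in this sense are the elements of the domain of the closure of the form. (If the form is
closed on the energy space, this domain is the energy space. In a thin peak the second
derivatives need not control the first ones in `L²`, and then the closure is a proper
extension.) -/
structure FormTendsto (Ω : TopologicalSpace.Opens Plane) (ΓD ΓM : Set Plane) (ν : ℝ)
    (w : ℕ → L2 Ω) (u : L2 Ω) : Prop where
  mem : ∀ n, w n ∈ energySpace Ω ΓD ΓM
  tendsto : Tendsto w atTop (𝓝 u)
  cauchy : Tendsto (fun p : ℕ × ℕ => energy ν (w p.1 - w p.2)) atTop (𝓝 0)

/-- `u` lies in the domain of the closure `ā` of the form `a` on the energy space, and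
`ā(u,v) = (f,v)` for all `v` in the energy space (hence, by density, for all `v` in the domain
of `ā`). Here `ā(u,v)` is the limit of `a(w n,v)` for any `w n` that converge to `u`. -/
def IsWeakSolution (Ω : TopologicalSpace.Opens Plane) (ΓD ΓM : Set Plane) (ν : ℝ)
    (u f : L2 Ω) : Prop :=
  ∃ w : ℕ → L2 Ω, FormTendsto Ω ΓD ΓM ν w u ∧ ∀ v ∈ energySpace Ω ΓD ΓM,
    Tendsto (fun n => energyForm ν (w n) v) atTop (𝓝 (inner ℂ v f))

theorem FormTendsto.add {ΓD ΓM : Set Plane} {ν : ℝ} (hν : ν ∈ Ico (0 : ℝ) (1 / 2))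
    {w w' : ℕ → L2 Ω} {u u' : L2 Ω} (h : FormTendsto Ω ΓD ΓM ν w u)
    (h' : FormTendsto Ω ΓD ΓM ν w' u') :
    FormTendsto Ω ΓD ΓM ν (fun n => w n + w' n) (u + u') where
  mem n := add_mem (h.mem n) (h'.mem n)
  tendsto := h.tendsto.add h'.tendsto
  cauchy := by
    have hl := (h.cauchy.const_mul 2).add (h'.cauchy.const_mul 2)
    rw [mul_zero, add_zero] at hl
    refine squeeze_zero (fun p => energy_nonneg hν _) (fun p => ?_) hl
    rw [add_sub_add_comm]
    exact energy_add_le hν (sub_mem (h.mem _) (h.mem _)).1 (sub_mem (h'.mem _) (h'.mem _)).1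

theorem FormTendsto.smul {ΓD ΓM : Set Plane} {ν : ℝ} {w : ℕ → L2 Ω} {u : L2 Ω}
    (h : FormTendsto Ω ΓD ΓM ν w u) (c : ℂ) :
    FormTendsto Ω ΓD ΓM ν (fun n => c • w n) (c • u) where
  mem n := Submodule.smul_mem _ c (h.mem n)
  tendsto := h.tendsto.const_smul c
  cauchy := by
    have hl := h.cauchy.const_mul (‖c‖ ^ 2)
    rw [mul_zero] at hl
    refine hl.congr fun p => ?_
    rw [← smul_sub, energy_smul (sub_mem (h.mem _) (h.mem _)).1]

theorem IsWeakSolution.add {ΓD ΓM : Set Plane} {ν : ℝ} (hν : ν ∈ Ico (0 : ℝ) (1 / 2))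
    {u v f g : L2 Ω} (h : IsWeakSolution Ω ΓD ΓM ν u f) (h' : IsWeakSolution Ω ΓD ΓM ν v g) :
    IsWeakSolution Ω ΓD ΓM ν (u + v) (f + g) := by
  obtain ⟨w, hw, e⟩ := h
  obtain ⟨w', hw', e'⟩ := h'
  refine ⟨_, hw.add hν hw', fun v hv => ?_⟩
  rw [inner_add_right]
  refine ((e v hv).add (e' v hv)).congr fun n => ?_
  rw [energyForm_add (hw.mem n).1 (hw'.mem n).1]

theorem IsWeakSolution.smul {ΓD ΓM : Set Plane} {ν : ℝ} {u f : L2 Ω}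
    (h : IsWeakSolution Ω ΓD ΓM ν u f) (c : ℂ) :
    IsWeakSolution Ω ΓD ΓM ν (c • u) (c • f) := by
  obtain ⟨w, hw, e⟩ := h
  refine ⟨_, hw.smul c, fun v hv => ?_⟩
  rw [inner_smul_right]
  refine ((e v hv).const_mul c).congr fun n => ?_
  rw [energyForm_smul (hw.mem n).1]

theorem IsWeakSolution.zero (ΓD ΓM : Set Plane) (ν : ℝ) :
    IsWeakSolution Ω ΓD ΓM ν (0 : L2 Ω) 0 := by
  have hz : (0 : L2 Ω) ∈ energySpace Ω ΓD ΓM := zero_mem _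
  have e : ∀ v : L2 Ω, energyForm ν (0 : L2 Ω) v = 0 := fun v => by
    simpa using energyForm_smul (ν := ν) (w := v) hz.1 0
  exact ⟨fun _ => 0, ⟨fun _ => hz, tendsto_const_nhds, by simp [energy, e]⟩, by simp [e]⟩

theorem IsBoundaryDecomposition.subset_frontier {S ΓD ΓN ΓM : Set Plane}
    (h : IsBoundaryDecomposition S ΓD ΓN ΓM) : ΓD ⊆ frontier S ∧ ΓM ⊆ frontier S := by
  rw [h.cover]
  exact ⟨fun x hx => Or.inl (Or.inl (subset_closure hx)), fun x hx => Or.inr (subset_closure hx)⟩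

/-- The energy space contains the test functions supported in `Ω`. -/
theorem test_mem_energySpace {ΓD ΓN ΓM : Set Plane}
    (hΓ : IsBoundaryDecomposition (Ω : Set Plane) ΓD ΓN ΓM) {φ : Plane → ℂ} (h : IsTest φ)
    (hs : tsupport φ ⊆ (Ω : Set Plane)) :
    (h.memLp (volume.restrict (Ω : Set Plane))).toLp φ ∈ energySpace Ω ΓD ΓM := by
  have hv : ∀ ψ : Plane → ℂ, tsupport ψ ⊆ (Ω : Set Plane) →
      ∀ x ∈ frontier (Ω : Set Plane), ψ x = 0 := by
    intro ψ hψ x hx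
    rw [Ω.isOpen.frontier_eq] at hx
    exact image_eq_zero_of_notMem_tsupport fun hm => hx.2 (hψ hm)
  obtain ⟨hD, hM⟩ := hΓ.subset_frontier
  refine ⟨memH2_test h, zeroTrace_test h fun x hx => hv φ hs x (hD hx), fun i => ?_,
    zeroTrace_test h fun x hx => hv φ hs x (hM hx)⟩
  rw [pd_test h]
  exact zeroTrace_test (h.partialD i) fun x hx =>
    hv _ ((tsupport_partialD_subset i φ).trans hs) x (hD hx)

theorem IsTest.conj {φ : Plane → ℂ} (h : IsTest φ) :
    IsTest (fun x => (starRingEnd ℂ) (φ x)) :=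
  ⟨Complex.conjCLE.contDiff.comp h.smooth, h.supp.comp_left (map_zero _)⟩

theorem tsupport_conj_subset (φ : Plane → ℂ) :
    tsupport (fun x => (starRingEnd ℂ) (φ x)) ⊆ tsupport φ :=
  closure_mono (fun x hx hz => hx (by simp [hz]) :
    Function.support (fun x => (starRingEnd ℂ) (φ x)) ⊆ Function.support φ)

theorem inner_test {φ : Plane → ℂ} (h : IsTest φ) (k : L2 Ω) :
    inner ℂ ((h.memLp (volume.restrict (Ω : Set Plane))).toLp φ) k =
      ∫ x in (Ω : Set Plane), k x * (starRingEnd ℂ) (φ x) := by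
  rw [L2.inner_def]
  refine integral_congr_ae ?_
  filter_upwards [(h.memLp (volume.restrict (Ω : Set Plane))).coeFn_toLp] with x hx
  rw [hx, RCLike.inner_apply]

/-- Testing the form against a test function moves all derivatives to the test function. -/
theorem energyForm_test (ν : ℝ) {φ : Plane → ℂ} (h : IsTest φ)
    (hs : tsupport φ ⊆ (Ω : Set Plane)) : ∃ g : L2 Ω, ∀ u : L2 Ω, MemH2 u →
      energyForm ν u ((h.memLp (volume.restrict (Ω : Set Plane))).toLp φ) = inner ℂ g u := by
  have m : ∀ {ψ : Plane → ℂ}, IsTest ψ → MemLp ψ 2 (volume.restrict (Ω : Set Plane)) :=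
    fun hψ => hψ.memLp _
  have key : ∀ i j k l : Fin 2, ∃ g : L2 Ω, ∀ u : L2 Ω, MemH2 u →
      inner ℂ (pd k (pd l ((m h).toLp φ))) (pd i (pd j u)) = inner ℂ g u := by
    intro i j k l
    have ht := ((h.partialD l).partialD k)
    have s2 := (tsupport_partialD_subset k _).trans ((tsupport_partialD_subset l φ).trans hs)
    refine ⟨(m ((ht.conj.partialD i).partialD j).conj).toLp _, fun u hu => ?_⟩
    have w1 := (hu.2 j).hasWeakDeriv i _ ht.conj ((tsupport_conj_subset _).trans s2)
    have w2 := hu.1.hasWeakDeriv j _ (ht.conj.partialD i)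
      ((tsupport_partialD_subset i _).trans ((tsupport_conj_subset _).trans s2))
    rw [pd_test h, pd_test (h.partialD l), inner_test ht,
      inner_test ((ht.conj.partialD i).partialD j).conj]
    simp only [Complex.conj_conj]
    rw [w2, w1, neg_neg]
  obtain ⟨g1, h1⟩ := key 0 0 0 0
  obtain ⟨g2, h2⟩ := key 1 1 1 1
  obtain ⟨g3, h3⟩ := key 0 1 0 1
  obtain ⟨g4, h4⟩ := key 0 0 1 1
  obtain ⟨g5, h5⟩ := key 1 1 0 0
  refine ⟨g1 + g2 + ((2 * (1 - ν) : ℝ) : ℂ) • g3 + (ν : ℂ) • (g4 + g5), fun u hu => ?_⟩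
  rw [energyForm, h1 u hu, h2 u hu, h3 u hu, h4 u hu, h5 u hu]
  simp only [inner_add_left, inner_smul_left, Complex.conj_ofReal]
  push_cast
  ring

theorem IsWeakSolution.unique {ΓD ΓN ΓM : Set Plane} {ν : ℝ} {u f g : L2 Ω}
    (hΓ : IsBoundaryDecomposition (Ω : Set Plane) ΓD ΓN ΓM)
    (h : IsWeakSolution Ω ΓD ΓM ν u f) (h' : IsWeakSolution Ω ΓD ΓM ν u g) : f = g := by
  obtain ⟨w, hw, e⟩ := h
  obtain ⟨w', hw', e'⟩ := h'
  refine eq_of_forall_test fun φ hφ hs => ?_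
  have hc : IsTest (fun x => (starRingEnd ℂ) (φ x)) := hφ.conj
  have hcs := (tsupport_conj_subset φ).trans hs
  have hm := test_mem_energySpace hΓ hc hcs
  have i : ∀ k : L2 Ω,
      inner ℂ ((hc.memLp (volume.restrict (Ω : Set Plane))).toLp _) k =
        ∫ x in (Ω : Set Plane), k x * φ x := by
    intro k
    rw [inner_test hc]
    simp only [Complex.conj_conj]
  rw [← i, ← i]
  obtain ⟨q, hq⟩ := energyForm_test ν hc hcs
  have l : ∀ (x : ℕ → L2 Ω), FormTendsto Ω ΓD ΓM ν x u →
      Tendsto (fun n => energyForm ν (x n)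
        ((hc.memLp (volume.restrict (Ω : Set Plane))).toLp _)) atTop (𝓝 (inner ℂ q u)) :=
    fun x hx => (tendsto_const_nhds.inner hx.tendsto).congr fun n => (hq _ (hx.mem n).1).symm
  rw [tendsto_nhds_unique (e _ hm) (l w hw), tendsto_nhds_unique (e' _ hm) (l w' hw')]

/-- The operator of the plate problem: the operator in `L²(Ω)` associated with the closure `ā`
of the form `a` on the energy space. Its domain is the set of all `u` in the domain of `ā` for
which some `f ∈ L²(Ω)` satisfies `ā(u,v) = (f,v)` for all `v` in the energy space, and it maps
`u` to this `f`. The conditions on the traction-free part are natural and enter through the form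
only. -/
def plateOperator {ΓD ΓN ΓM : Set Plane}
    (hΓ : IsBoundaryDecomposition (Ω : Set Plane) ΓD ΓN ΓM) {ν : ℝ}
    (hν : ν ∈ Ico (0 : ℝ) (1 / 2)) : L2 Ω →ₗ.[ℂ] L2 Ω where
  domain :=
    { carrier := {u | ∃ f, IsWeakSolution Ω ΓD ΓM ν u f}
      add_mem' := fun ⟨_, h⟩ ⟨_, h'⟩ => ⟨_, h.add hν h'⟩
      zero_mem' := ⟨0, IsWeakSolution.zero ΓD ΓM ν⟩
      smul_mem' := fun c _ ⟨_, h⟩ => ⟨_, h.smul c⟩ }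
  toFun :=
    { toFun := fun u => u.2.choose
      map_add' := fun u v => IsWeakSolution.unique hΓ (u + v).2.choose_spec
        (u.2.choose_spec.add hν v.2.choose_spec)
      map_smul' := fun c u => IsWeakSolution.unique hΓ (c • u).2.choose_spec
        (u.2.choose_spec.smul c) }

end

end Plate

/-!
# Discreteness of the spectrum of a plate with a peak

The form `a(u,u) + ‖u‖²` is an inner product on the energy space, so `-1` belongs to the resolvent
set of the plate operator, and the resolvent there is `P P†`, where `P` is the projection of the
form domain to `L²(Ω)` (`hasDiscreteSpectrum_plateOperator`). Once `P` is compact, the spectrum is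
discrete by the theory of compact symmetric operators
(`hasDiscreteSpectrum_of_isCompactOperator`). It remains to prove that the unit ball of the form is
totally bounded in `L²(Ω)` (`totallyBounded_energyBall`). Because `ν < 1/2`, the form controls the
second derivatives (`sqNormH2_le`); it need not control the first derivatives on all of `Ω`.

The mass of a function in the ball is small, uniformly on the ball, outside a compact subset of `Ω`.

* In the tail of the peak, a function that vanishes on one side satisfies
  `∫ |u|² ≤ 8 ∫ H² |∂₂u|²` by the Friedrichs inequality on the vertical fibres
  (`IsRegularPeak.lintegral_le_of_zeroTrace`). Along the curves `x₂ = t H(x₁)`, which fill the peak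
  as `t` runs through `(-1, 1)`, the one-dimensional Hardy inequality for the weight `H` and
  `Φ(y) = ∫_R^y 1/H` controls `∫ |∂₂u|² / (H² Φ²)` by the second derivatives; here `H'` has to be
  bounded (`IsRegularPeak.exists_hardy_bound`). The hypothesis on `H` says that `1 / (4 H⁴ Φ²)`
  tends to infinity, that is, that `H²` is small against the weight `1 / (H² Φ²)`
  (`exists_tail_bound`).
* Along the smooth boundary, a layer of thickness `δ` carries mass of order `δ`, because on the
  transversal lines the supremum of `u` is controlled by `u` and its second derivative
  (`exists_boundary_layer`). No boundary condition is needed for this.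

What remains is covered by finitely many squares whose closures lie in `Ω`. There bounded sets of
`H²` are precompact in `L²`: smooth approximations are equicontinuous with bounds that depend only
on the `H²` norm (`exists_mem_ultrafilter_square`).

Estimates are proved for the convolutions with mollifiers, as inequalities between lower Lebesgue
integrals with values in `ℝ≥0∞`, and pass to the limit on compact subsets of `Ω`.
-/

namespace Plate

/-! ### Operators with compact resolvent -/

section CompactResolvent

variable {X : Type*} [NormedAddCommGroup X] [InnerProductSpace ℂ X] [CompleteSpace X]

/-- On the orthogonal complement of the eigenspace of `μ` the operator `T - μ` is invertible by
the Fredholm alternative, and invertibility is an open condition. -/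
theorem eventually_not_hasEigenvalue {T : X →L[ℂ] X} (hc : IsCompactOperator T)
    (hs : (T : X →ₗ[ℂ] X).IsSymmetric) {μ : ℂ} (hμ : μ ≠ 0) :
    ∀ᶠ w in 𝓝 μ, w ≠ μ → ¬ Module.End.HasEigenvalue (T : Module.End ℂ X) w := by
  set M : Submodule ℂ X := (Module.End.eigenspace (T : Module.End ℂ X) μ)ᗮ with hM
  have hinv : ∀ x ∈ M, T x ∈ M := hs.invariant_orthogonalComplement_eigenspace μ
  let S : M →L[ℂ] M := T.restrict hinv
  have hSc : IsCompactOperator S := hc.restrict' hinv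
  have hSv : ∀ x : M, ((S x : M) : X) = T x := fun x => rfl
  have hno : ¬ Module.End.HasEigenvalue (S : Module.End ℂ M) μ := by
    intro h
    obtain ⟨x, hx⟩ := h.exists_hasEigenvector
    have h1 : T (x : X) = μ • (x : X) := by
      have := congrArg (Subtype.val) hx.apply_eq_smul
      simpa [hSv] using this
    have h2 : (x : X) ∈ Module.End.eigenspace (T : Module.End ℂ X) μ :=
      Module.End.mem_eigenspace_iff.2 h1
    have h3 : inner ℂ (x : X) (x : X) = 0 := (Submodule.mem_orthogonal _ _).1 x.2 _ h2
    exact hx.2 (Subtype.ext (inner_self_eq_zero.1 h3))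
  have hres := (hSc.hasEigenvalue_or_mem_resolventSet hμ).resolve_left hno
  filter_upwards [(spectrum.isOpen_resolventSet (𝕜 := ℂ) S).mem_nhds hres] with w hw hne hev
  obtain ⟨x, hx⟩ := hev.exists_hasEigenvector
  have hxM : x ∈ M := by
    rw [hM, Submodule.mem_orthogonal]
    intro y hy
    exact hs.orthogonalFamily_eigenspaces hne.symm ⟨y, hy⟩ ⟨x, hx.1⟩
  have hx0 : (⟨x, hxM⟩ : M) ≠ 0 := fun h => hx.2 (congrArg Subtype.val h)
  have : Module.End.HasEigenvalue (S : Module.End ℂ M) w := by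
    refine Module.End.hasEigenvalue_of_hasEigenvector (x := ⟨x, hxM⟩)
      ⟨Module.End.mem_eigenspace_iff.2 (Subtype.ext ?_), hx0⟩
    exact hx.apply_eq_smul
  have h1 := this.mem_spectrum
  rw [← ContinuousLinearMap.spectrum_eq] at h1
  exact h1 hw

/-- If `(A + 1)⁻¹` is a compact symmetric operator `T`, then `z ≠ -1` lies in the spectrum of `A`
only if `(1 + z)⁻¹` is an eigenvalue of `T`. -/
theorem hasDiscreteSpectrum_of_isCompactOperator (A : X →ₗ.[ℂ] X) (T : X →L[ℂ] X)
    (hc : IsCompactOperator T) (hs : (T : X →ₗ[ℂ] X).IsSymmetric)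
    (h1 : ∀ f : X, ∃ h : T f ∈ A.domain, A ⟨T f, h⟩ + T f = f)
    (h2 : ∀ u : A.domain, T (A u + u) = u) : HasDiscreteSpectrum A := by
  have hneg : (-1 : ℂ) ∈ resolventSet A := by
    refine ⟨T, fun f => ?_, fun u => ?_⟩
    · obtain ⟨h, e⟩ := h1 f
      exact ⟨h, by simpa using e⟩
    · simpa using h2 u
  have hres : ∀ z : ℂ, 1 + z ≠ 0 → (1 + z)⁻¹ ∈ _root_.resolventSet ℂ T →
      z ∈ resolventSet A := by
    intro z hz hr
    set c : ℂ := 1 + z with hcz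
    obtain ⟨U, hU⟩ := hr
    have e1 : ∀ x : X, c⁻¹ • (U⁻¹.1 x) - T (U⁻¹.1 x) = x := by
      intro x
      have : (U.1 * U⁻¹.1) x = x := by rw [U.mul_inv]; rfl
      rw [hU] at this
      simpa [Algebra.algebraMap_eq_smul_one] using this
    have e2 : ∀ x : X, U⁻¹.1 (c⁻¹ • x - T x) = x := by
      intro x
      have : (U⁻¹.1 * U.1) x = x := by rw [U.inv_mul]; rfl
      rw [hU] at this
      simpa [Algebra.algebraMap_eq_smul_one] using this
    refine ⟨c⁻¹ • (T ∘L U⁻¹.1), fun f => ?_, fun u => ?_⟩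
    · obtain ⟨h, e⟩ := h1 (c⁻¹ • U⁻¹.1 f)
      have hT : (c⁻¹ • (T ∘L U⁻¹.1)) f = T (c⁻¹ • U⁻¹.1 f) := by simp
      have h' : (c⁻¹ • (T ∘L U⁻¹.1)) f ∈ A.domain := hT ▸ h
      refine ⟨h', ?_⟩
      have e3 : A ⟨(c⁻¹ • (T ∘L U⁻¹.1)) f, h'⟩ = A ⟨T (c⁻¹ • U⁻¹.1 f), h⟩ :=
        congrArg A (Subtype.ext hT)
      have hz' : z = c - 1 := by rw [hcz]; ring
      rw [e3, hT, eq_sub_of_add_eq e, hz', map_smul, sub_smul, smul_smul, mul_inv_cancel₀ hz]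
      have := e1 f
      rw [one_smul]
      linear_combination (norm := module) this
    · have hk : A u - z • (u : X) = (A u + u) - c • (u : X) := by
        rw [hcz]; module
      have : c⁻¹ • (A u + u : X) - T (A u + u) = c⁻¹ • (A u - z • (u : X)) := by
        rw [h2, hk, smul_sub, smul_smul, inv_mul_cancel₀ hz, one_smul]
      have h4 := e2 (A u + u)
      rw [this, map_smul] at h4
      change c⁻¹ • T (U⁻¹.1 _) = _
      rw [← map_smul, h4, h2]
  have key : ∀ z ∈ spectrum A, 1 + z ≠ 0 ∧
      Module.End.HasEigenvalue (T : Module.End ℂ X) (1 + z)⁻¹ := by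
    intro z hz
    have h0 : 1 + z ≠ 0 := by
      intro h
      rw [eq_neg_of_add_eq_zero_right h] at hz
      exact hz hneg
    exact ⟨h0, (hc.hasEigenvalue_or_mem_resolventSet (inv_ne_zero h0)).resolve_right
      fun h => hz (hres z h0 h)⟩
  intro z hz
  obtain ⟨h0, hev⟩ := key z hz
  refine ⟨?_, ?_, ?_⟩
  · have hcont : ContinuousAt (fun w : ℂ => (1 + w)⁻¹) z :=
      (continuousAt_const.add continuousAt_id).inv₀ h0
    have := hcont.eventually (eventually_not_hasEigenvalue hc hs (inv_ne_zero h0))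
    obtain ⟨ε, hε, hb⟩ := Metric.eventually_nhds_iff.1 this
    refine ⟨ε, hε, fun w hw hd => ?_⟩
    by_contra hne
    refine hb hd (fun h => hne ?_) (key w hw).2
    exact add_left_cancel (inv_injective h)
  · obtain ⟨x, hx⟩ := hev.exists_hasEigenvector
    have hTx : T ((1 + z) • x) = x := by
      rw [map_smul]
      have : T x = (1 + z)⁻¹ • x := hx.apply_eq_smul
      rw [this, smul_smul, mul_inv_cancel₀ h0, one_smul]
    obtain ⟨h, e⟩ := h1 ((1 + z) • x)
    intro hbot
    have hm : (⟨T ((1 + z) • x), h⟩ : A.domain) ∈ eigenspace A z := by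
      rw [eigenspace, LinearMap.mem_ker]
      change A ⟨T ((1 + z) • x), h⟩ - z • (T ((1 + z) • x)) = 0
      rw [eq_sub_of_add_eq e, hTx]
      module
    rw [hbot, Submodule.mem_bot] at hm
    have := congrArg Subtype.val hm
    exact hx.2 (hTx ▸ this)
  · have := ContinuousLinearMap.finite_dimensional_eigenspace hc _ (inv_ne_zero h0)
    let F : eigenspace A z →ₗ[ℂ] X := A.domain.subtype ∘ₗ (eigenspace A z).subtype
    have hF : ∀ x, F x ∈ Module.End.eigenspace T.toLinearMap (1 + z)⁻¹ := by
      intro x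
      have hx : A x.1 - z • (x.1 : X) = 0 := LinearMap.mem_ker.1 x.2
      have h3 : T (A x.1 + x.1) = x.1 := h2 x.1
      have h4 : z • (x.1 : X) + x.1 = (1 + z) • (x.1 : X) := by module
      rw [sub_eq_zero.1 hx, h4, map_smul] at h3
      rw [Module.End.mem_eigenspace_iff]
      exact (eq_inv_smul_iff₀ h0).2 h3
    refine Module.Finite.of_injective (F.codRestrict _ hF) ?_
    intro x y hxy
    have h3 : (F.codRestrict _ hF x : X) = F.codRestrict _ hF y := by rw [hxy]
    exact Subtype.ext (Subtype.ext h3)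

end CompactResolvent

/-! ### The resolvent of the plate operator -/

section

variable {Ω : TopologicalSpace.Opens Plane}

theorem IsWeakSolution.plateOperator_eq {ΓD ΓN ΓM : Set Plane}
    (hΓ : IsBoundaryDecomposition (Ω : Set Plane) ΓD ΓN ΓM) {ν : ℝ}
    (hν : ν ∈ Ico (0 : ℝ) (1 / 2)) {u f : L2 Ω} (h : IsWeakSolution Ω ΓD ΓM ν u f) :
    ∃ hu : u ∈ (plateOperator hΓ hν).domain, plateOperator hΓ hν ⟨u, hu⟩ = f := by
  have hu : u ∈ (plateOperator hΓ hν).domain := ⟨f, h⟩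
  exact ⟨hu, IsWeakSolution.unique hΓ hu.choose_spec h⟩

theorem isWeakSolution_plateOperator {ΓD ΓN ΓM : Set Plane}
    (hΓ : IsBoundaryDecomposition (Ω : Set Plane) ΓD ΓN ΓM) {ν : ℝ}
    (hν : ν ∈ Ico (0 : ℝ) (1 / 2)) (u : (plateOperator hΓ hν).domain) :
    IsWeakSolution Ω ΓD ΓM ν u (plateOperator hΓ hν u) :=
  u.2.choose_spec

/-- The embedding of the energy space into `L²(Ω)⁵` given by
`u ↦ (u, √(1-ν) u₁₁, √(1-ν) u₂₂, √ν (u₁₁ + u₂₂), √(2(1-ν)) u₁₂)`; it carries the inner product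
`a(u,v) + (u,v)` to the one of `L²(Ω)⁵`. -/
noncomputable def energyEmbedding (Ω : TopologicalSpace.Opens Plane) (ΓD ΓM : Set Plane)
    (ν : ℝ) : energySpace Ω ΓD ΓM →ₗ[ℂ] PiLp 2 (fun _ : Fin 5 => L2 Ω) where
  toFun u := WithLp.toLp 2 ![(u : L2 Ω), ((√(1 - ν) : ℝ) : ℂ) • pd 0 (pd 0 (u : L2 Ω)),
    ((√(1 - ν) : ℝ) : ℂ) • pd 1 (pd 1 (u : L2 Ω)),
    ((√ν : ℝ) : ℂ) • (pd 0 (pd 0 (u : L2 Ω)) + pd 1 (pd 1 (u : L2 Ω))),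
    ((√(2 * (1 - ν)) : ℝ) : ℂ) • pd 0 (pd 1 (u : L2 Ω))]
  map_add' u v := by
    ext i : 1
    fin_cases i <;> simp [u.2.1.pd2_add v.2.1]
    all_goals abel
  map_smul' c u := by
    ext i : 1
    fin_cases i <;> simp [u.2.1.pd2_smul, -Complex.coe_smul]
    all_goals module

theorem inner_energyEmbedding {ΓD ΓM : Set Plane} {ν : ℝ} (hν : ν ∈ Ico (0 : ℝ) (1 / 2))
    (u v : energySpace Ω ΓD ΓM) :
    inner ℂ (energyEmbedding Ω ΓD ΓM ν v) (energyEmbedding Ω ΓD ΓM ν u) =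
      energyForm ν (u : L2 Ω) v + inner ℂ (v : L2 Ω) u := by
  have h1 : ∀ t : ℝ, 0 ≤ t → ∀ z : ℂ, ((√t : ℝ) : ℂ) * (((√t : ℝ) : ℂ) * z) = t * z := by
    intro t ht z
    rw [← mul_assoc, ← Complex.ofReal_mul, Real.mul_self_sqrt ht]
  have ha : 0 ≤ 1 - ν := by linarith [hν.2]
  have hb : 0 ≤ 2 * (1 - ν) := by linarith
  simp only [energyEmbedding, LinearMap.coe_mk, AddHom.coe_mk, PiLp.inner_apply,
    Fin.sum_univ_five]
  simp only [Matrix.cons_val, inner_smul_left, inner_smul_right, Complex.conj_ofReal,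
    h1 _ ha, h1 _ hb, inner_add_left, inner_add_right, energyForm]
  have h2 : ((√ν : ℝ) : ℂ) ^ 2 = ν := by
    rw [← Complex.ofReal_pow, Real.sq_sqrt hν.1]
  push_cast
  linear_combination (inner ℂ (pd 0 (pd 0 (v : L2 Ω))) (pd 0 (pd 0 (u : L2 Ω))) +
    inner ℂ (pd 1 (pd 1 (v : L2 Ω))) (pd 1 (pd 1 (u : L2 Ω))) +
    inner ℂ (pd 1 (pd 1 (v : L2 Ω))) (pd 0 (pd 0 (u : L2 Ω))) +
    inner ℂ (pd 0 (pd 0 (v : L2 Ω))) (pd 1 (pd 1 (u : L2 Ω)))) * h2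

theorem norm_energyEmbedding {ΓD ΓM : Set Plane} {ν : ℝ} (hν : ν ∈ Ico (0 : ℝ) (1 / 2))
    (u : energySpace Ω ΓD ΓM) :
    ‖energyEmbedding Ω ΓD ΓM ν u‖ ^ 2 = energy ν (u : L2 Ω) + ‖(u : L2 Ω)‖ ^ 2 := by
  rw [← inner_self_eq_norm_sq (𝕜 := ℂ), ← inner_self_eq_norm_sq (𝕜 := ℂ) (u : L2 Ω),
    inner_energyEmbedding hν]
  rfl

/-- The form is nonnegative, so `-1` is in the resolvent set of the operator, and the resolvent is
`P P†`, where `P` is the projection to the first component on the closure of the range of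
`energyEmbedding`. If the unit ball of the form is precompact in `L²(Ω)`, then `P` is compact. -/
theorem hasDiscreteSpectrum_plateOperator {ΓD ΓN ΓM : Set Plane}
    (hΓ : IsBoundaryDecomposition (Ω : Set Plane) ΓD ΓN ΓM) {ν : ℝ}
    (hν : ν ∈ Ico (0 : ℝ) (1 / 2))
    (htb : TotallyBounded {u : L2 Ω | u ∈ energySpace Ω ΓD ΓM ∧ energy ν u + ‖u‖ ^ 2 ≤ 1}) :
    HasDiscreteSpectrum (plateOperator hΓ hν) := by
  set J := energyEmbedding Ω ΓD ΓM ν with hJ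
  let G : Submodule ℂ (PiLp 2 (fun _ : Fin 5 => L2 Ω)) := (LinearMap.range J).topologicalClosure
  let P : G →L[ℂ] L2 Ω := (PiLp.proj 2 (fun _ : Fin 5 => L2 Ω) 0).comp G.subtypeL
  have hP : ∀ g : G, P g = (g : PiLp 2 (fun _ : Fin 5 => L2 Ω)) 0 := fun _ => rfl
  have hJ0 : ∀ u, J u 0 = (u : L2 Ω) := fun _ => rfl
  have hJG : ∀ u, J u ∈ G := fun u => subset_closure ⟨u, rfl⟩
  have happ : ∀ g ∈ G, ∃ w : ℕ → energySpace Ω ΓD ΓM, Tendsto (fun n => J (w n)) atTop (𝓝 g) := by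
    intro g hg
    obtain ⟨x, hx, hl⟩ := mem_closure_iff_seq_limit.1 hg
    choose w hw using hx
    exact ⟨w, by simpa only [hw] using hl⟩
  have hproj : Continuous fun g : PiLp 2 (fun _ : Fin 5 => L2 Ω) => g 0 :=
    (PiLp.proj (𝕜 := ℂ) 2 (fun _ : Fin 5 => L2 Ω) 0).continuous
  have hnorm : ∀ u : energySpace Ω ΓD ΓM, ‖J u‖ ^ 2 = energy ν (u : L2 Ω) + ‖(u : L2 Ω)‖ ^ 2 :=
    norm_energyEmbedding hν
  have hPc : IsCompactOperator P := by
    refine (isCompactOperator_iff_isCompact_closure_image_ball (P : G →ₗ[ℂ] L2 Ω)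
      zero_lt_one).2 ?_
    refine isCompact_iff_totallyBounded_isComplete.2
      ⟨TotallyBounded.closure ?_, isClosed_closure.isComplete⟩
    refine htb.closure.subset ?_
    rintro _ ⟨g, hg, rfl⟩
    obtain ⟨w, hw⟩ := happ g g.2
    have hlt : ∀ᶠ n in atTop, ‖J (w n)‖ < 1 := by
      refine (hw.norm).eventually (gt_mem_nhds ?_)
      simpa using hg
    refine mem_closure_of_tendsto ((hproj.tendsto _).comp hw) ?_
    filter_upwards [hlt] with n hn
    refine ⟨(w n).2, ?_⟩
    change energy ν ((w n : L2 Ω)) + ‖(w n : L2 Ω)‖ ^ 2 ≤ 1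
    rw [← hnorm]
    exact pow_le_one₀ (norm_nonneg _) hn.le
  set Pa : L2 Ω →L[ℂ] G := ContinuousLinearMap.adjoint P with hPa
  refine hasDiscreteSpectrum_of_isCompactOperator _ (P ∘L Pa) (hPc.comp_clm _) ?_ ?_ ?_
  · intro x y
    change inner ℂ (P (Pa x)) y = inner ℂ x (P (Pa y))
    rw [hPa, ← ContinuousLinearMap.adjoint_inner_right, ContinuousLinearMap.adjoint_inner_left]
  · intro f
    obtain ⟨w, hw⟩ := happ (Pa f) (Pa f).2
    have hsol : IsWeakSolution Ω ΓD ΓM ν (P (Pa f)) (f - P (Pa f)) := by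
      have hl : Tendsto (fun n => (w n : L2 Ω)) atTop (𝓝 (P (Pa f))) :=
        (hproj.tendsto _).comp hw
      refine ⟨fun n => w n, ⟨fun n => (w n).2, hl, ?_⟩, fun v hv => ?_⟩
      · have h1 : Tendsto (fun p : ℕ × ℕ => J (w p.1) - J (w p.2)) atTop (𝓝 0) := by
          rw [← sub_self ((Pa f : G) : PiLp 2 (fun _ : Fin 5 => L2 Ω)), ← prod_atTop_atTop_eq]
          exact (hw.comp tendsto_fst).sub (hw.comp tendsto_snd)
        have h2 : Tendsto (fun p : ℕ × ℕ => ‖J (w p.1) - J (w p.2)‖ ^ 2) atTop (𝓝 0) := by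
          simpa using h1.norm.pow 2
        refine squeeze_zero (fun p => energy_nonneg hν _) (fun p => ?_) h2
        rw [← map_sub, hnorm]
        exact le_add_of_nonneg_right (sq_nonneg _)
      · have h1 : Tendsto (fun n => inner ℂ (J ⟨v, hv⟩) (J (w n)) - inner ℂ v (w n : L2 Ω)) atTop
            (𝓝 (inner ℂ (J ⟨v, hv⟩) ((Pa f : G) : PiLp 2 (fun _ : Fin 5 => L2 Ω)) -
              inner ℂ v (P (Pa f)))) :=
          (tendsto_const_nhds.inner hw).sub (tendsto_const_nhds.inner hl)
        have h2 : inner ℂ (J ⟨v, hv⟩) ((Pa f : G) : PiLp 2 (fun _ : Fin 5 => L2 Ω)) =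
            inner ℂ v f := by
          have := ContinuousLinearMap.adjoint_inner_right P (⟨J ⟨v, hv⟩, hJG _⟩ : G) f
          exact this
        rw [h2, ← inner_sub_right] at h1
        refine h1.congr fun n => ?_
        rw [inner_energyEmbedding hν]
        simp
    obtain ⟨h, e⟩ := hsol.plateOperator_eq hΓ hν
    exact ⟨h, by
      change plateOperator hΓ hν ⟨P (Pa f), h⟩ + P (Pa f) = f
      rw [e, sub_add_cancel]⟩
  · intro u
    obtain ⟨w, hw, hv⟩ := isWeakSolution_plateOperator hΓ hν u
    set f := plateOperator hΓ hν u with hf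
    let w' : ℕ → energySpace Ω ΓD ΓM := fun n => ⟨w n, hw.mem n⟩
    have hcau : CauchySeq fun n => J (w' n) := by
      rw [cauchySeq_iff_tendsto_dist_atTop_0]
      have h1 : Tendsto (fun p : ℕ × ℕ => ‖w p.1 - w p.2‖ ^ 2) atTop (𝓝 0) := by
        have := (cauchySeq_iff_tendsto_dist_atTop_0.1 hw.tendsto.cauchySeq).pow 2
        simpa [dist_eq_norm] using this
      have h2 := (hw.cauchy.add h1).sqrt
      simp only [add_zero, Real.sqrt_zero] at h2
      refine h2.congr fun p => ?_
      rw [dist_eq_norm, ← map_sub, ← Real.sqrt_sq (norm_nonneg (J _)), hnorm]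
      rfl
    obtain ⟨g, hg⟩ := cauchySeq_tendsto_of_complete hcau
    have hgG : g ∈ G := mem_closure_of_tendsto hg (Eventually.of_forall fun n => ⟨_, rfl⟩)
    have hg0 : g 0 = (u : L2 Ω) :=
      tendsto_nhds_unique ((hproj.tendsto _).comp hg) hw.tendsto
    have hgP : Pa (f + u) = ⟨g, hgG⟩ := by
      have hin : ∀ k ∈ G, inner ℂ k g = inner ℂ (k 0) (f + (u : L2 Ω)) := by
        intro k hk
        obtain ⟨v, hvk⟩ := happ k hk
        have hJv : ∀ v : energySpace Ω ΓD ΓM,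
            inner ℂ (J v) g = inner ℂ (v : L2 Ω) (f + (u : L2 Ω)) := by
          intro v
          have h1 : Tendsto (fun n => inner ℂ (J v) (J (w' n))) atTop (𝓝 (inner ℂ (J v) g)) :=
            tendsto_const_nhds.inner hg
          have h2 := (hv v v.2).add (tendsto_const_nhds.inner (x := (v : L2 Ω)) (𝕜 := ℂ) hw.tendsto)
          rw [← inner_add_right] at h2
          refine tendsto_nhds_unique h1 (h2.congr fun n => ?_)
          exact (inner_energyEmbedding hν (w' n) v).symm
        refine tendsto_nhds_unique (hvk.inner tendsto_const_nhds) ?_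
        simp only [hJv]
        exact ((hproj.tendsto _).comp hvk).inner tendsto_const_nhds
      refine ext_inner_left ℂ fun k => ?_
      rw [hPa, ContinuousLinearMap.adjoint_inner_right]
      exact (hin k k.2).symm
    change P (Pa (f + u)) = u
    rw [hgP, hP]
    exact hg0

end

/-! ### Mollification -/

section

theorem eLpNorm_two_sq {α E : Type*} [MeasurableSpace α] [NormedAddCommGroup E] (μ : Measure α)
    (f : α → E) : eLpNorm f 2 μ ^ 2 = ∫⁻ x, ‖f x‖ₑ ^ 2 ∂μ := by
  have := eLpNorm_nnreal_pow_eq_lintegral (μ := μ) (f := f) (p := 2) (by norm_num)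
  simpa using this

/-- The Cauchy–Schwarz inequality against the constant function `1`. -/
theorem sq_lintegral_le {α : Type*} [MeasurableSpace α] (μ : Measure α) {f : α → ℝ≥0∞}
    (hf : AEMeasurable f μ) : (∫⁻ x, f x ∂μ) ^ 2 ≤ μ univ * ∫⁻ x, f x ^ 2 ∂μ := by
  have h := ENNReal.lintegral_mul_le_Lp_mul_Lq μ Real.HolderConjugate.two_two
    (aemeasurable_const (b := (1 : ℝ≥0∞))) hf
  simp only [Pi.mul_apply, one_mul, lintegral_const, ENNReal.rpow_two, one_pow] at h
  calc _ ≤ (μ univ ^ (1 / 2 : ℝ) * (∫⁻ x, f x ^ 2 ∂μ) ^ (1 / 2 : ℝ)) ^ 2 := by gcongr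
    _ = _ := by
      rw [mul_pow, ← ENNReal.rpow_two, ← ENNReal.rpow_two, ← ENNReal.rpow_mul,
        ← ENNReal.rpow_mul]
      norm_num

theorem enorm_add_sq_le {E : Type*} [SeminormedAddCommGroup E] (a b : E) :
    ‖a + b‖ₑ ^ 2 ≤ 2 * ‖a‖ₑ ^ 2 + 2 * ‖b‖ₑ ^ 2 := by
  have h : ‖a + b‖ ^ 2 ≤ 2 * ‖a‖ ^ 2 + 2 * ‖b‖ ^ 2 := by
    nlinarith [norm_add_le a b, norm_nonneg (a + b), sq_nonneg (‖a‖ - ‖b‖), norm_nonneg a,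
      norm_nonneg b]
  have := ENNReal.ofReal_le_ofReal h
  rwa [ENNReal.ofReal_add (by positivity) (by positivity), ENNReal.ofReal_mul zero_le_two,
    ENNReal.ofReal_mul zero_le_two, ENNReal.ofReal_pow (norm_nonneg _),
    ENNReal.ofReal_pow (norm_nonneg _), ENNReal.ofReal_pow (norm_nonneg _), ofReal_norm,
    ofReal_norm, ofReal_norm, ENNReal.ofReal_ofNat] at this

/-- Translation is continuous in `L²`. -/
theorem tendsto_lintegral_translate_sub {g : Plane → ℂ} (hg : MemLp g 2 volume) :
    Tendsto (fun t : Plane => ∫⁻ x, ‖g (x - t) - g x‖ₑ ^ 2) (𝓝 0) (𝓝 0) := by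
  have hm : ∀ t : Plane, MeasurePreserving (fun x : Plane => x - t) volume volume :=
    fun t => measurePreserving_sub_right volume t
  let τ : Plane → C(Plane, Plane) := fun t => ⟨fun x => x - t, by fun_prop⟩
  have hτ : Continuous τ := ContinuousMap.continuous_of_continuous_uncurry _
    (continuous_snd.sub continuous_fst)
  have hc : Continuous fun t => Lp.compMeasurePreserving (τ t) (hm t) (hg.toLp g) :=
    Continuous.compMeasurePreservingLp continuous_const hτ hm (by norm_num)
  have h0 : Lp.compMeasurePreserving (τ 0) (hm 0) (hg.toLp g) = hg.toLp g := by
    rw [Lp.toLp_compMeasurePreserving]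
    exact MemLp.toLp_congr _ _ (ae_of_all _ fun x => by simp [τ])
  have h1 := ((ENNReal.continuous_pow 2).tendsto 0).comp
    (tendsto_iff_edist_tendsto_0.1 (hc.tendsto 0))
  rw [h0] at h1
  simp only [ne_eq, OfNat.ofNat_ne_zero, not_false_eq_true, zero_pow] at h1
  refine h1.congr fun t => ?_
  rw [Function.comp, Lp.toLp_compMeasurePreserving, Lp.edist_toLp_toLp, eLpNorm_two_sq]
  rfl

/-- A sequence of mollifiers, supported in balls of radius `1 / (n + 1)`. -/
noncomputable def bump (n : ℕ) : ContDiffBump (0 : Plane) where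
  rIn := 1 / (2 * (n + 1))
  rOut := 1 / (n + 1)
  rIn_pos := by positivity
  rIn_lt_rOut := by
    apply one_div_lt_one_div_of_lt <;> linarith [(n.cast_nonneg : (0 : ℝ) ≤ n)]

/-- The convolution of the extension by zero of `u` with the `n`-th mollifier. -/
noncomputable def mollify {Ω : TopologicalSpace.Opens Plane} (n : ℕ) (u : L2 Ω) : Plane → ℂ :=
  convolution (indicator (Ω : Set Plane) u) ((bump n).normed volume)
    (ContinuousLinearMap.lsmul ℝ ℝ).flip volume

variable {Ω : TopologicalSpace.Opens Plane}

theorem memLp_indicator (u : L2 Ω) : MemLp (indicator (Ω : Set Plane) u) 2 volume :=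
  (memLp_indicator_iff_restrict Ω.isOpen.measurableSet).2 (Lp.memLp u)

theorem locallyIntegrable_indicator (u : L2 Ω) :
    LocallyIntegrable (indicator (Ω : Set Plane) u) volume :=
  (memLp_indicator u).locallyIntegrable (by norm_num)

theorem contDiff_mollify (n : ℕ) (u : L2 Ω) : ContDiff ℝ ∞ (mollify n u) :=
  (bump n).hasCompactSupport_normed.contDiff_convolution_right _ (locallyIntegrable_indicator u)
    (bump n).contDiff_normed

theorem integral_indicator_mul (u : L2 Ω) (k : Plane → ℝ) :
    ∫ t, k t • indicator (Ω : Set Plane) u t = ∫ t in (Ω : Set Plane), u t * (k t : ℂ) := by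
  rw [← integral_indicator Ω.isOpen.measurableSet]
  refine integral_congr_ae (ae_of_all _ fun t => ?_)
  by_cases h : t ∈ (Ω : Set Plane) <;> simp [h, mul_comm]

theorem mollify_apply (n : ℕ) (u : L2 Ω) (x : Plane) :
    mollify n u x = ∫ t in (Ω : Set Plane), u t * ((bump n).normed volume (x - t) : ℂ) := by
  rw [← integral_indicator_mul u fun t => (bump n).normed volume (x - t)]
  rfl

/-- Differentiation falls on the mollifier, which is a test function supported in `Ω`. -/
theorem partialD_mollify {n : ℕ} {i : Fin 2} {u g : L2 Ω} (h : HasWeakDeriv i u g) {x : Plane}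
    (hx : Metric.closedBall x (1 / (n + 1)) ⊆ (Ω : Set Plane)) :
    partialD i (mollify n u) x = mollify n g x := by
  set ρ := (bump n).normed volume with hρ
  have hsm : ContDiff ℝ ∞ ρ := (bump n).contDiff_normed
  have hcs : HasCompactSupport ρ := (bump n).hasCompactSupport_normed
  have h1 : ContDiff ℝ 1 ρ := (bump n).contDiff_normed (n := 1)
  have hd := hcs.hasFDerivAt_convolution_right (ContinuousLinearMap.lsmul ℝ ℝ).flip
    (locallyIntegrable_indicator u) h1 x
  have e1 : partialD i (mollify n u) x =
      ∫ t in (Ω : Set Plane), u t * (fderiv ℝ ρ (x - t) (EuclideanSpace.single i 1) : ℂ) := by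
    rw [Plate.partialD, mollify, hd.fderiv, convolution_precompR_apply _
      (locallyIntegrable_indicator u) (hcs.fderiv ℝ) (h1.continuous_fderiv one_ne_zero),
      ← integral_indicator_mul u fun t => fderiv ℝ ρ (x - t) (EuclideanSpace.single i 1)]
    rfl
  have hc : ContDiff ℝ ∞ fun t => ρ (x - t) := hsm.comp (contDiff_const.sub contDiff_id)
  have hc' : HasCompactSupport fun t => ρ (x - t) :=
    hcs.comp_homeomorph (Homeomorph.subLeft x)
  have ht : IsTest fun t => ((ρ (x - t) : ℝ) : ℂ) := IsTest.ofReal hc hc'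
  have hs : tsupport (fun t => ((ρ (x - t) : ℝ) : ℂ)) ⊆ (Ω : Set Plane) := by
    refine (tsupport_ofReal_subset _).trans (subset_trans ?_ hx)
    refine closure_minimal (fun t hxt => ?_) Metric.isClosed_closedBall
    have : x - t ∈ Function.support ρ := hxt
    rw [hρ, ContDiffBump.support_normed_eq] at this
    rw [Metric.mem_closedBall, dist_comm, dist_eq_norm]
    exact (mem_ball_zero_iff.1 this).le
  have hp : ∀ t, partialD i (fun t => ((ρ (x - t) : ℝ) : ℂ)) t =
      -(fderiv ℝ ρ (x - t) (EuclideanSpace.single i 1) : ℂ) := by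
    intro t
    have hdiff := (h1.differentiable one_ne_zero (x - t)).hasFDerivAt
    have h2 : HasFDerivAt (fun t => ρ (x - t)) (-(fderiv ℝ ρ (x - t))) t := by
      have := hdiff.comp t ((hasFDerivAt_id t).const_sub x)
      refine this.congr_fderiv ?_
      ext v
      simp
    have h3 := Complex.ofRealCLM.hasFDerivAt.comp t h2
    rw [Plate.partialD]
    have h4 : fderiv ℝ (fun t => ((ρ (x - t) : ℝ) : ℂ)) t = _ := h3.fderiv
    rw [h4]
    simp
  have := h _ ht hs
  simp only [hp, mul_neg, integral_neg, neg_inj] at this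
  rw [e1, this, mollify_apply]

theorem eventually_closedBall_subset {K U : Set Plane} (hK : IsCompact K) (hU : IsOpen U)
    (h : K ⊆ U) : ∀ᶠ n : ℕ in atTop, ∀ x ∈ K, Metric.closedBall x (1 / (n + 1)) ⊆ U := by
  obtain ⟨δ, hδ, hs⟩ := hK.exists_cthickening_subset_open hU h
  have := (tendsto_one_div_add_atTop_nhds_zero_nat (𝕜 := ℝ)).eventually (ge_mem_nhds hδ)
  filter_upwards [this] with n hn x hx
  exact ((Metric.closedBall_subset_closedBall hn).trans
    (Metric.closedBall_subset_cthickening hx _)).trans hs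

theorem eventually_partialD_mollify {K : Set Plane} (hK : IsCompact K)
    (h : K ⊆ (Ω : Set Plane)) : ∀ᶠ n : ℕ in atTop, ∀ x ∈ K, ∀ (i : Fin 2) (u g : L2 Ω),
      HasWeakDeriv i u g → partialD i (mollify n u) x = mollify n g x :=
  (eventually_closedBall_subset hK Ω.isOpen h).mono
    fun _ hn x hx _ _ _ hw => partialD_mollify hw (hn x hx)

theorem eventually_partialD_partialD_mollify {K : Set Plane} (hK : IsCompact K)
    (h : K ⊆ (Ω : Set Plane)) : ∀ᶠ n : ℕ in atTop, ∀ x ∈ K, ∀ (i j : Fin 2) (u g k : L2 Ω),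
      HasWeakDeriv i u g → HasWeakDeriv j g k →
      partialD j (partialD i (mollify n u)) x = mollify n k x := by
  obtain ⟨δ, hδ, hs⟩ := hK.exists_cthickening_subset_open Ω.isOpen h
  filter_upwards [eventually_partialD_mollify hK.cthickening hs] with n hn x hx i j u g k hu hg
  have he : partialD i (mollify n u) =ᶠ[𝓝 x] mollify n g := by
    filter_upwards [Metric.closedBall_mem_nhds x hδ] with y hy
    exact hn y (Metric.closedBall_subset_cthickening hx _ hy) i u g hu
  have : partialD j (partialD i (mollify n u)) x = partialD j (mollify n g) x := by
    rw [Plate.partialD, he.fderiv_eq]; rfl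
  rw [this]
  exact hn x (Metric.self_subset_cthickening _ hx) j g k hg

/-- Mollification converges in `L²`. By the Cauchy–Schwarz inequality the error is at most the
average of the errors of the translations by the vectors in the support of the mollifier. -/
theorem tendsto_mollify (u : L2 Ω) :
    Tendsto (fun n => ∫⁻ x in (Ω : Set Plane), ‖mollify n u x - u x‖ₑ ^ 2) atTop (𝓝 0) := by
  set g := indicator (Ω : Set Plane) u with hgdef
  have hg : MemLp g 2 volume := memLp_indicator u
  have hgm : AEStronglyMeasurable g volume := hg.1
  rw [ENNReal.tendsto_nhds_zero]
  intro ε hε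
  obtain ⟨δ, hδ, hb⟩ := Metric.eventually_nhds_iff.1
    (ENNReal.tendsto_nhds_zero.1 (tendsto_lintegral_translate_sub hg) ε hε)
  have hn := (tendsto_one_div_add_atTop_nhds_zero_nat (𝕜 := ℝ)).eventually (gt_mem_nhds hδ)
  filter_upwards [hn] with n hn
  set ρ := (bump n).normed volume with hρ
  have hρ0 : ∀ t, 0 ≤ ρ t := (bump n).nonneg_normed
  have hρc : Continuous ρ := (bump n).continuous_normed
  set w : Measure Plane := volume.withDensity fun t => ENNReal.ofReal (ρ t) with hw
  have hwm : Measurable fun t => ENNReal.ofReal (ρ t) := (hρc.measurable).ennreal_ofReal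
  have hw1 : w univ = 1 := by
    rw [hw, withDensity_apply _ MeasurableSet.univ, Measure.restrict_univ,
      ← ofReal_integral_eq_lintegral_ofReal (bump n).integrable_normed (ae_of_all _ hρ0),
      (bump n).integral_normed, ENNReal.ofReal_one]
  have hsubm : AEStronglyMeasurable (fun p : Plane × Plane => g (p.1 - p.2) - g p.1)
      (volume.prod volume) :=
    (hgm.comp_quasiMeasurePreserving (quasiMeasurePreserving_sub volume volume)).sub hgm.comp_fst
  have hac : (volume : Measure Plane).prod w ≪ volume.prod volume :=
    Measure.AbsolutelyContinuous.rfl.prod (withDensity_absolutelyContinuous _ _)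
  have hpoint : ∀ x, ‖mollify n u x - g x‖ₑ ^ 2 ≤ ∫⁻ t, ‖g (x - t) - g x‖ₑ ^ 2 ∂w := by
    intro x
    have hex : Integrable (fun t => ρ t • g (x - t)) := by
      have := (bump n).hasCompactSupport_normed.convolutionExists_left (μ := volume)
        (ContinuousLinearMap.lsmul ℝ ℝ) hρc (locallyIntegrable_indicator u) x
      exact this
    have e1 : mollify n u x = ∫ t, ρ t • g (x - t) := by
      rw [mollify, convolution_flip]
      rfl
    have e2 : mollify n u x - g x = ∫ t, ρ t • (g (x - t) - g x) := by
      have hi : Integrable (fun t => ρ t • g x) := (bump n).integrable_normed.smul_const _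
      simp only [smul_sub]
      rw [integral_sub hex hi, ← e1, hρ, (bump n).integral_normed_smul]
    have hmx : AEStronglyMeasurable (fun t => g (x - t) - g x) volume :=
      (hgm.comp_quasiMeasurePreserving
        (quasiMeasurePreserving_sub_left volume x)).sub aestronglyMeasurable_const
    have hmw := hmx.mono_ac (withDensity_absolutelyContinuous volume
      fun t => ENNReal.ofReal (ρ t))
    calc ‖mollify n u x - g x‖ₑ ^ 2 ≤ (∫⁻ t, ‖ρ t • (g (x - t) - g x)‖ₑ) ^ 2 := by
          rw [e2]
          gcongr
          exact enorm_integral_le_lintegral_enorm _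
      _ = (∫⁻ t, ‖g (x - t) - g x‖ₑ ∂w) ^ 2 := by
          rw [hw, lintegral_withDensity_eq_lintegral_mul₀ hwm.aemeasurable hmx.enorm]
          congr 1
          refine lintegral_congr fun t => ?_
          rw [Pi.mul_apply, enorm_smul, Real.enorm_of_nonneg (hρ0 t)]
      _ ≤ _ := by
          have := sq_lintegral_le w hmw.enorm
          rwa [hw1, one_mul] at this
  calc ∫⁻ x in (Ω : Set Plane), ‖mollify n u x - u x‖ₑ ^ 2
      = ∫⁻ x in (Ω : Set Plane), ‖mollify n u x - g x‖ₑ ^ 2 := by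
        refine setLIntegral_congr_fun Ω.isOpen.measurableSet fun x hx => ?_
        simp only [hgdef, indicator_of_mem hx]
    _ ≤ ∫⁻ x, ‖mollify n u x - g x‖ₑ ^ 2 := setLIntegral_le_lintegral _ _
    _ ≤ ∫⁻ x, ∫⁻ t, ‖g (x - t) - g x‖ₑ ^ 2 ∂w := lintegral_mono hpoint
    _ = ∫⁻ t, (∫⁻ x, ‖g (x - t) - g x‖ₑ ^ 2) ∂w := by
        have : SFinite w := by rw [hw]; infer_instance
        exact lintegral_lintegral_swap (f := fun x t => ‖g (x - t) - g x‖ₑ ^ 2)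
          (((hsubm.mono_ac hac).enorm).pow_const 2)
    _ ≤ ∫⁻ t, ε ∂w := by
        have hmem : ∀ᵐ t ∂w, ‖t‖ < δ := by
          rw [hw, ae_withDensity_iff hwm]
          refine ae_of_all _ fun t ht => ?_
          have : t ∈ Function.support ρ := fun h => ht (by simp [h])
          rw [hρ, ContDiffBump.support_normed_eq] at this
          exact (mem_ball_zero_iff.1 this).trans hn
        refine lintegral_mono_ae (hmem.mono fun t ht => hb ?_)
        rwa [dist_zero_right]
    _ = ε := by rw [lintegral_const, hw1, mul_one]

/-- If `φₙ → u` in `L²(Ω)`, then the squared norms converge for every measure that is bounded by a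
multiple of Lebesgue measure on `Ω`. -/
theorem tendsto_lintegral_sq {φ : ℕ → Plane → ℂ} {u : L2 Ω}
    (hφ : ∀ n, Continuous (φ n))
    (h : Tendsto (fun n => ∫⁻ x in (Ω : Set Plane), ‖φ n x - u x‖ₑ ^ 2) atTop (𝓝 0))
    {μ : Measure Plane} {c : ℝ≥0∞} (hc : c ≠ ⊤)
    (hμ : μ ≤ c • volume.restrict (Ω : Set Plane)) :
    Tendsto (fun n => ∫⁻ x, ‖φ n x‖ₑ ^ 2 ∂μ) atTop (𝓝 (∫⁻ x, ‖u x‖ₑ ^ 2 ∂μ)) := by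
  have hac : μ ≪ volume.restrict (Ω : Set Plane) :=
    (Measure.absolutelyContinuous_of_le hμ).trans (Measure.smul_absolutelyContinuous)
  have hum : AEStronglyMeasurable u μ := (Lp.aestronglyMeasurable u).mono_ac hac
  have hufin : eLpNorm u 2 μ ≠ ⊤ := by
    have h1 : MemLp u 2 (c • volume.restrict (Ω : Set Plane)) := (Lp.memLp u).smul_measure hc
    exact (h1.mono_measure hμ).eLpNorm_ne_top
  have h0 : Tendsto (fun n => eLpNorm (fun x => φ n x - u x) 2 μ) atTop (𝓝 0) := by
    have h1 : Tendsto (fun n => ∫⁻ x, ‖φ n x - u x‖ₑ ^ 2 ∂μ) atTop (𝓝 0) := by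
      have h2 := ENNReal.Tendsto.const_mul h (Or.inr hc) (a := c)
      rw [mul_zero] at h2
      refine tendsto_of_tendsto_of_tendsto_of_le_of_le tendsto_const_nhds h2
        (fun _ => zero_le) fun n => ?_
      calc _ ≤ ∫⁻ x, ‖φ n x - u x‖ₑ ^ 2 ∂(c • volume.restrict (Ω : Set Plane)) :=
            lintegral_mono' hμ le_rfl
        _ = _ := lintegral_smul_measure _ _
    have h3 := (ENNReal.continuous_rpow_const (y := (1 / 2 : ℝ))).tendsto 0 |>.comp h1
    rw [ENNReal.zero_rpow_of_pos (by norm_num)] at h3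
    refine h3.congr fun n => ?_
    rw [Function.comp, ← eLpNorm_two_sq, ← ENNReal.rpow_two, ← ENNReal.rpow_mul]
    norm_num
  have h1 : Tendsto (fun n => eLpNorm (φ n) 2 μ) atTop (𝓝 (eLpNorm u 2 μ)) := by
    have hl : Tendsto (fun n => eLpNorm u 2 μ - eLpNorm (fun x => φ n x - u x) 2 μ) atTop
        (𝓝 (eLpNorm u 2 μ)) := by
      simpa using ENNReal.Tendsto.sub (tendsto_const_nhds (x := eLpNorm u 2 μ)) h0 (Or.inl hufin)
    have hr : Tendsto (fun n => eLpNorm u 2 μ + eLpNorm (fun x => φ n x - u x) 2 μ) atTop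
        (𝓝 (eLpNorm u 2 μ)) := by
      simpa using (tendsto_const_nhds (x := eLpNorm u 2 μ)).add h0
    have hφm : ∀ n, AEStronglyMeasurable (φ n) μ := fun n => (hφ n).aestronglyMeasurable
    refine tendsto_of_tendsto_of_tendsto_of_le_of_le hl hr (fun n => ?_) (fun n => ?_)
    · change _ - _ ≤ _
      rw [tsub_le_iff_right]
      have e : (u : Plane → ℂ) = φ n - fun x => φ n x - u x := by ext x; simp
      calc eLpNorm u 2 μ = eLpNorm (φ n - fun x => φ n x - u x) 2 μ := by rw [← e]
        _ ≤ _ := eLpNorm_sub_le (hφm n) ((hφm n).sub hum) (by norm_num)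
    · have e : φ n = (u : Plane → ℂ) + fun x => φ n x - u x := by ext x; simp
      calc eLpNorm (φ n) 2 μ = eLpNorm ((u : Plane → ℂ) + fun x => φ n x - u x) 2 μ := by
            rw [← e]
        _ ≤ _ := eLpNorm_add_le hum ((hφm n).sub hum) (by norm_num)
  have h2 := ((ENNReal.continuous_pow 2).tendsto _).comp h1
  simp only [Function.comp_def, eLpNorm_two_sq] at h2
  exact h2

theorem tendsto_lintegral_mollify (u : L2 Ω) {μ : Measure Plane} {c : ℝ≥0∞} (hc : c ≠ ⊤)
    (hμ : μ ≤ c • volume.restrict (Ω : Set Plane)) :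
    Tendsto (fun n => ∫⁻ x, ‖mollify n u x‖ₑ ^ 2 ∂μ) atTop (𝓝 (∫⁻ x, ‖u x‖ₑ ^ 2 ∂μ)) :=
  tendsto_lintegral_sq (fun n => (contDiff_mollify n u).continuous) (tendsto_mollify u) hc hμ

theorem tendsto_setLIntegral_mollify (u : L2 Ω) {E : Set Plane} (hE : E ⊆ (Ω : Set Plane)) :
    Tendsto (fun n => ∫⁻ x in E, ‖mollify n u x‖ₑ ^ 2) atTop
      (𝓝 (∫⁻ x in E, ‖u x‖ₑ ^ 2)) :=
  tendsto_lintegral_mollify u ENNReal.one_ne_top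
    (by rw [one_smul]; exact Measure.restrict_mono_set _ hE)

end

/-! ### Inequalities on an interval -/

theorem setLIntegral_Ioc_eq_Ioo (a b : ℝ) (F : ℝ → ℝ≥0∞) :
    ∫⁻ t in Ioc a b, F t = ∫⁻ t in Ioo a b, F t :=
  setLIntegral_congr Ioo_ae_eq_Ioc.symm

theorem setLIntegral_Icc_eq_Ioo (a b : ℝ) (F : ℝ → ℝ≥0∞) :
    ∫⁻ t in Icc a b, F t = ∫⁻ t in Ioo a b, F t :=
  setLIntegral_congr Ioo_ae_eq_Icc.symm

theorem enorm_sub_sq_le {f f' : ℝ → ℂ} {a b x y : ℝ} (hf : ∀ t, HasDerivAt f (f' t) t)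
    (hc : Continuous f') (hx : x ∈ Icc a b) (hy : y ∈ Icc a b) :
    ‖f x - f y‖ₑ ^ 2 ≤ ENNReal.ofReal |x - y| * ∫⁻ t in Ioo a b, ‖f' t‖ₑ ^ 2 := by
  wlog hxy : y ≤ x generalizing x y
  · have := this hy hx (le_of_not_ge hxy)
    rwa [← enorm_neg, neg_sub, abs_sub_comm] at this
  have h1 : ∫ t in y..x, f' t = f x - f y :=
    intervalIntegral.integral_eq_sub_of_hasDerivAt (fun t _ => hf t) (hc.intervalIntegrable _ _)
  rw [← h1, intervalIntegral.integral_of_le hxy, abs_of_nonneg (sub_nonneg.2 hxy)]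
  calc _ ≤ (∫⁻ t in Ioc y x, ‖f' t‖ₑ) ^ 2 := by
        gcongr
        exact enorm_integral_le_lintegral_enorm _
    _ ≤ _ := sq_lintegral_le _ (by fun_prop)
    _ = ENNReal.ofReal (x - y) * ∫⁻ t in Ioc y x, ‖f' t‖ₑ ^ 2 := by simp
    _ ≤ _ := by
        rw [← setLIntegral_Icc_eq_Ioo a b]
        gcongr
        exact Ioc_subset_Icc_self.trans (Icc_subset_Icc hy.1 hx.2)

/-- Division of an averaged bound by the length `l` of the interval of averaging. -/
theorem le_of_ofReal_mul_le {X A B : ℝ≥0∞} {l p q C : ℝ} (hl : 0 < l)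
    (h : ENNReal.ofReal l * X ≤ ENNReal.ofReal p * A + ENNReal.ofReal q * B)
    (hpC : p / l ≤ C) (hqC : q / l ≤ C) : X ≤ ENNReal.ofReal C * (A + B) := by
  have hl0 : ENNReal.ofReal l ≠ 0 := by simpa using hl
  have e : X = ENNReal.ofReal l⁻¹ * (ENNReal.ofReal l * X) := by
    rw [← mul_assoc, ← ENNReal.ofReal_mul (by positivity), inv_mul_cancel₀ hl.ne',
      ENNReal.ofReal_one, one_mul]
  rw [e]
  calc _ ≤ ENNReal.ofReal l⁻¹ * (ENNReal.ofReal p * A + ENNReal.ofReal q * B) := by gcongr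
    _ = ENNReal.ofReal (p / l) * A + ENNReal.ofReal (q / l) * B := by
        rw [mul_add, ← mul_assoc, ← mul_assoc, ← ENNReal.ofReal_mul (by positivity),
          ← ENNReal.ofReal_mul (by positivity), div_eq_inv_mul, div_eq_inv_mul]
    _ ≤ ENNReal.ofReal C * A + ENNReal.ofReal C * B := by gcongr
    _ = _ := (mul_add _ _ _).symm

/-- The Sobolev inequality on an interval, with a constant that depends only on bounds for the
length. -/
theorem exists_enorm_sq_le {m M : ℝ} (hm : 0 < m) : ∃ C : ℝ≥0∞, C ≠ ⊤ ∧
    ∀ (a b : ℝ) (f f' : ℝ → ℂ), m ≤ b - a → b - a ≤ M → (∀ t, HasDerivAt f (f' t) t) →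
      Continuous f' → ∀ x ∈ Icc a b,
      ‖f x‖ₑ ^ 2 ≤ C * ((∫⁻ t in Ioo a b, ‖f t‖ₑ ^ 2) + ∫⁻ t in Ioo a b, ‖f' t‖ₑ ^ 2) := by
  refine ⟨ENNReal.ofReal (max (2 / m) (2 * M)), ENNReal.ofReal_ne_top, ?_⟩
  intro a b f f' h1 h2 hf hc x hx
  have hl : 0 < b - a := hm.trans_le h1
  have hfc : Continuous f := continuous_iff_continuousAt.2 fun t => (hf t).continuousAt
  refine le_of_ofReal_mul_le (l := b - a) (p := 2) (q := 2 * (b - a) ^ 2) hl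
    ?_ (le_max_of_le_left (by gcongr)) (le_max_of_le_right ?_)
  · set B := ∫⁻ t in Ioo a b, ‖f' t‖ₑ ^ 2
    calc ENNReal.ofReal (b - a) * ‖f x‖ₑ ^ 2 = ∫⁻ _ in Ioo a b, ‖f x‖ₑ ^ 2 := by
          rw [setLIntegral_const, Real.volume_Ioo, mul_comm]
      _ ≤ ∫⁻ t in Ioo a b, (2 * ‖f t‖ₑ ^ 2 + 2 * (ENNReal.ofReal (b - a) * B)) := by
          refine setLIntegral_mono (by fun_prop) fun t ht => ?_
          have e : f x = f t + (f x - f t) := by ring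
          calc ‖f x‖ₑ ^ 2 = ‖f t + (f x - f t)‖ₑ ^ 2 := by rw [← e]
            _ ≤ 2 * ‖f t‖ₑ ^ 2 + 2 * ‖f x - f t‖ₑ ^ 2 := enorm_add_sq_le _ _
            _ ≤ _ := by
              gcongr
              refine (enorm_sub_sq_le hf hc hx (Ioo_subset_Icc_self ht)).trans ?_
              gcongr
              rw [abs_le]
              constructor <;> linarith [hx.1, hx.2, ht.1, ht.2]
      _ = _ := by
          rw [lintegral_add_right _ measurable_const, lintegral_const_mul _ (by fun_prop),
            setLIntegral_const, Real.volume_Ioo, ENNReal.ofReal_mul zero_le_two,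
            ENNReal.ofReal_pow hl.le, ENNReal.ofReal_ofNat]
          ring
  · rw [div_le_iff₀ hl]
    nlinarith

/-- The derivative is controlled by the function and its second derivative: the difference
quotient over half of the interval approximates `f' x`, and it is averaged over its position. -/
theorem exists_enorm_deriv_sq_le {m M : ℝ} (hm : 0 < m) : ∃ C : ℝ≥0∞, C ≠ ⊤ ∧
    ∀ (a b : ℝ) (f f' f'' : ℝ → ℂ), m ≤ b - a → b - a ≤ M → (∀ t, HasDerivAt f (f' t) t) →
      (∀ t, HasDerivAt f' (f'' t) t) → Continuous f'' → ∀ x ∈ Icc a b,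
      ‖f' x‖ₑ ^ 2 ≤ C * ((∫⁻ t in Ioo a b, ‖f t‖ₑ ^ 2) + ∫⁻ t in Ioo a b, ‖f'' t‖ₑ ^ 2) := by
  refine ⟨ENNReal.ofReal (max (48 / m ^ 3) (16 * M)), ENNReal.ofReal_ne_top, ?_⟩
  intro a b f f' f'' h1 h2 hf hf' hc x hx
  set l := b - a with hldef
  have hl : 0 < l := hm.trans_le h1
  have hfc : Continuous f := continuous_iff_continuousAt.2 fun t => (hf t).continuousAt
  have hfc' : Continuous f' := continuous_iff_continuousAt.2 fun t => (hf' t).continuousAt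
  set A := ∫⁻ t in Ioo a b, ‖f t‖ₑ ^ 2 with hA
  set B := ∫⁻ t in Ioo a b, ‖f'' t‖ₑ ^ 2 with hB
  let g : ℝ → ℂ := fun t => f t - t * f' x
  have hg : ∀ t, HasDerivAt g (f' t - f' x) t := fun t => by
    have := (hf t).sub ((Complex.ofRealCLM.hasDerivAt (x := t)).mul_const (f' x))
    exact (this.congr_deriv (by simp)).congr_of_eventuallyEq
      (Eventually.of_forall fun t => by simp [g])
  have hle : ∀ s ∈ Icc a b, ∀ t ∈ Icc a b, |s - t| ≤ l := fun s hs t ht => by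
    rw [abs_le]
    constructor <;> linarith [hs.1, hs.2, ht.1, ht.2]
  have hgd : ∀ s ∈ Icc a b, ∀ t ∈ Icc a b, ‖g s - g t‖ₑ ^ 2 ≤ ENNReal.ofReal (l ^ 3) * B := by
    intro s hs t ht
    calc _ ≤ ENNReal.ofReal l * ∫⁻ τ in Ioo a b, ‖f' τ - f' x‖ₑ ^ 2 := by
          refine (enorm_sub_sq_le hg (hfc'.sub continuous_const) hs ht).trans ?_
          gcongr
          exact hle s hs t ht
      _ ≤ ENNReal.ofReal l * ∫⁻ τ in Ioo a b, ENNReal.ofReal l * B := by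
          refine mul_le_mul_right (setLIntegral_mono measurable_const fun τ hτ => ?_) _
          refine (enorm_sub_sq_le hf' hc (Ioo_subset_Icc_self hτ) hx).trans ?_
          gcongr
          exact hle _ (Ioo_subset_Icc_self hτ) _ hx
      _ = _ := by
          rw [setLIntegral_const, Real.volume_Ioo, ← hldef, ENNReal.ofReal_pow hl.le]
          ring
  refine le_of_ofReal_mul_le (l := (l / 2) ^ 3) (p := 6) (q := 2 * l ^ 4) (by positivity)
    ?_ (le_max_of_le_left ?_) (le_max_of_le_right ?_)
  · have hm1 : Measurable fun s => ‖f s‖ₑ ^ 2 := hfc.measurable.enorm.pow_const 2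
    have hm2 : Measurable fun s => ‖f (s + l / 2)‖ₑ ^ 2 :=
      (hfc.comp (continuous_id.add continuous_const)).measurable.enorm.pow_const 2
    have hshift : ∫⁻ s in Ioo a (a + l / 2), ‖f (s + l / 2)‖ₑ ^ 2 ≤ A := by
      rw [hA, ← lintegral_indicator measurableSet_Ioo, ← lintegral_indicator measurableSet_Ioo,
        ← lintegral_add_right_eq_self (indicator (Ioo a b) _) (l / 2)]
      refine lintegral_mono fun s => ?_
      by_cases hs : s ∈ Ioo a (a + l / 2)
      · have : s + l / 2 ∈ Ioo a b := ⟨by linarith [hs.1], by linarith [hs.2]⟩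
        rw [indicator_of_mem hs, indicator_of_mem this]
      · rw [indicator_of_notMem hs]
        exact zero_le
    calc ENNReal.ofReal ((l / 2) ^ 3) * ‖f' x‖ₑ ^ 2
        = ∫⁻ _ in Ioo a (a + l / 2), ‖((l / 2 : ℝ) : ℂ) * f' x‖ₑ ^ 2 := by
          rw [setLIntegral_const, Real.volume_Ioo, add_sub_cancel_left, enorm_mul, mul_pow,
            ← ofReal_norm (((l / 2 : ℝ) : ℂ)), Complex.norm_real, Real.norm_of_nonneg (by positivity),
            ← ENNReal.ofReal_pow (by positivity), mul_right_comm,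
            ← ENNReal.ofReal_mul (by positivity), pow_succ (l / 2) 2]
      _ ≤ ∫⁻ s in Ioo a (a + l / 2), (2 * ‖f (s + l / 2)‖ₑ ^ 2 + (4 * ‖f s‖ₑ ^ 2 +
            4 * (ENNReal.ofReal (l ^ 3) * B))) := by
          refine setLIntegral_mono ((hm2.const_mul 2).add ((hm1.const_mul 4).add_const _))
            fun s hs => ?_
          have hs1 : s ∈ Icc a b := ⟨hs.1.le, by linarith [hs.2]⟩
          have hs2 : s + l / 2 ∈ Icc a b := ⟨by linarith [hs.1], by linarith [hs.2]⟩
          have e : ((l / 2 : ℝ) : ℂ) * f' x =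
              f (s + l / 2) + (-f s + -(g (s + l / 2) - g s)) := by
            simp only [g]
            push_cast
            ring
          rw [e]
          calc _ ≤ 2 * ‖f (s + l / 2)‖ₑ ^ 2 + 2 * ‖-f s + -(g (s + l / 2) - g s)‖ₑ ^ 2 :=
                enorm_add_sq_le _ _
            _ ≤ 2 * ‖f (s + l / 2)‖ₑ ^ 2 +
                2 * (2 * ‖-f s‖ₑ ^ 2 + 2 * ‖-(g (s + l / 2) - g s)‖ₑ ^ 2) := by
                gcongr
                exact enorm_add_sq_le _ _
            _ = 2 * ‖f (s + l / 2)‖ₑ ^ 2 +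
                (4 * ‖f s‖ₑ ^ 2 + 4 * ‖g (s + l / 2) - g s‖ₑ ^ 2) := by
                rw [enorm_neg, enorm_neg]
                ring
            _ ≤ _ := by
                gcongr
                exact hgd _ hs2 _ hs1
      _ = 2 * (∫⁻ s in Ioo a (a + l / 2), ‖f (s + l / 2)‖ₑ ^ 2) +
          (4 * (∫⁻ s in Ioo a (a + l / 2), ‖f s‖ₑ ^ 2) +
            4 * (ENNReal.ofReal (l ^ 3) * B) * ENNReal.ofReal (l / 2)) := by
          rw [lintegral_add_left (hm2.const_mul 2), lintegral_add_left (hm1.const_mul 4),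
            lintegral_const_mul _ hm2, lintegral_const_mul _ hm1,
            setLIntegral_const, Real.volume_Ioo, add_sub_cancel_left]
      _ ≤ 2 * A + (4 * A + 4 * (ENNReal.ofReal (l ^ 3) * B) * ENNReal.ofReal (l / 2)) := by
          gcongr 2 * ?_ + (4 * ?_ + _)
          exact lintegral_mono_set (Ioo_subset_Ioo le_rfl (by linarith))
      _ = _ := by
          have e : ENNReal.ofReal (2 * l ^ 4) =
              4 * (ENNReal.ofReal (l ^ 3) * ENNReal.ofReal (l / 2)) := by
            rw [← ENNReal.ofReal_ofNat 4, ← ENNReal.ofReal_mul (by positivity),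
              ← ENNReal.ofReal_mul (by positivity)]
            congr 1
            ring
          rw [e, ENNReal.ofReal_ofNat]
          ring
  · rw [div_le_div_iff₀ (by positivity) (by positivity)]
    have : m ^ 3 ≤ l ^ 3 := by gcongr
    nlinarith
  · rw [div_le_iff₀ (by positivity)]
    have : 0 ≤ l ^ 3 * (M - l) := mul_nonneg (by positivity) (by linarith)
    nlinarith

theorem exists_enorm_sq_le_deriv2 {m M : ℝ} (hm : 0 < m) : ∃ C : ℝ≥0∞, C ≠ ⊤ ∧
    ∀ (a b : ℝ) (f f' f'' : ℝ → ℂ), m ≤ b - a → b - a ≤ M → (∀ t, HasDerivAt f (f' t) t) →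
      (∀ t, HasDerivAt f' (f'' t) t) → Continuous f'' → ∀ x ∈ Icc a b,
      ‖f x‖ₑ ^ 2 ≤ C * ((∫⁻ t in Ioo a b, ‖f t‖ₑ ^ 2) + ∫⁻ t in Ioo a b, ‖f'' t‖ₑ ^ 2) := by
  obtain ⟨C, hC, h⟩ := exists_enorm_sq_le (M := M) hm
  obtain ⟨D, hD, k⟩ := exists_enorm_deriv_sq_le (M := M) hm
  refine ⟨C * (1 + D * ENNReal.ofReal M), by finiteness, ?_⟩
  intro a b f f' f'' h1 h2 hf hf' hc x hx
  have hfc' : Continuous f' := continuous_iff_continuousAt.2 fun t => (hf' t).continuousAt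
  set A := ∫⁻ t in Ioo a b, ‖f t‖ₑ ^ 2
  set B := ∫⁻ t in Ioo a b, ‖f'' t‖ₑ ^ 2
  have hd : ∫⁻ t in Ioo a b, ‖f' t‖ₑ ^ 2 ≤ D * (A + B) * ENNReal.ofReal M :=
    calc _ ≤ ∫⁻ _ in Ioo a b, D * (A + B) := setLIntegral_mono measurable_const fun t ht =>
          k a b f f' f'' h1 h2 hf hf' hc t (Ioo_subset_Icc_self ht)
      _ = D * (A + B) * ENNReal.ofReal (b - a) := by rw [setLIntegral_const, Real.volume_Ioo]
      _ ≤ _ := by gcongr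
  calc ‖f x‖ₑ ^ 2 ≤ C * (A + ∫⁻ t in Ioo a b, ‖f' t‖ₑ ^ 2) := h a b f f' h1 h2 hf hfc' x hx
    _ ≤ C * ((A + B) + D * (A + B) * ENNReal.ofReal M) := by
        gcongr
        exact le_self_add
    _ = _ := by ring

/-- Hardy's inequality with the weight `1 / (h Φ²)`, where `Φ' = 1 / h`, and a boundary term at
the left end point. It follows by integration of the derivative of `‖f‖² / Φ`. -/
theorem hardy_inequality {f f' : ℝ → ℂ} {h Φ : ℝ → ℝ} {a b : ℝ} (hab : a ≤ b)
    (hf : ∀ y ∈ Icc a b, HasDerivAt f (f' y) y) (hc : ContinuousOn f' (Icc a b))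
    (hh : ContinuousOn h (Icc a b)) (hpos : ∀ y ∈ Icc a b, 0 < h y)
    (hΦ : ∀ y ∈ Icc a b, HasDerivAt Φ (1 / h y) y) (hΦ0 : ∀ y ∈ Icc a b, 0 < Φ y) :
    ∫ y in a..b, ‖f y‖ ^ 2 / (h y * Φ y ^ 2) ≤
      2 * ‖f a‖ ^ 2 / Φ a + 4 * ∫ y in a..b, h y * ‖f' y‖ ^ 2 := by
  have hfc : ContinuousOn f (Icc a b) := fun y hy => (hf y hy).continuousAt.continuousWithinAt
  have hΦc : ContinuousOn Φ (Icc a b) := fun y hy => (hΦ y hy).continuousAt.continuousWithinAt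
  have hu : uIcc a b = Icc a b := uIcc_of_le hab
  let N' : ℝ → ℝ := fun y => (2 * inner ℝ (f y) (f' y) * Φ y - ‖f y‖ ^ 2 * (1 / h y)) / Φ y ^ 2
  have hder : ∀ y ∈ uIcc a b, HasDerivAt (fun y => ‖f y‖ ^ 2 / Φ y) (N' y) y := by
    intro y hy
    rw [hu] at hy
    exact (hf y hy).norm_sq.div (hΦ y hy) (hΦ0 y hy).ne'
  have hcN : ContinuousOn N' (Icc a b) := by
    refine ContinuousOn.div ?_ (hΦc.pow 2) fun y hy => (pow_pos (hΦ0 y hy) 2).ne'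
    exact ((continuousOn_const.mul (hfc.inner hc)).mul hΦc).sub
      ((hfc.norm.pow 2).mul (continuousOn_const.div hh fun y hy => (hpos y hy).ne'))
  have hc1 : ContinuousOn (fun y => ‖f y‖ ^ 2 / (h y * Φ y ^ 2)) (Icc a b) :=
    (hfc.norm.pow 2).div (hh.mul (hΦc.pow 2)) fun y hy =>
      (mul_pos (hpos y hy) (pow_pos (hΦ0 y hy) 2)).ne'
  have hc2 : ContinuousOn (fun y => h y * ‖f' y‖ ^ 2) (Icc a b) := hh.mul (hc.norm.pow 2)
  have i0 := hcN.intervalIntegrable_of_Icc hab (μ := volume)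
  have i1 := hc1.intervalIntegrable_of_Icc hab (μ := volume)
  have i2 := hc2.intervalIntegrable_of_Icc hab (μ := volume)
  have h1 := intervalIntegral.integral_eq_sub_of_hasDerivAt hder i0
  have h2 : ∫ y in a..b, N' y ≤
      ∫ y in a..b, (2 * (h y * ‖f' y‖ ^ 2) - 1 / 2 * (‖f y‖ ^ 2 / (h y * Φ y ^ 2))) := by
    refine intervalIntegral.integral_mono_on hab i0 ((i2.const_mul 2).sub (i1.const_mul (1 / 2)))
      fun y hy => ?_
    have p1 := hpos y hy
    have p2 := hΦ0 y hy
    have p3 : inner ℝ (f y) (f' y) ≤ ‖f y‖ * ‖f' y‖ := real_inner_le_norm _ _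
    have e1 : N' y = 2 * inner ℝ (f y) (f' y) / Φ y - ‖f y‖ ^ 2 / (h y * Φ y ^ 2) := by
      simp only [N']
      field_simp
    have e2 : 2 * (‖f y‖ * ‖f' y‖) / Φ y ≤
        2 * (h y * ‖f' y‖ ^ 2) + 1 / 2 * (‖f y‖ ^ 2 / (h y * Φ y ^ 2)) := by
      have e3 : 2 * (h y * ‖f' y‖ ^ 2) + 1 / 2 * (‖f y‖ ^ 2 / (h y * Φ y ^ 2)) -
          2 * (‖f y‖ * ‖f' y‖) / Φ y =
          (2 * h y * Φ y * ‖f' y‖ - ‖f y‖) ^ 2 / (2 * (h y * Φ y ^ 2)) := by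
        field_simp
        ring
      have : 0 ≤ (2 * h y * Φ y * ‖f' y‖ - ‖f y‖) ^ 2 / (2 * (h y * Φ y ^ 2)) := by positivity
      linarith
    have e4 : 2 * inner ℝ (f y) (f' y) / Φ y ≤ 2 * (‖f y‖ * ‖f' y‖) / Φ y := by gcongr
    rw [e1]
    linarith
  rw [h1, intervalIntegral.integral_sub (i2.const_mul 2) (i1.const_mul (1 / 2)),
    intervalIntegral.integral_const_mul, intervalIntegral.integral_const_mul] at h2
  have h3 : 0 ≤ ‖f b‖ ^ 2 / Φ b := div_nonneg (sq_nonneg _) (hΦ0 b (right_mem_Icc.2 hab)).le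
  have h4 : 2 * ‖f a‖ ^ 2 / Φ a = 2 * (‖f a‖ ^ 2 / Φ a) := mul_div_assoc _ _ _
  rw [h4]
  linarith

theorem ofReal_intervalIntegral {F : ℝ → ℝ} {a b : ℝ} (hab : a ≤ b)
    (hc : ContinuousOn F (Icc a b)) (h0 : ∀ y ∈ Icc a b, 0 ≤ F y) :
    ENNReal.ofReal (∫ y in a..b, F y) = ∫⁻ y in Ioo a b, ENNReal.ofReal (F y) := by
  rw [intervalIntegral.integral_of_le hab, ofReal_integral_eq_lintegral_ofReal,
    setLIntegral_Ioc_eq_Ioo]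
  · exact (hc.integrableOn_Icc).mono_set Ioc_subset_Icc_self
  · exact (ae_restrict_mem measurableSet_Ioc).mono fun y hy => h0 y (Ioc_subset_Icc_self hy)

/-- Hardy's inequality, with the boundary term averaged over an interval of unit length. -/
theorem lintegral_hardy_le {f f' : ℝ → ℂ} {h Φ : ℝ → ℝ} {a b c : ℝ} (hab : a + 1 ≤ b)
    (hf : ∀ y ∈ Icc a b, HasDerivAt f (f' y) y) (hc : ContinuousOn f' (Icc a b))
    (hh : ContinuousOn h (Icc a b)) (hpos : ∀ y ∈ Icc a b, 0 < h y)
    (hΦ : ∀ y ∈ Icc a b, HasDerivAt Φ (1 / h y) y) (hc0 : 0 < c) (hΦ0 : ∀ y ∈ Icc a b, c ≤ Φ y) :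
    ∫⁻ y in Ioo (a + 1) b, ENNReal.ofReal (1 / (h y * Φ y ^ 2)) * ‖f y‖ₑ ^ 2 ≤
      ENNReal.ofReal (2 / c) * (∫⁻ y in Ioo a (a + 1), ‖f y‖ₑ ^ 2) +
      4 * ∫⁻ y in Ioo a b, ENNReal.ofReal (h y) * ‖f' y‖ₑ ^ 2 := by
  have hΦp : ∀ y ∈ Icc a b, 0 < Φ y := fun y hy => hc0.trans_le (hΦ0 y hy)
  have hfc : ContinuousOn f (Icc a b) := fun y hy => (hf y hy).continuousAt.continuousWithinAt
  have hΦc : ContinuousOn Φ (Icc a b) := fun y hy => (hΦ y hy).continuousAt.continuousWithinAt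
  have hsq : ∀ z : ℂ, ENNReal.ofReal (‖z‖ ^ 2) = ‖z‖ₑ ^ 2 := fun z => by
    rw [ENNReal.ofReal_pow (norm_nonneg _), ofReal_norm]
  set L := ∫⁻ y in Ioo (a + 1) b, ENNReal.ofReal (1 / (h y * Φ y ^ 2)) * ‖f y‖ₑ ^ 2
  set D := ∫⁻ y in Ioo a b, ENNReal.ofReal (h y) * ‖f' y‖ₑ ^ 2
  have key : ∀ s ∈ Ioo a (a + 1), L ≤ ENNReal.ofReal (2 / c) * ‖f s‖ₑ ^ 2 + 4 * D := by
    intro s hs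
    have hsb : s ≤ b := hs.2.le.trans hab
    have hsub : Icc s b ⊆ Icc a b := Icc_subset_Icc hs.1.le le_rfl
    have h1 := hardy_inequality hsb (fun y hy => hf y (hsub hy)) (hc.mono hsub) (hh.mono hsub)
      (fun y hy => hpos y (hsub hy)) (fun y hy => hΦ y (hsub hy)) fun y hy => hΦp y (hsub hy)
    have hc1 : ContinuousOn (fun y => ‖f y‖ ^ 2 / (h y * Φ y ^ 2)) (Icc s b) :=
      (((hfc.norm.pow 2).div (hh.mul (hΦc.pow 2)) fun y hy =>
        (mul_pos (hpos y hy) (pow_pos (hΦp y hy) 2)).ne')).mono hsub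
    have hc2 : ContinuousOn (fun y => h y * ‖f' y‖ ^ 2) (Icc s b) :=
      (hh.mul (hc.norm.pow 2)).mono hsub
    calc L ≤ ∫⁻ y in Ioo s b, ENNReal.ofReal (1 / (h y * Φ y ^ 2)) * ‖f y‖ₑ ^ 2 :=
          lintegral_mono_set (Ioo_subset_Ioo hs.2.le le_rfl)
      _ = ∫⁻ y in Ioo s b, ENNReal.ofReal (‖f y‖ ^ 2 / (h y * Φ y ^ 2)) := by
          refine lintegral_congr fun y => ?_
          rw [div_eq_mul_one_div (‖f y‖ ^ 2), ENNReal.ofReal_mul (sq_nonneg _), hsq, mul_comm]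
      _ = ENNReal.ofReal (∫ y in s..b, ‖f y‖ ^ 2 / (h y * Φ y ^ 2)) :=
          (ofReal_intervalIntegral hsb hc1 fun y hy => by
            have := hpos y (hsub hy)
            positivity).symm
      _ ≤ ENNReal.ofReal (2 * ‖f s‖ ^ 2 / Φ s + 4 * ∫ y in s..b, h y * ‖f' y‖ ^ 2) :=
          ENNReal.ofReal_le_ofReal h1
      _ ≤ ENNReal.ofReal (2 * ‖f s‖ ^ 2 / Φ s) +
          ENNReal.ofReal (4 * ∫ y in s..b, h y * ‖f' y‖ ^ 2) := ENNReal.ofReal_add_le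
      _ ≤ ENNReal.ofReal (2 / c) * ‖f s‖ₑ ^ 2 + 4 * D := by
          gcongr ?_ + ?_
          · rw [← hsq, ← ENNReal.ofReal_mul (by positivity)]
            apply ENNReal.ofReal_le_ofReal
            have := hΦ0 s ⟨hs.1.le, hsb⟩
            rw [div_mul_eq_mul_div]
            gcongr
          · rw [ENNReal.ofReal_mul (by norm_num), ENNReal.ofReal_ofNat,
              ofReal_intervalIntegral hsb hc2 fun y hy => by
                have := hpos y (hsub hy)
                positivity]
            gcongr 4 * ?_
            calc _ = ∫⁻ y in Ioo s b, ENNReal.ofReal (h y) * ‖f' y‖ₑ ^ 2 := by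
                  refine setLIntegral_congr_fun measurableSet_Ioo fun y hy => ?_
                  rw [ENNReal.ofReal_mul (hpos y (hsub (Ioo_subset_Icc_self hy))).le, hsq]
              _ ≤ D := lintegral_mono_set (Ioo_subset_Ioo hs.1.le le_rfl)
  have hfm : AEMeasurable (fun y => ‖f y‖ₑ ^ 2) (volume.restrict (Ioo a (a + 1))) := by
    have : ContinuousOn f (Ioo a (a + 1)) :=
      hfc.mono (Ioo_subset_Icc_self.trans (Icc_subset_Icc le_rfl hab))
    exact ((this.aestronglyMeasurable measurableSet_Ioo).enorm).pow_const 2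
  calc L = ∫⁻ _ in Ioo a (a + 1), L := by
        rw [setLIntegral_const, Real.volume_Ioo, add_sub_cancel_left, ENNReal.ofReal_one, mul_one]
    _ ≤ ∫⁻ s in Ioo a (a + 1), (ENNReal.ofReal (2 / c) * ‖f s‖ₑ ^ 2 + 4 * D) :=
        setLIntegral_mono' measurableSet_Ioo key
    _ = _ := by
        rw [lintegral_add_right _ measurable_const, lintegral_const_mul'' _ hfm,
          setLIntegral_const, Real.volume_Ioo, add_sub_cancel_left, ENNReal.ofReal_one, mul_one]

/-! ### Integration along coordinate lines -/

/-- The point of the plane with `j`-th coordinate `b` and other coordinate `a`. -/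
def cpt (j : Fin 2) (a b : ℝ) : Plane := WithLp.toLp 2 fun k => if k = j then b else a

@[simp]
theorem cpt_self (j : Fin 2) (a b : ℝ) : cpt j a b j = b := by simp [cpt]

theorem cpt_of_ne {i j : Fin 2} (h : i ≠ j) (a b : ℝ) : cpt j a b i = a := by simp [cpt, h]

theorem cpt_eta {i j : Fin 2} (h : i ≠ j) (x : Plane) : cpt j (x i) (x j) = x := by
  ext k
  by_cases hk : k = j
  · subst hk; simp
  · have : k = i := by omega
    subst this
    exact cpt_of_ne hk _ _

theorem cpt_eq_add {i j : Fin 2} (h : i ≠ j) (a b : ℝ) :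
    cpt j a b = a • EuclideanSpace.single i (1 : ℝ) + b • EuclideanSpace.single j (1 : ℝ) := by
  ext k
  by_cases hk : k = j
  · subst hk; simp [h.symm]
  · have : k = i := by omega
    subst this
    simp [cpt_of_ne hk, hk]

theorem cpt_comm {i j : Fin 2} (h : i ≠ j) (a b : ℝ) : cpt j a b = cpt i b a := by
  rw [cpt_eq_add h, cpt_eq_add h.symm, add_comm]

theorem continuous_cpt (j : Fin 2) : Continuous fun p : ℝ × ℝ => cpt j p.1 p.2 := by
  refine (PiLp.continuous_toLp 2 _).comp (continuous_pi fun k => ?_)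
  by_cases hk : k = j <;> simp only [hk, if_true, if_false] <;> fun_prop

theorem dist_cpt_le {i j : Fin 2} (h : i ≠ j) (a b : ℝ) (x : Plane) :
    dist (cpt j a b) x ≤ |a - x i| + |b - x j| := by
  have e : cpt j a b - x = (a - x i) • EuclideanSpace.single i (1 : ℝ) +
      (b - x j) • EuclideanSpace.single j (1 : ℝ) := by
    conv_lhs => rw [← cpt_eta h x, cpt_eq_add h, cpt_eq_add h]
    module
  rw [dist_eq_norm, e]
  refine (norm_add_le _ _).trans (le_of_eq ?_)
  simp [norm_smul]

/-- Tonelli's theorem in the plane, with the inner integral over the `j`-th coordinate. -/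
theorem lintegral_plane (j : Fin 2) {F : Plane → ℝ≥0∞} (hF : Measurable F) :
    ∫⁻ x, F x = ∫⁻ a, ∫⁻ b, F (cpt j a b) := by
  have hm : MeasurePreserving (fun p : ℝ × ℝ => cpt 1 p.1 p.2) volume volume := by
    have h1 := (volume_preserving_finTwoArrow ℝ).symm
    have h2 := (PiLp.volume_preserving_toLp (Fin 2)).comp h1
    convert! h2 using 1
    ext p k
    fin_cases k <;> rfl
  have hc : ∀ j, Measurable fun p : ℝ × ℝ => F (cpt j p.1 p.2) :=
    fun j => hF.comp (continuous_cpt j).measurable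
  have h1 : ∫⁻ x, F x = ∫⁻ p : ℝ × ℝ, F (cpt 1 p.1 p.2) :=
    (hm.lintegral_comp hF).symm
  have h2 : ∫⁻ x, F x = ∫⁻ a, ∫⁻ b, F (cpt 1 a b) := by
    rw [h1, Measure.volume_eq_prod, lintegral_prod _ (hc 1).aemeasurable]
  fin_cases j
  · rw [h2, lintegral_lintegral_swap (hc 1).aemeasurable]
    refine lintegral_congr fun a => lintegral_congr fun b => congrArg F ?_
    ext k
    fin_cases k <;> rfl
  · exact h2

theorem lintegral_comp_affine {G : ℝ → ℝ≥0∞} (hG : Measurable G) (c : ℝ) {k : ℝ} (hk : k ≠ 0) :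
    ∫⁻ b, G b = ENNReal.ofReal |k| * ∫⁻ t, G (c + k * t) := by
  have h1 : ∫⁻ t, G (c + k * t) = ∫⁻ b, G (c + b) ∂(Measure.map (k * ·) volume) :=
    (lintegral_map (hG.comp (measurable_const_add c)) (measurable_const_mul k)).symm
  rw [h1, Real.map_volume_mul_left hk, lintegral_smul_measure,
    lintegral_add_left_eq_self G c, smul_eq_mul, ← mul_assoc, ← ENNReal.ofReal_mul (abs_nonneg _),
    ← abs_mul, mul_inv_cancel₀ hk, abs_one, ENNReal.ofReal_one, one_mul]

/-- The set swept by the segments `γ a + κ a * t` with `t ∈ J` in the lines `x i = a ∈ I` parallel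
to the `j`-th coordinate axis. -/
def columns (i j : Fin 2) (γ κ : ℝ → ℝ) (I J : Set ℝ) : Set Plane :=
  {x | x i ∈ I ∧ (x j - γ (x i)) / κ (x i) ∈ J}

theorem cpt_mem_columns {i j : Fin 2} (hij : i ≠ j) {γ κ : ℝ → ℝ} {I J : Set ℝ} {a t : ℝ}
    (hκ : κ a ≠ 0) : cpt j a (γ a + κ a * t) ∈ columns i j γ κ I J ↔ a ∈ I ∧ t ∈ J := by
  simp [columns, cpt_of_ne hij, mul_div_cancel_left₀ _ hκ]

theorem measurableSet_columns {i j : Fin 2} {γ κ : ℝ → ℝ} (hγ : Continuous γ) (hκ : Continuous κ)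
    {I J : Set ℝ} (hI : MeasurableSet I) (hJ : MeasurableSet J) :
    MeasurableSet (columns i j γ κ I J) := by
  have hi : Measurable fun x : Plane => x i := by fun_prop
  have hj : Measurable fun x : Plane => x j := by fun_prop
  exact (hi hI).inter (((hj.sub (hγ.measurable.comp hi)).div (hκ.measurable.comp hi)) hJ)

/-- Tonelli's theorem, with the inner integral in the coordinate `t` of the segments. -/
theorem setLIntegral_columns {i j : Fin 2} (hij : i ≠ j) {γ κ : ℝ → ℝ} (hγ : Continuous γ)
    (hκ : Continuous κ) (hκ0 : ∀ a, κ a ≠ 0) {I J : Set ℝ} (hI : MeasurableSet I)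
    (hJ : MeasurableSet J) {F : Plane → ℝ≥0∞} (hF : Measurable F) :
    ∫⁻ x in columns i j γ κ I J, F x =
      ∫⁻ a in I, ENNReal.ofReal |κ a| * ∫⁻ t in J, F (cpt j a (γ a + κ a * t)) := by
  have hm := measurableSet_columns (i := i) (j := j) hγ hκ hI hJ
  rw [← lintegral_indicator hm, lintegral_plane j (hF.indicator hm), ← lintegral_indicator hI]
  refine lintegral_congr fun a => ?_
  have hl : Measurable fun b => indicator (columns i j γ κ I J) F (cpt j a b) :=
    (hF.indicator hm).comp ((continuous_cpt j).comp
      (by fun_prop : Continuous fun b => (a, b))).measurable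
  rw [lintegral_comp_affine hl (γ a) (hκ0 a)]
  by_cases ha : a ∈ I
  · rw [indicator_of_mem ha, ← lintegral_indicator hJ]
    congr 1
    refine lintegral_congr fun t => ?_
    by_cases ht : t ∈ J
    · rw [indicator_of_mem ht, indicator_of_mem ((cpt_mem_columns hij (hκ0 a)).2 ⟨ha, ht⟩)]
    · rw [indicator_of_notMem ht,
        indicator_of_notMem fun h => ht ((cpt_mem_columns hij (hκ0 a)).1 h).2]
  · rw [indicator_of_notMem ha]
    have : ∀ t, indicator (columns i j γ κ I J) F (cpt j a (γ a + κ a * t)) = 0 := fun t =>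
      indicator_of_notMem (fun h => ha ((cpt_mem_columns hij (hκ0 a)).1 h).1) _
    simp [this]

theorem contDiff_partialD {φ : Plane → ℂ} (h : ContDiff ℝ ∞ φ) (i : Fin 2) :
    ContDiff ℝ ∞ (partialD i φ) :=
  (h.fderiv_right (m := ∞) (by simp)).clm_apply contDiff_const

theorem partialD_comm {φ : Plane → ℂ} (h : ContDiff ℝ ∞ φ) (i j : Fin 2) (x : Plane) :
    partialD i (partialD j φ) x = partialD j (partialD i φ) x := by
  have hd : DifferentiableAt ℝ (fderiv ℝ φ) x :=
    (h.fderiv_right (m := ∞) (by simp)).differentiable (by simp) x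
  have e : ∀ i j : Fin 2, partialD i (partialD j φ) x =
      fderiv ℝ (fderiv ℝ φ) x (EuclideanSpace.single i 1) (EuclideanSpace.single j 1) := by
    intro i j
    have : HasFDerivAt (partialD j φ) _ x :=
      hd.hasFDerivAt.clm_apply (hasFDerivAt_const (EuclideanSpace.single j (1 : ℝ)) x)
    rw [Plate.partialD, this.fderiv]
    simp
  have hs : IsSymmSndFDerivAt ℝ φ x :=
    (h.contDiffAt).isSymmSndFDerivAt (by simpa using WithTop.coe_le_coe.2 (le_top (a := (2 : ℕ∞))))
  rw [e, e, hs.eq]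

/-- The chain rule along a curve in the plane. -/
theorem hasDerivAt_comp_cpt {φ : Plane → ℂ} (h : ContDiff ℝ ∞ φ) {i j : Fin 2} (hij : i ≠ j)
    {p q : ℝ → ℝ} {p' q' y : ℝ} (hp : HasDerivAt p p' y) (hq : HasDerivAt q q' y) :
    HasDerivAt (fun y => φ (cpt j (p y) (q y)))
      ((p' : ℂ) * partialD i φ (cpt j (p y) (q y)) + (q' : ℂ) * partialD j φ (cpt j (p y) (q y)))
      y := by
  have h1 : HasDerivAt (fun y => cpt j (p y) (q y))
      (p' • EuclideanSpace.single i (1 : ℝ) + q' • EuclideanSpace.single j (1 : ℝ)) y := by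
    simp only [cpt_eq_add hij]
    exact (hp.smul_const _).add (hq.smul_const _)
  have h2 := ((h.differentiable (by simp)) (cpt j (p y) (q y))).hasFDerivAt.comp_hasDerivAt y h1
  refine h2.congr_deriv ?_
  simp [Plate.partialD, map_add]

theorem hasDerivAt_column {φ : Plane → ℂ} (h : ContDiff ℝ ∞ φ) (j : Fin 2) (a c k t : ℝ) :
    HasDerivAt (fun t => φ (cpt j a (c + k * t))) ((k : ℂ) * partialD j φ (cpt j a (c + k * t)))
      t := by
  obtain ⟨i, hij⟩ : ∃ i : Fin 2, i ≠ j := exists_ne j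
  have := hasDerivAt_comp_cpt h hij (hasDerivAt_const t a)
    (((hasDerivAt_id t).const_mul k).const_add c)
  simpa using this

theorem hasDerivAt_line {φ : Plane → ℂ} (h : ContDiff ℝ ∞ φ) (j : Fin 2) (a t : ℝ) :
    HasDerivAt (fun t => φ (cpt j a t)) (partialD j φ (cpt j a t)) t := by
  simpa using hasDerivAt_column h j a 0 1 t

theorem continuous_line {E : Type*} [TopologicalSpace E] {φ : Plane → E} (h : Continuous φ)
    (j : Fin 2) (a : ℝ) : Continuous fun t => φ (cpt j a t) :=
  h.comp ((continuous_cpt j).comp (by fun_prop : Continuous fun t : ℝ => (a, t)))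

theorem continuous_column {E : Type*} [TopologicalSpace E] {φ : Plane → E} (h : Continuous φ)
    (j : Fin 2) (a c k : ℝ) : Continuous fun t => φ (cpt j a (c + k * t)) :=
  h.comp ((continuous_cpt j).comp (by fun_prop : Continuous fun t : ℝ => (a, c + k * t)))

/-! ### Interior compactness -/

section

/-- The open square with centre `p` and side length `2 r`. -/
def square (p : Plane) (r : ℝ) : Set Plane := {x | |x 0 - p 0| < r ∧ |x 1 - p 1| < r}

/-- The closed square with centre `p` and side length `2 r`. -/
def closedSquare (p : Plane) (r : ℝ) : Set Plane := {x | |x 0 - p 0| ≤ r ∧ |x 1 - p 1| ≤ r}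

theorem square_subset_closedSquare (p : Plane) (r : ℝ) : square p r ⊆ closedSquare p r :=
  fun _ hx => ⟨hx.1.le, hx.2.le⟩

theorem isOpen_square (p : Plane) (r : ℝ) : IsOpen (square p r) :=
  (isOpen_lt (f := fun x : Plane => |x 0 - p 0|) (by fun_prop) continuous_const).inter
    (isOpen_lt (f := fun x : Plane => |x 1 - p 1|) (by fun_prop) continuous_const)

theorem dist_le_of_plane (x y : Plane) : dist x y ≤ |x 0 - y 0| + |x 1 - y 1| := by
  have h := dist_cpt_le (i := 0) (j := 1) (by decide) (x 0) (x 1) y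
  rwa [cpt_eta (by decide)] at h

theorem isCompact_closedSquare (p : Plane) (r : ℝ) : IsCompact (closedSquare p r) := by
  refine Metric.isCompact_of_isClosed_isBounded ?_ ?_
  · exact (isClosed_le (f := fun x : Plane => |x 0 - p 0|) (by fun_prop) continuous_const).inter
      (isClosed_le (f := fun x : Plane => |x 1 - p 1|) (by fun_prop) continuous_const)
  · refine (Metric.isBounded_closedBall (x := p) (r := r + r)).subset fun x hx => ?_
    exact (dist_le_of_plane x p).trans (add_le_add hx.1 hx.2)

theorem square_eq_columns {i j : Fin 2} (hij : i ≠ j) (p : Plane) (r : ℝ) :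
    square p r = columns i j (fun _ => 0) (fun _ => 1) (Ioo (p i - r) (p i + r))
      (Ioo (p j - r) (p j + r)) := by
  ext x
  have h : ∀ k, |x k - p k| < r ↔ x k ∈ Ioo (p k - r) (p k + r) := fun k => by
    rw [abs_lt, mem_Ioo]
    constructor <;> rintro ⟨h1, h2⟩ <;> constructor <;> linarith
  simp only [square, columns, mem_ofPred_eq, h, sub_zero, div_one]
  fin_cases i <;> fin_cases j <;> first | exact absurd rfl hij | exact Iff.rfl | exact and_comm

theorem setLIntegral_square {i j : Fin 2} (hij : i ≠ j) (p : Plane) (r : ℝ) {F : Plane → ℝ≥0∞}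
    (hF : Measurable F) :
    ∫⁻ x in square p r, F x = ∫⁻ a in Ioo (p i - r) (p i + r),
      ∫⁻ t in Ioo (p j - r) (p j + r), F (cpt j a t) := by
  rw [square_eq_columns hij, setLIntegral_columns hij continuous_const continuous_const
    (fun _ => one_ne_zero) measurableSet_Ioo measurableSet_Ioo hF]
  simp

theorem mem_Icc_of_mem_closedSquare {p : Plane} {r : ℝ} {x : Plane} (hx : x ∈ closedSquare p r)
    (k : Fin 2) : x k ∈ Icc (p k - r) (p k + r) := by
  have : |x k - p k| ≤ r := by
    fin_cases k
    exacts [hx.1, hx.2]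
  rw [abs_le] at this
  constructor <;> linarith

theorem measurable_enorm_sq {φ : Plane → ℂ} (h : Continuous φ) : Measurable fun x => ‖φ x‖ₑ ^ 2 :=
  h.measurable.enorm.pow_const 2

theorem exists_lintegral_partialD_le {r : ℝ} (hr : 0 < r) : ∃ C : ℝ≥0∞, C ≠ ⊤ ∧
    ∀ (p : Plane) (j : Fin 2) (φ : Plane → ℂ), ContDiff ℝ ∞ φ →
      ∫⁻ x in square p r, ‖partialD j φ x‖ₑ ^ 2 ≤ C * ((∫⁻ x in square p r, ‖φ x‖ₑ ^ 2) +
        ∫⁻ x in square p r, ‖partialD j (partialD j φ) x‖ₑ ^ 2) := by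
  obtain ⟨C, hC, h⟩ := exists_enorm_deriv_sq_le (m := 2 * r) (M := 2 * r) (by positivity)
  refine ⟨ENNReal.ofReal (2 * r) * C, by finiteness, fun p j φ hφ => ?_⟩
  obtain ⟨i, hij⟩ : ∃ i : Fin 2, i ≠ j := exists_ne j
  have hφ1 := contDiff_partialD hφ j
  have hφ2 := contDiff_partialD hφ1 j
  have m0 := measurable_enorm_sq hφ.continuous
  have m2 := measurable_enorm_sq hφ2.continuous
  rw [← lintegral_add_left m0, setLIntegral_square hij _ _ (measurable_enorm_sq hφ1.continuous),
    setLIntegral_square hij _ _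
      (F := fun x => ‖φ x‖ₑ ^ 2 + ‖partialD j (partialD j φ) x‖ₑ ^ 2) (m0.add m2),
    ← lintegral_const_mul' _ _ (by finiteness)]
  refine lintegral_mono fun a => ?_
  have ml : Measurable fun t => ‖φ (cpt j a t)‖ₑ ^ 2 :=
    (continuous_line hφ.continuous j a).measurable.enorm.pow_const 2
  rw [lintegral_add_left ml]
  set D := (∫⁻ t in Ioo (p j - r) (p j + r), ‖φ (cpt j a t)‖ₑ ^ 2) +
    ∫⁻ t in Ioo (p j - r) (p j + r), ‖partialD j (partialD j φ) (cpt j a t)‖ₑ ^ 2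
  calc _ ≤ ∫⁻ _ in Ioo (p j - r) (p j + r), C * D := by
        refine setLIntegral_mono measurable_const fun t ht => ?_
        exact h _ _ _ _ _ (by linarith) (by linarith) (hasDerivAt_line hφ j a)
          (hasDerivAt_line hφ1 j a) (continuous_line hφ2.continuous j a) t
          (Ioo_subset_Icc_self ht)
    _ = _ := by
        rw [setLIntegral_const, Real.volume_Ioo]
        ring_nf

/-- The trace inequality on the lines that cross a square. -/
theorem exists_lintegral_line_le {r : ℝ} (hr : 0 < r) : ∃ C : ℝ≥0∞, C ≠ ⊤ ∧
    ∀ (p : Plane) (i j : Fin 2) (φ : Plane → ℂ), i ≠ j → ContDiff ℝ ∞ φ →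
      ∀ b ∈ Icc (p j - r) (p j + r),
      ∫⁻ a in Ioo (p i - r) (p i + r), ‖φ (cpt i b a)‖ₑ ^ 2 ≤
        C * ((∫⁻ x in square p r, ‖φ x‖ₑ ^ 2) + ∫⁻ x in square p r, ‖partialD j φ x‖ₑ ^ 2) := by
  obtain ⟨C, hC, h⟩ := exists_enorm_sq_le (m := 2 * r) (M := 2 * r) (by positivity)
  refine ⟨C, hC, fun p i j φ hij hφ b hb => ?_⟩
  have hφ1 := contDiff_partialD hφ j
  have m0 := measurable_enorm_sq hφ.continuous
  have m1 := measurable_enorm_sq hφ1.continuous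
  rw [← lintegral_add_left m0, setLIntegral_square hij _ _
      (F := fun x => ‖φ x‖ₑ ^ 2 + ‖partialD j φ x‖ₑ ^ 2) (m0.add m1),
    ← lintegral_const_mul' _ _ hC]
  refine lintegral_mono fun a => ?_
  have ml : Measurable fun t => ‖φ (cpt j a t)‖ₑ ^ 2 :=
    (continuous_line hφ.continuous j a).measurable.enorm.pow_const 2
  rw [lintegral_add_left ml,
    ← cpt_comm hij]
  exact h _ _ _ _ (by linarith) (by linarith) (hasDerivAt_line hφ j a)
    (continuous_line hφ1.continuous j a) b hb

/-- On a square a smooth function and its modulus of continuity are controlled by the function and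
its second derivatives: the restrictions of `φ` and its gradient to lines are controlled by means
of the mixed derivative. -/
theorem exists_pointwise_bound {r : ℝ} (hr : 0 < r) : ∃ C : ℝ≥0∞, C ≠ ⊤ ∧
    ∀ (p : Plane) (φ : Plane → ℂ) (D : ℝ≥0∞), ContDiff ℝ ∞ φ →
      ∫⁻ x in square p r, ‖φ x‖ₑ ^ 2 ≤ D →
      (∀ i j, ∫⁻ x in square p r, ‖partialD i (partialD j φ) x‖ₑ ^ 2 ≤ D) →
      (∀ x ∈ closedSquare p r, ‖φ x‖ₑ ^ 2 ≤ C * D) ∧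
      ∀ x ∈ closedSquare p r, ∀ y ∈ closedSquare p r,
        ‖φ x - φ y‖ₑ ^ 2 ≤ C * D * ENNReal.ofReal (|x 0 - y 0| + |x 1 - y 1|) := by
  obtain ⟨C1, hC1, h1⟩ := exists_lintegral_partialD_le hr
  obtain ⟨C2, hC2, h2⟩ := exists_lintegral_line_le hr
  obtain ⟨C3, hC3, h3⟩ := exists_enorm_sq_le (m := 2 * r) (M := 2 * r) (by positivity)
  set E : ℝ≥0∞ := C2 * (1 + 2 * C1) with hE
  refine ⟨2 * C3 * E + 2 * E, by finiteness, fun p φ D hφ hD0 hD2 => ?_⟩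
  have hgrad : ∀ j, ∫⁻ x in square p r, ‖partialD j φ x‖ₑ ^ 2 ≤ 2 * C1 * D := fun j =>
    calc _ ≤ C1 * (D + D) := (h1 p j φ hφ).trans (by gcongr; exact hD2 j j)
      _ = _ := by ring
  have hline : ∀ i j, i ≠ j → ∀ b ∈ Icc (p j - r) (p j + r),
      ∫⁻ a in Ioo (p i - r) (p i + r), ‖φ (cpt i b a)‖ₑ ^ 2 ≤ E * D := fun i j hij b hb =>
    calc _ ≤ C2 * (D + 2 * C1 * D) :=
          (h2 p i j φ hij hφ b hb).trans (by gcongr; exact hgrad j)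
      _ = _ := by rw [hE]; ring
  have hline' : ∀ i j, i ≠ j → ∀ b ∈ Icc (p j - r) (p j + r),
      ∫⁻ a in Ioo (p i - r) (p i + r), ‖partialD i φ (cpt i b a)‖ₑ ^ 2 ≤ E * D :=
    fun i j hij b hb =>
    calc _ ≤ C2 * (2 * C1 * D + D) :=
          (h2 p i j _ hij (contDiff_partialD hφ i) b hb).trans
            (by gcongr; exacts [hgrad i, hD2 j i])
      _ = _ := by rw [hE]; ring
  have hstep : ∀ i j, i ≠ j → ∀ b ∈ Icc (p j - r) (p j + r), ∀ s ∈ Icc (p i - r) (p i + r),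
      ∀ t ∈ Icc (p i - r) (p i + r),
      ‖φ (cpt i b s) - φ (cpt i b t)‖ₑ ^ 2 ≤ ENNReal.ofReal |s - t| * (E * D) := by
    intro i j hij b hb s hs t ht
    refine (enorm_sub_sq_le (hasDerivAt_line hφ i b)
      (continuous_line (contDiff_partialD hφ i).continuous i b) hs ht).trans ?_
    gcongr
    exact hline' i j hij b hb
  constructor
  · intro x hx
    have hx0 := mem_Icc_of_mem_closedSquare hx 0
    have hx1 := mem_Icc_of_mem_closedSquare hx 1
    have h := h3 (p 0 - r) (p 0 + r) _ _ (by linarith) (by linarith) (hasDerivAt_line hφ 0 (x 1))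
      (continuous_line (contDiff_partialD hφ 0).continuous 0 (x 1)) (x 0) hx0
    rw [cpt_eta (by decide)] at h
    calc _ ≤ C3 * (E * D + E * D) := h.trans (by
          gcongr
          exacts [hline 0 1 (by decide) _ hx1, hline' 0 1 (by decide) _ hx1])
      _ = 2 * C3 * E * D := by ring
      _ ≤ _ := by gcongr; exact le_self_add
  · intro x hx y hy
    have hx0 := mem_Icc_of_mem_closedSquare hx 0
    have hx1 := mem_Icc_of_mem_closedSquare hx 1
    have hy0 := mem_Icc_of_mem_closedSquare hy 0
    have hy1 := mem_Icc_of_mem_closedSquare hy 1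
    have e : φ x - φ y = (φ (cpt 0 (x 1) (x 0)) - φ (cpt 0 (x 1) (y 0))) +
        (φ (cpt 1 (y 0) (x 1)) - φ (cpt 1 (y 0) (y 1))) := by
      rw [cpt_eta (by decide), cpt_eta (by decide), cpt_comm (i := 0) (j := 1) (by decide)]
      ring
    calc ‖φ x - φ y‖ₑ ^ 2 ≤ 2 * (ENNReal.ofReal |x 0 - y 0| * (E * D)) +
          2 * (ENNReal.ofReal |x 1 - y 1| * (E * D)) := by
          rw [e]
          refine (enorm_add_sq_le _ _).trans ?_
          gcongr
          exacts [hstep 0 1 (by decide) _ hx1 _ hx0 _ hy0,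
            hstep 1 0 (by decide) _ hy0 _ hx1 _ hy1]
      _ = 2 * E * D * ENNReal.ofReal (|x 0 - y 0| + |x 1 - y 1|) := by
          rw [ENNReal.ofReal_add (abs_nonneg _) (abs_nonneg _)]
          ring
      _ ≤ _ := by gcongr; exact le_add_self

variable {Ω : TopologicalSpace.Opens Plane}

/-- The squared norm of `u` and its second derivatives in `L²(Ω)`. -/
noncomputable def sqNormH2 (u : L2 Ω) : ℝ≥0∞ :=
  (∫⁻ x in (Ω : Set Plane), ‖u x‖ₑ ^ 2) +
    ((∫⁻ x in (Ω : Set Plane), ‖pd 0 (pd 0 u) x‖ₑ ^ 2) +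
      (∫⁻ x in (Ω : Set Plane), ‖pd 1 (pd 1 u) x‖ₑ ^ 2) +
      ∫⁻ x in (Ω : Set Plane), ‖pd 0 (pd 1 u) x‖ₑ ^ 2)

theorem lintegral_sq_le_sqNormH2 (u : L2 Ω) :
    ∫⁻ x in (Ω : Set Plane), ‖u x‖ₑ ^ 2 ≤ sqNormH2 u := le_self_add

theorem lintegral_pd_sq_le_sqNormH2 (u : L2 Ω) (i j : Fin 2) (hij : (i, j) ≠ (1, 0)) :
    ∫⁻ x in (Ω : Set Plane), ‖pd i (pd j u) x‖ₑ ^ 2 ≤ sqNormH2 u := by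
  refine le_trans ?_ le_add_self
  fin_cases i <;> fin_cases j
  · exact le_self_add.trans le_self_add
  · exact le_add_self
  · exact absurd rfl hij
  · exact le_add_self.trans le_self_add

theorem MemH2.hasWeakDeriv {u : L2 Ω} (h : MemH2 u) (i : Fin 2) : HasWeakDeriv i u (pd i u) :=
  h.1.hasWeakDeriv i

theorem MemH2.hasWeakDeriv_pd {u : L2 Ω} (h : MemH2 u) (i j : Fin 2) :
    HasWeakDeriv i (pd j u) (pd i (pd j u)) :=
  (h.2 j).hasWeakDeriv i

/-- In a square inside of `Ω`, a function of `H²(Ω)` is approximated by smooth functions with the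
same bounds. -/
theorem exists_smooth_approx {p : Plane} {r : ℝ} (hs : closedSquare p r ⊆ (Ω : Set Plane))
    {u : L2 Ω} (hu : MemH2 u) {Λ ε : ℝ≥0∞} (hΛ : sqNormH2 u < Λ) (hε : 0 < ε) :
    ∃ φ : Plane → ℂ, ContDiff ℝ ∞ φ ∧ ∫⁻ x in square p r, ‖φ x - u x‖ₑ ^ 2 ≤ ε ∧
      ∫⁻ x in square p r, ‖φ x‖ₑ ^ 2 ≤ Λ ∧
      ∀ i j, ∫⁻ x in square p r, ‖partialD i (partialD j φ) x‖ₑ ^ 2 ≤ Λ := by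
  have hQ : square p r ⊆ (Ω : Set Plane) := (square_subset_closedSquare p r).trans hs
  have hlim : ∀ g : L2 Ω, ∫⁻ x in (Ω : Set Plane), ‖g x‖ₑ ^ 2 ≤ sqNormH2 u →
      ∀ᶠ n in atTop, ∫⁻ x in square p r, ‖mollify n g x‖ₑ ^ 2 < Λ := fun g hg =>
    (tendsto_setLIntegral_mollify g hQ).eventually (gt_mem_nhds
      (((lintegral_mono_set hQ).trans hg).trans_lt hΛ))
  have hd : ∀ᶠ n in atTop, ∀ i j, (i, j) ≠ ((1, 0) : Fin 2 × Fin 2) →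
      ∫⁻ x in square p r, ‖partialD i (partialD j (mollify n u)) x‖ₑ ^ 2 ≤ Λ := by
    have h2 : ∀ᶠ n in atTop, ∀ i j, (i, j) ≠ ((1, 0) : Fin 2 × Fin 2) →
        ∫⁻ x in square p r, ‖mollify n (pd i (pd j u)) x‖ₑ ^ 2 < Λ := by
      simp only [eventually_all]
      exact fun i j hij => hlim _ (lintegral_pd_sq_le_sqNormH2 u i j hij)
    filter_upwards [h2, eventually_partialD_partialD_mollify (isCompact_closedSquare p r) hs]
      with n h3 h4 i j hij
    refine le_trans (le_of_eq ?_) (h3 i j hij).le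
    refine setLIntegral_congr_fun (isOpen_square p r).measurableSet fun x hx => ?_
    simp only [h4 x (square_subset_closedSquare p r hx) j i u _ _ (hu.hasWeakDeriv j)
      (hu.hasWeakDeriv_pd i j)]
  obtain ⟨n, h1, h2, h3⟩ := (((ENNReal.tendsto_nhds_zero.1 (tendsto_mollify u)) ε hε).and
    ((hlim u (lintegral_sq_le_sqNormH2 u)).and hd)).exists
  have hsm := contDiff_mollify n u
  refine ⟨mollify n u, hsm, (lintegral_mono_set hQ).trans h1, h2.le, fun i j => ?_⟩
  by_cases hij : (i, j) = ((1, 0) : Fin 2 × Fin 2)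
  · simp only [Prod.mk.injEq] at hij
    rw [hij.1, hij.2]
    simp only [partialD_comm hsm 1 0]
    exact h3 0 1 (by decide)
  · exact h3 i j hij

/-- A family that is bounded in `H²` is precompact in `L²` of a square inside of `Ω`: along an
ultrafilter the smooth approximations converge at the points of a finite net, and by
equicontinuity they converge uniformly. -/
theorem exists_mem_ultrafilter_square {p : Plane} {r : ℝ} (hr : 0 < r)
    (hs : closedSquare p r ⊆ (Ω : Set Plane)) (f : Ultrafilter (L2 Ω)) {Λ : ℝ≥0∞} (hΛ : Λ ≠ ⊤)
    (hf : ∀ᶠ u in (f : Filter (L2 Ω)), MemH2 u ∧ sqNormH2 u < Λ) {ε : ℝ≥0∞} (hε : 0 < ε) :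
    ∃ s ∈ f, ∀ u ∈ s, ∀ w ∈ s, ∫⁻ x in square p r, ‖u x - w x‖ₑ ^ 2 ≤ ε := by
  have hQ : square p r ⊆ (Ω : Set Plane) := (square_subset_closedSquare p r).trans hs
  obtain ⟨C, hC, hb⟩ := exists_pointwise_bound hr
  have hε1 : 0 < ε / 10 := ENNReal.div_pos hε.ne' (by norm_num)
  have happ : ∀ u : L2 Ω, ∃ φ : Plane → ℂ, MemH2 u ∧ sqNormH2 u < Λ → ContDiff ℝ ∞ φ ∧
      ∫⁻ x in square p r, ‖φ x - u x‖ₑ ^ 2 ≤ ε / 10 ∧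
      (∀ x ∈ closedSquare p r, ‖φ x‖ₑ ^ 2 ≤ C * Λ) ∧
      ∀ x ∈ closedSquare p r, ∀ y ∈ closedSquare p r,
        ‖φ x - φ y‖ₑ ^ 2 ≤ C * Λ * ENNReal.ofReal (|x 0 - y 0| + |x 1 - y 1|) := by
    intro u
    by_cases h : MemH2 u ∧ sqNormH2 u < Λ
    · obtain ⟨φ, h1, h2, h3, h4⟩ := exists_smooth_approx hs h.1 h.2 hε1
      obtain ⟨h5, h6⟩ := hb p φ Λ h1 h3 h4
      exact ⟨φ, fun _ => ⟨h1, h2, h5, h6⟩⟩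
    · exact ⟨0, fun h' => absurd h' h⟩
  choose φ hφ using happ
  set V := volume (square p r) with hV
  have hVfin : V ≠ ⊤ := ((measure_mono (square_subset_closedSquare p r)).trans_lt
    (isCompact_closedSquare p r).measure_lt_top).ne
  -- The uniform distance `η` and the mesh `δ` of the net.
  obtain ⟨η, hη, hηV⟩ : ∃ η : ℝ≥0∞, 0 < η ∧ 36 * η * V ≤ ε / 10 := by
    have h36 : 36 * V ≠ ⊤ := by finiteness
    refine ⟨ε / 10 / (36 * V + 1), ENNReal.div_pos hε1.ne' (by finiteness), ?_⟩
    calc _ = ε / 10 / (36 * V + 1) * (36 * V) := by ring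
      _ ≤ ε / 10 / (36 * V + 1) * (36 * V + 1) := by gcongr; exact le_self_add
      _ = _ := ENNReal.div_mul_cancel (by simp) (by finiteness)
  obtain ⟨δ, hδ, hδη⟩ : ∃ δ : ℝ, 0 < δ ∧ C * Λ * ENNReal.ofReal (δ + δ) ≤ η := by
    have hl : Tendsto (fun δ : ℝ => C * Λ * ENNReal.ofReal (δ + δ)) (𝓝[>] 0) (𝓝 0) := by
      have h1 : Tendsto (fun δ : ℝ => ENNReal.ofReal (δ + δ)) (𝓝[>] 0) (𝓝 0) := by
        have : Continuous fun δ : ℝ => ENNReal.ofReal (δ + δ) :=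
          ENNReal.continuous_ofReal.comp (continuous_id.add continuous_id)
        simpa using (this.tendsto 0).mono_left nhdsWithin_le_nhds
      simpa using ENNReal.Tendsto.const_mul h1 (Or.inr (by finiteness : C * Λ ≠ ⊤))
    obtain ⟨δ, h1, h2⟩ := ((ENNReal.tendsto_nhds_zero.1 hl η hη).and
      self_mem_nhdsWithin).exists
    exact ⟨δ, h2, h1⟩
  obtain ⟨t, ht, htf, hcov⟩ := (isCompact_closedSquare p r).finite_cover_balls hδ
  have hpt : ∀ q ∈ t, ∃ z : ℂ, ∀ᶠ u in (f : Filter (L2 Ω)), ‖φ u q - z‖ₑ ^ 2 ≤ η := by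
    intro q hq
    have hcpt : IsCompact {z : ℂ | ‖z‖ₑ ^ 2 ≤ C * Λ} := by
      refine Metric.isCompact_of_isClosed_isBounded
        (isClosed_le (by fun_prop) continuous_const) ?_
      have hCΛ : C * Λ ≠ ⊤ := by finiteness
      refine (Metric.isBounded_closedBall (x := (0 : ℂ))
        (r := √(C * Λ).toReal)).subset fun z hz => ?_
      rw [mem_closedBall_zero_iff]
      apply Real.le_sqrt_of_sq_le
      have := ENNReal.toReal_mono hCΛ hz
      simpa using this
    obtain ⟨z, -, hz⟩ := hcpt.ultrafilter_le_nhds (f.map fun u => φ u q) (by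
      rw [le_principal_iff]
      exact hf.mono fun u hu => (hφ u hu).2.2.1 q (ht hq))
    refine ⟨z, ?_⟩
    have hcz : Tendsto (fun w : ℂ => ‖w - z‖ₑ ^ 2) (𝓝 z) (𝓝 0) := by
      have : Continuous fun w : ℂ => ‖w - z‖ₑ ^ 2 := by fun_prop
      simpa using this.tendsto z
    exact hz ((ENNReal.tendsto_nhds_zero.1 hcz) η hη)
  choose! z hz using hpt
  have hall : ∀ᶠ u in (f : Filter (L2 Ω)), ∀ q ∈ t, ‖φ u q - z q‖ₑ ^ 2 ≤ η :=
    (eventually_all_finite htf).2 hz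
  have htri : ∀ a b c : ℂ, ‖a + b + c‖ₑ ^ 2 ≤ 4 * ‖a‖ₑ ^ 2 + 4 * ‖b‖ₑ ^ 2 + 2 * ‖c‖ₑ ^ 2 :=
    fun a b c =>
    calc _ ≤ 2 * ‖a + b‖ₑ ^ 2 + 2 * ‖c‖ₑ ^ 2 := enorm_add_sq_le _ _
      _ ≤ 2 * (2 * ‖a‖ₑ ^ 2 + 2 * ‖b‖ₑ ^ 2) + 2 * ‖c‖ₑ ^ 2 := by
        gcongr
        exact enorm_add_sq_le _ _
      _ = _ := by ring
  refine ⟨_, hf.and hall, fun u hu w hw => ?_⟩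
  obtain ⟨hu1, hu2, -, hu4⟩ := hφ u hu.1
  obtain ⟨hw1, hw2, -, hw4⟩ := hφ w hw.1
  have hunif : ∀ x ∈ square p r, ‖φ u x - φ w x‖ₑ ^ 2 ≤ 36 * η := by
    intro x hx
    have hxc := square_subset_closedSquare p r hx
    obtain ⟨q, hq, hxq⟩ := mem_iUnion₂.1 (hcov hxc)
    have hle : ∀ k, |x k - q k| ≤ δ := fun k => by
      have := PiLp.dist_apply_le x q k
      rw [Real.dist_eq] at this
      exact this.trans (Metric.mem_ball.1 hxq).le
    have hδ' : C * Λ * ENNReal.ofReal (|x 0 - q 0| + |x 1 - q 1|) ≤ η := by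
      refine le_trans ?_ hδη
      gcongr
      exacts [hle 0, hle 1]
    have e : φ u x - φ w x = (φ u x - φ u q) + (φ u q - φ w q) + -(φ w x - φ w q) := by ring
    have e2 : φ u q - φ w q = (φ u q - z q) + -(φ w q - z q) := by ring
    calc ‖φ u x - φ w x‖ₑ ^ 2 ≤ 4 * ‖φ u x - φ u q‖ₑ ^ 2 + 4 * ‖φ u q - φ w q‖ₑ ^ 2 +
          2 * ‖φ w x - φ w q‖ₑ ^ 2 := by
          rw [e]
          refine (htri _ _ _).trans ?_
          rw [enorm_neg]
      _ ≤ 4 * η + 4 * (2 * η + 2 * η) + 2 * η := by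
          have h1 : ‖φ u q - φ w q‖ₑ ^ 2 ≤ 2 * η + 2 * η := by
            rw [e2]
            refine (enorm_add_sq_le _ _).trans ?_
            rw [enorm_neg]
            gcongr
            exacts [hu.2 q hq, hw.2 q hq]
          gcongr
          · exact (hu4 x hxc q (ht hq)).trans hδ'
          · exact (hw4 x hxc q (ht hq)).trans hδ'
      _ = 22 * η := by ring
      _ ≤ _ := by gcongr; norm_num
  have hms : MeasurableSet (square p r) := (isOpen_square p r).measurableSet
  have hmu : AEMeasurable (fun x => ‖φ u x - u x‖ₑ ^ 2) (volume.restrict (square p r)) :=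
    (((hu1.continuous.aestronglyMeasurable).sub ((Lp.aestronglyMeasurable u).mono_measure
      (Measure.restrict_mono_set _ hQ))).enorm).pow_const 2
  calc ∫⁻ x in square p r, ‖u x - w x‖ₑ ^ 2
      ≤ ∫⁻ x in square p r, (4 * ‖φ u x - u x‖ₑ ^ 2 + (4 * (36 * η) + 2 * ‖φ w x - w x‖ₑ ^ 2)) := by
        refine setLIntegral_mono' hms fun x hx => ?_
        have e : u x - w x = -(φ u x - u x) + (φ u x - φ w x) + (φ w x - w x) := by ring
        rw [e, ← add_assoc]
        refine (htri _ _ _).trans ?_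
        rw [enorm_neg]
        gcongr
        exact hunif x hx
    _ = 4 * (∫⁻ x in square p r, ‖φ u x - u x‖ₑ ^ 2) + (4 * (36 * η * V) +
          2 * ∫⁻ x in square p r, ‖φ w x - w x‖ₑ ^ 2) := by
        rw [lintegral_add_left' (hmu.const_mul 4), lintegral_add_left measurable_const,
          setLIntegral_const, lintegral_const_mul' _ _ (by norm_num),
          lintegral_const_mul' _ _ (by norm_num), mul_assoc 4 (36 * η)]
    _ ≤ 4 * (ε / 10) + (4 * (ε / 10) + 2 * (ε / 10)) := by gcongr
    _ = 10 * (ε / 10) := by ring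
    _ = ε := ENNReal.mul_div_cancel (by norm_num) (by norm_num)

end

/-! ### Boundary layers -/

section

variable {Ω : TopologicalSpace.Opens Plane}

theorem setLIntegral_iUnion_le {f : Plane → ℝ≥0∞} {E : ℕ → Set Plane} (hE : Monotone E)
    {c : ℝ≥0∞} (h : ∀ n, ∫⁻ x in E n, f x ≤ c) : ∫⁻ x in ⋃ n, E n, f x ≤ c := by
  rw [setLIntegral_iUnion_of_directed f hE.directed_le]
  exact iSup_le h

theorem mem_columns_iff {i j : Fin 2} (hij : i ≠ j) {γ κ : ℝ → ℝ} (hκ : ∀ a, κ a ≠ 0)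
    {I J : Set ℝ} {x : Plane} : x ∈ columns i j γ κ I J ↔
      ∃ a ∈ I, ∃ t ∈ J, x = cpt j a (γ a + κ a * t) := by
  constructor
  · rintro ⟨h1, h2⟩
    refine ⟨x i, h1, _, h2, ?_⟩
    rw [mul_div_cancel₀ _ (hκ _), add_sub_cancel, cpt_eta hij]
  · rintro ⟨a, ha, t, ht, rfl⟩
    exact (cpt_mem_columns hij (hκ a)).2 ⟨ha, ht⟩

theorem columns_mono {i j : Fin 2} {γ κ : ℝ → ℝ} {I J I' J' : Set ℝ} (hI : I ⊆ I') (hJ : J ⊆ J') :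
    columns i j γ κ I J ⊆ columns i j γ κ I' J' :=
  fun _ hx => ⟨hI hx.1, hJ hx.2⟩

theorem isCompact_columns {i j : Fin 2} (hij : i ≠ j) {γ κ : ℝ → ℝ} (hγ : Continuous γ)
    (hκ : Continuous κ) (hκ0 : ∀ a, κ a ≠ 0) {I J : Set ℝ} (hI : IsCompact I)
    (hJ : IsCompact J) : IsCompact (columns i j γ κ I J) := by
  have hc : Continuous fun p : ℝ × ℝ => cpt j p.1 (γ p.1 + κ p.1 * p.2) :=
    (continuous_cpt j).comp (by fun_prop : Continuous fun p : ℝ × ℝ => (p.1, γ p.1 + κ p.1 * p.2))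
  convert! (hI.prod hJ).image hc using 1
  ext x
  rw [mem_columns_iff hij hκ0]
  constructor
  · rintro ⟨a, ha, t, ht, rfl⟩
    exact ⟨(a, t), ⟨ha, ht⟩, rfl⟩
  · rintro ⟨⟨a, t⟩, ⟨ha, ht⟩, rfl⟩
    exact ⟨a, ha, t, ht, rfl⟩

theorem exists_ofReal_mul_le {C ε : ℝ≥0∞} (hC : C ≠ ⊤) (hε : 0 < ε) :
    ∃ δ : ℝ, 0 < δ ∧ ENNReal.ofReal δ * C ≤ ε := by
  have h1 : Tendsto (fun δ : ℝ => ENNReal.ofReal δ) (𝓝[>] 0) (𝓝 0) := by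
    simpa using (ENNReal.continuous_ofReal.tendsto 0).mono_left nhdsWithin_le_nhds
  have h2 : Tendsto (fun δ : ℝ => ENNReal.ofReal δ * C) (𝓝[>] 0) (𝓝 0) := by
    simpa using ENNReal.Tendsto.mul_const h1 (Or.inr hC)
  obtain ⟨δ, h3, h4⟩ := ((ENNReal.tendsto_nhds_zero.1 h2 ε hε).and self_mem_nhdsWithin).exists
  exact ⟨δ, h4, h3⟩

/-- Along a graph, the mass in a layer of thickness `δ` is of order `δ`, because on every line
transversal to the graph the supremum is controlled by the second derivative. -/
theorem exists_layer_bound {i j : Fin 2} (hij : i ≠ j) {γ : ℝ → ℝ} (hγ : Continuous γ) {s : ℝ}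
    (hs : s = 1 ∨ s = -1) {α β d : ℝ} (hd : 0 < d)
    (hΩ : columns i j γ (fun _ => s) (Icc α β) (Ioc 0 d) ⊆ (Ω : Set Plane)) :
    ∃ C : ℝ≥0∞, C ≠ ⊤ ∧ ∀ δ, δ ≤ d / 2 → ∀ u : L2 Ω, MemH2 u →
      ∫⁻ x in columns i j γ (fun _ => s) (Ioo α β) (Ioo 0 δ), ‖u x‖ₑ ^ 2 ≤
        ENNReal.ofReal δ * C * sqNormH2 u := by
  have hs0 : s ≠ 0 := by rcases hs with rfl | rfl <;> norm_num
  have hs1 : |s| = 1 := by rcases hs with rfl | rfl <;> norm_num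
  have hss : ∀ z : ℂ, (s : ℂ) * ((s : ℂ) * z) = z := by
    intro z
    rcases hs with rfl | rfl <;> simp
  obtain ⟨C, hC, h⟩ := exists_enorm_sq_le_deriv2 (m := d / 2) (M := d) (by positivity)
  refine ⟨C * 2, by finiteness, fun δ hδ u hu => ?_⟩
  have hκ : Continuous fun _ : ℝ => s := continuous_const
  -- The estimate is proved for smooth functions away from the boundary.
  have hη : ∀ η, 0 < η → η < δ →
      ∫⁻ x in columns i j γ (fun _ => s) (Ioo α β) (Ioo η δ), ‖u x‖ₑ ^ 2 ≤
        ENNReal.ofReal δ * C * ((∫⁻ x in columns i j γ (fun _ => s) (Ioo α β) (Ioo η d),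
          ‖u x‖ₑ ^ 2) + ∫⁻ x in columns i j γ (fun _ => s) (Ioo α β) (Ioo η d),
          ‖pd j (pd j u) x‖ₑ ^ 2) := by
    intro η hη0 hηδ
    set F := columns i j γ (fun _ => s) (Ioo α β) (Ioo η δ) with hF
    set G := columns i j γ (fun _ => s) (Ioo α β) (Ioo η d) with hG
    set K := columns i j γ (fun _ => s) (Icc α β) (Icc η d) with hK
    have hKc : IsCompact K := isCompact_columns hij hγ hκ (fun _ => hs0) isCompact_Icc isCompact_Icc
    have hsub : Icc η d ⊆ Ioc 0 d := fun t ht => ⟨hη0.trans_le ht.1, ht.2⟩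
    have hKΩ : K ⊆ (Ω : Set Plane) := (columns_mono Subset.rfl hsub).trans hΩ
    have hGK : G ⊆ K := columns_mono Ioo_subset_Icc_self Ioo_subset_Icc_self
    have hFG : F ⊆ G := columns_mono Subset.rfl (Ioo_subset_Ioo le_rfl (by linarith))
    have hGm : MeasurableSet G := measurableSet_columns hγ hκ measurableSet_Ioo measurableSet_Ioo
    have hev := eventually_partialD_partialD_mollify hKc hKΩ
    have hr := ENNReal.Tendsto.const_mul ((tendsto_setLIntegral_mollify u (hGK.trans hKΩ)).add
      (tendsto_setLIntegral_mollify (pd j (pd j u)) (hGK.trans hKΩ)))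
      (Or.inr (by finiteness : ENNReal.ofReal δ * C ≠ ⊤))
    refine le_of_tendsto_of_tendsto
      (tendsto_setLIntegral_mollify u (hFG.trans (hGK.trans hKΩ))) hr ?_
    filter_upwards [hev] with n hn
    set φ := mollify n u with hφdef
    have hφ : ContDiff ℝ ∞ φ := contDiff_mollify n u
    have hφ1 := contDiff_partialD hφ j
    have hφ2 := contDiff_partialD hφ1 j
    have m0 := measurable_enorm_sq hφ.continuous
    have m2 := measurable_enorm_sq hφ2.continuous
    have e : ∫⁻ x in G, ‖mollify n (pd j (pd j u)) x‖ₑ ^ 2 =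
        ∫⁻ x in G, ‖partialD j (partialD j φ) x‖ₑ ^ 2 :=
      setLIntegral_congr_fun hGm fun x hx => by
        simp only [hφdef, hn x (hGK hx) j j u _ _ (hu.hasWeakDeriv j) (hu.hasWeakDeriv_pd j j)]
    rw [e, ← lintegral_add_left m0, hF, hG,
      setLIntegral_columns hij hγ hκ (fun _ => hs0) measurableSet_Ioo measurableSet_Ioo m0,
      setLIntegral_columns hij hγ hκ (fun _ => hs0) measurableSet_Ioo measurableSet_Ioo
        (F := fun x => ‖φ x‖ₑ ^ 2 + ‖partialD j (partialD j φ) x‖ₑ ^ 2) (m0.add m2),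
      ← lintegral_const_mul' _ _ (by finiteness)]
    refine lintegral_mono fun a => ?_
    simp only [hs1, ENNReal.ofReal_one, one_mul]
    have ml : Measurable fun t => ‖φ (cpt j a (γ a + s * t))‖ₑ ^ 2 :=
      (continuous_column hφ.continuous j a _ _).measurable.enorm.pow_const 2
    rw [lintegral_add_left ml]
    set D := (∫⁻ t in Ioo η d, ‖φ (cpt j a (γ a + s * t))‖ₑ ^ 2) +
      ∫⁻ t in Ioo η d, ‖partialD j (partialD j φ) (cpt j a (γ a + s * t))‖ₑ ^ 2 with hD
    calc _ ≤ ∫⁻ _ in Ioo η δ, C * D := by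
          refine setLIntegral_mono measurable_const fun t ht => ?_
          refine h η d (fun t => φ (cpt j a (γ a + s * t))) _
            (fun t => partialD j (partialD j φ) (cpt j a (γ a + s * t))) (by linarith)
            (by linarith) (hasDerivAt_column hφ j a _ s)
            (fun t => ?_) (continuous_column hφ2.continuous j a _ _) t
            ⟨ht.1.le, by linarith [ht.2]⟩
          have := (hasDerivAt_column hφ1 j a (γ a) s t).const_mul (s : ℂ)
          rwa [hss] at this
      _ = C * D * ENNReal.ofReal (δ - η) := by rw [setLIntegral_const, Real.volume_Ioo]
      _ ≤ C * D * ENNReal.ofReal δ := by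
          gcongr
          linarith
      _ = _ := by ring
  have hU : columns i j γ (fun _ => s) (Ioo α β) (Ioo 0 δ) =
      ⋃ n : ℕ, columns i j γ (fun _ => s) (Ioo α β) (Ioo (1 / ((n : ℝ) + 1)) δ) := by
    ext x
    simp only [columns, mem_ofPred_eq, mem_iUnion, exists_and_left]
    refine and_congr_right fun _ => ⟨fun hx => ?_, fun ⟨n, hx⟩ => ⟨lt_trans (by positivity) hx.1,
      hx.2⟩⟩
    obtain ⟨n, hn⟩ := exists_nat_one_div_lt hx.1
    exact ⟨n, hn, hx.2⟩
  rw [hU]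
  refine setLIntegral_iUnion_le (fun m n hmn => columns_mono Subset.rfl
    (Ioo_subset_Ioo (one_div_le_one_div_of_le (by positivity) (by gcongr)) le_rfl)) fun n => ?_
  rcases lt_or_ge (1 / ((n : ℝ) + 1)) δ with hlt | hge
  · refine (hη _ (by positivity) hlt).trans ?_
    have hIoo : Ioo (1 / ((n : ℝ) + 1)) d ⊆ Ioc 0 d :=
      fun t ht => ⟨lt_trans (by positivity) ht.1, ht.2.le⟩
    have hsub : columns i j γ (fun _ => s) (Ioo α β) (Ioo (1 / ((n : ℝ) + 1)) d) ⊆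
        (Ω : Set Plane) := (columns_mono Ioo_subset_Icc_self hIoo).trans hΩ
    have h1 := (lintegral_mono_set hsub).trans (lintegral_sq_le_sqNormH2 u)
    have h2 := (lintegral_mono_set hsub).trans (lintegral_pd_sq_le_sqNormH2 u j j (by
      fin_cases j <;> decide))
    calc _ ≤ ENNReal.ofReal δ * C * (sqNormH2 u + sqNormH2 u) := by gcongr
      _ = _ := by ring
  · rw [Ioo_eq_empty (not_lt.2 hge)]
    have : columns i j γ (fun _ => s) (Ioo α β) ∅ = ∅ := by
      ext x
      simp [columns]
    rw [this]
    simp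

/-- Near a boundary point the boundary has neighbourhoods that carry an arbitrarily small part of
the mass, uniformly in the functions of bounded `H²` norm. -/
theorem exists_boundary_layer (hΩ : HasSmoothBoundary (Ω : Set Plane)) {p : Plane}
    (hp : p ∈ frontier (Ω : Set Plane)) :
    ∃ W : Set Plane, IsOpen W ∧ p ∈ W ∧ ∀ ε : ℝ≥0∞, 0 < ε → ∃ N : Set Plane, IsOpen N ∧
      frontier (Ω : Set Plane) ∩ W ⊆ N ∧ ∀ u : L2 Ω, MemH2 u →
        ∫⁻ x in (Ω : Set Plane) ∩ N, ‖u x‖ₑ ^ 2 ≤ ε * sqNormH2 u := by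
  obtain ⟨r, hr, i, j, hij, s, hs, γ, hγ, heq⟩ := hΩ p hp
  have hγc : Continuous γ := hγ.continuous
  have hs0 : s ≠ 0 := by rcases hs with rfl | rfl <;> norm_num
  have hss : s * s = 1 := by rcases hs with rfl | rfl <;> norm_num
  have hs1 : |s| = 1 := by rcases hs with rfl | rfl <;> norm_num
  have hmem : ∀ q ∈ Metric.ball p r, (q ∈ (Ω : Set Plane) ↔ 0 < s * (q j - γ (q i))) := by
    intro q hq
    have : q ∈ (Ω : Set Plane) ∩ Metric.ball p r ↔
        q ∈ {x | x ∈ Metric.ball p r ∧ 0 < s * (x j - γ (x i))} := by rw [heq]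
    rw [mem_inter_iff, mem_ofPred_eq, and_comm] at this
    exact (and_congr_right_iff.1 this) hq
  have hfun : Continuous fun q : Plane => s * (q j - γ (q i)) := by fun_prop
  have hzero : ∀ q ∈ frontier (Ω : Set Plane), q ∈ Metric.ball p r → q j = γ (q i) := by
    intro q hq hqb
    rw [Ω.isOpen.frontier_eq] at hq
    have h1 : ¬ 0 < s * (q j - γ (q i)) := fun h => hq.2 ((hmem q hqb).2 h)
    have h2 : ¬ s * (q j - γ (q i)) < 0 := by
      intro h
      obtain ⟨y, ⟨hy1, hy2⟩, hy3⟩ := mem_closure_iff.1 hq.1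
        ({y | s * (y j - γ (y i)) < 0} ∩ Metric.ball p r)
        ((isOpen_lt hfun continuous_const).inter Metric.isOpen_ball) ⟨h, hqb⟩
      exact lt_asymm hy1 ((hmem y hy2).1 hy3)
    have h3 : s * (q j - γ (q i)) = 0 := le_antisymm (not_lt.1 h1) (not_lt.1 h2)
    have := (mul_eq_zero.1 h3).resolve_left hs0
    linarith
  have hpj : p j = γ (p i) := hzero p hp (Metric.mem_ball_self hr)
  obtain ⟨r', hr', hγr⟩ : ∃ r' > 0, ∀ a, |a - p i| ≤ r' → |γ a - p j| < r / 4 ∧ r' ≤ r / 4 := by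
    obtain ⟨δ, hδ, hb⟩ := Metric.continuousAt_iff.1 (hγc.continuousAt (x := p i)) (r / 4)
      (by positivity)
    refine ⟨min (δ / 2) (r / 4), by positivity, fun a ha => ⟨?_, min_le_right _ _⟩⟩
    have := hb (x := a) (by
      rw [Real.dist_eq]
      exact lt_of_le_of_lt (ha.trans (min_le_left _ _)) (by linarith))
    rwa [Real.dist_eq, ← hpj] at this
  have hcol : columns i j γ (fun _ => s) (Icc (p i - r') (p i + r')) (Ioc 0 (r / 4)) ⊆
      (Ω : Set Plane) := by
    intro x hx
    obtain ⟨a, ha, t, ht, rfl⟩ := (mem_columns_iff hij fun _ => hs0).1 hx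
    have ha' : |a - p i| ≤ r' := by
      rw [abs_le]
      constructor <;> linarith [ha.1, ha.2]
    obtain ⟨h1, h2⟩ := hγr a ha'
    have hb : cpt j a (γ a + s * t) ∈ Metric.ball p r := by
      rw [Metric.mem_ball]
      have h3 : |γ a + s * t - p j| ≤ |γ a - p j| + t := by
        calc _ = |(γ a - p j) + s * t| := by ring_nf
          _ ≤ |γ a - p j| + |s * t| := abs_add_le _ _
          _ = _ := by rw [abs_mul, hs1, one_mul, abs_of_pos ht.1]
      have := dist_cpt_le hij a (γ a + s * t) p
      linarith [ht.2]
    rw [hmem _ hb, cpt_self, cpt_of_ne hij, add_sub_cancel_left, ← mul_assoc, hss, one_mul]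
    exact ht.1
  obtain ⟨C, hC, hlayer⟩ := exists_layer_bound hij hγc hs (by positivity : 0 < r / 4) hcol
  refine ⟨{x | |x i - p i| < r'} ∩ Metric.ball p r,
    (isOpen_lt (f := fun x : Plane => |x i - p i|) (by fun_prop) continuous_const).inter
      Metric.isOpen_ball, ⟨by simpa using hr', Metric.mem_ball_self hr⟩, fun ε hε => ?_⟩
  obtain ⟨δ, hδ0, hδd, hδε⟩ : ∃ δ : ℝ, 0 < δ ∧ δ ≤ r / 4 / 2 ∧ ENNReal.ofReal δ * C ≤ ε := by
    obtain ⟨δ, h1, h2⟩ := exists_ofReal_mul_le hC hε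
    exact ⟨min δ (r / 4 / 2), by positivity, min_le_right _ _, le_trans (by gcongr; simp) h2⟩
  refine ⟨{x | |x i - p i| < r' ∧ |x j - γ (x i)| < δ} ∩ Metric.ball p r, ?_, ?_, ?_⟩
  · exact ((isOpen_lt (f := fun x : Plane => |x i - p i|) (by fun_prop) continuous_const).inter
      (isOpen_lt (f := fun x : Plane => |x j - γ (x i)|) (by fun_prop) continuous_const)).inter
      Metric.isOpen_ball
  · rintro q ⟨hq, hq1, hq2⟩
    refine ⟨⟨hq1, ?_⟩, hq2⟩
    rw [hzero q hq hq2, sub_self, abs_zero]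
    exact hδ0
  · intro u hu
    refine le_trans (lintegral_mono_set ?_) ((hlayer δ hδd u hu).trans (by gcongr))
    rintro x ⟨hxΩ, ⟨hx1, hx2⟩, hx3⟩
    have hpos := (hmem x hx3).1 hxΩ
    have hsdiv : (x j - γ (x i)) / s = s * (x j - γ (x i)) := by
      rw [div_eq_iff hs0]
      linear_combination -(x j - γ (x i)) * hss
    refine ⟨?_, ?_⟩
    · rw [abs_lt] at hx1
      constructor <;> linarith [hx1.1, hx1.2]
    · rw [hsdiv]
      refine ⟨hpos, ?_⟩
      rwa [← abs_of_pos hpos, abs_mul, hs1, one_mul]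

end

/-! ### The Hardy inequality in the peak -/

section

variable {Ω : TopologicalSpace.Opens Plane}

/-- The part of the peak with profile `h` that lies over `I` and where `x 1 / h (x 0)` lies
in `J`. -/
def subpeak (h : ℝ → ℝ) (I J : Set ℝ) : Set Plane := columns 0 1 (fun _ => 0) h I J

theorem setLIntegral_subpeak {h : ℝ → ℝ} (hc : Continuous h) (hp : ∀ y, 0 < h y) {I J : Set ℝ}
    (hI : MeasurableSet I) (hJ : MeasurableSet J) {F : Plane → ℝ≥0∞} (hF : Measurable F) :
    ∫⁻ x in subpeak h I J, F x =
      ∫⁻ y in I, ∫⁻ t in J, ENNReal.ofReal (h y) * F (cpt 1 y (h y * t)) := by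
  rw [subpeak, setLIntegral_columns zero_ne_one continuous_const hc (fun a => (hp a).ne') hI hJ hF]
  simp only [zero_add, abs_of_pos (hp _)]
  exact lintegral_congr fun y => (lintegral_const_mul' _ _ ENNReal.ofReal_ne_top).symm

/-- The domain contains the peak with profile `h` over `[a, ∞)`, where `h` is positive and
decreasing with `|h'| ≤ 1`, and `Φ` is a primitive of `1 / h` that is bounded below by `c > 0`.
To the left of `a` the functions `h` and `Φ` only serve as continuous extensions. -/
structure IsRegularPeak (Ω : TopologicalSpace.Opens Plane) (a : ℝ) (h h' Φ : ℝ → ℝ) (c : ℝ) :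
    Prop where
  cont : Continuous h
  pos : ∀ y, 0 < h y
  anti : Antitone h
  hasDerivAt : ∀ y, a ≤ y → HasDerivAt h (h' y) y
  cont_deriv : ContinuousOn h' (Ici a)
  abs_deriv_le : ∀ y, a ≤ y → |h' y| ≤ 1
  cont_primitive : Continuous Φ
  hasDerivAt_primitive : ∀ y, a ≤ y → HasDerivAt Φ (1 / h y) y
  const_pos : 0 < c
  le_primitive : ∀ y, c ≤ Φ y
  subset : subpeak h (Ici a) (Ioo (-1) 1) ⊆ (Ω : Set Plane)

variable {a c : ℝ} {h h' Φ : ℝ → ℝ}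

theorem IsRegularPeak.primitive_pos (hP : IsRegularPeak Ω a h h' Φ c) (y : ℝ) : 0 < Φ y :=
  hP.const_pos.trans_le (hP.le_primitive y)

theorem IsRegularPeak.isCompact (hP : IsRegularPeak Ω a h h' Φ c) (b θ : ℝ) :
    IsCompact (subpeak h (Icc a b) (Icc (-θ) θ)) :=
  isCompact_columns zero_ne_one continuous_const hP.cont (fun y => (hP.pos y).ne') isCompact_Icc
    isCompact_Icc

theorem IsRegularPeak.compact_subset (hP : IsRegularPeak Ω a h h' Φ c) {b θ : ℝ} (hθ : θ < 1) :
    subpeak h (Icc a b) (Icc (-θ) θ) ⊆ (Ω : Set Plane) :=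
  (columns_mono Icc_subset_Ici_self (Icc_subset_Ioo (by linarith) hθ)).trans hP.subset

theorem IsRegularPeak.measurableSet (hP : IsRegularPeak Ω a h h' Φ c) {I J : Set ℝ}
    (hI : MeasurableSet I) (hJ : MeasurableSet J) : MeasurableSet (subpeak h I J) :=
  measurableSet_columns continuous_const hP.cont hI hJ

theorem hasDerivAt_fiber {φ : Plane → ℂ} (h : ContDiff ℝ ∞ φ) (y k t : ℝ) :
    HasDerivAt (fun t => φ (cpt 1 y (k * t))) ((k : ℂ) * partialD 1 φ (cpt 1 y (k * t))) t := by
  simpa using hasDerivAt_column h 1 y 0 k t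

theorem continuous_fiber {E : Type*} [TopologicalSpace E] {φ : Plane → E} (h : Continuous φ)
    (y k : ℝ) : Continuous fun t => φ (cpt 1 y (k * t)) := by
  simpa using continuous_column h 1 y 0 k

theorem enorm_ofReal_mul_sq {k : ℝ} (hk : 0 ≤ k) (z : ℂ) :
    ‖(k : ℂ) * z‖ₑ ^ 2 = ENNReal.ofReal k ^ 2 * ‖z‖ₑ ^ 2 := by
  rw [enorm_mul, mul_pow, ← ofReal_norm (k : ℂ), Complex.norm_real, Real.norm_of_nonneg hk]

/-- Over a bounded interval the transversal derivative is controlled on the fibres by the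
function and its second transversal derivative, uniformly in the width of the subpeak. -/
theorem IsRegularPeak.exists_initial_bound (hP : IsRegularPeak Ω a h h' Φ c) :
    ∃ C : ℝ≥0∞, C ≠ ⊤ ∧ ∀ θ, 1 / 2 ≤ θ → θ < 1 → ∀ u : L2 Ω, MemH2 u →
      ∫⁻ x in subpeak h (Ioo a (a + 1)) (Ioo (-θ) θ), ‖pd 1 u x‖ₑ ^ 2 ≤ C * sqNormH2 u := by
  obtain ⟨C, hC, hd⟩ := exists_enorm_deriv_sq_le (m := 1) (M := 2) one_pos
  set m := h (a + 1) with hm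
  have hm0 : 0 < m := hP.pos _
  set k := ENNReal.ofReal (1 / m) with hk
  set M := 1 + ENNReal.ofReal (h a) ^ 4 with hM
  have hM1 : 1 ≤ M := le_self_add
  have hMt : M ≠ ⊤ := by finiteness
  refine ⟨k ^ 2 * (C * M) * 2 * 2, by finiteness, fun θ hθ hθ1 u hu => ?_⟩
  set E := subpeak h (Ioo a (a + 1)) (Ioo (-θ) θ) with hE
  set K := subpeak h (Icc a (a + 1)) (Icc (-θ) θ) with hK
  have hKc : IsCompact K := hP.isCompact _ _
  have hKΩ : K ⊆ (Ω : Set Plane) := hP.compact_subset hθ1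
  have hEK : E ⊆ K := columns_mono Ioo_subset_Icc_self Ioo_subset_Icc_self
  have hEΩ := hEK.trans hKΩ
  have hEm : MeasurableSet E := hP.measurableSet measurableSet_Ioo measurableSet_Ioo
  have hr := ENNReal.Tendsto.const_mul ((tendsto_setLIntegral_mollify u hEΩ).add
    (tendsto_setLIntegral_mollify (pd 1 (pd 1 u)) hEΩ))
    (Or.inr (by finiteness : k ^ 2 * (C * M) * 2 ≠ ⊤))
  have hlim := le_of_tendsto_of_tendsto (tendsto_setLIntegral_mollify (pd 1 u) hEΩ) hr (by
    filter_upwards [eventually_partialD_mollify hKc hKΩ,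
      eventually_partialD_partialD_mollify hKc hKΩ] with n hn1 hn2
    set φ := mollify n u with hφdef
    have hφ : ContDiff ℝ ∞ φ := contDiff_mollify n u
    have hφ1 := contDiff_partialD hφ 1
    have hφ2 := contDiff_partialD hφ1 1
    have m0 := measurable_enorm_sq hφ.continuous
    have m1 := measurable_enorm_sq hφ1.continuous
    have m2 := measurable_enorm_sq hφ2.continuous
    have e1 : ∫⁻ x in E, ‖mollify n (pd 1 u) x‖ₑ ^ 2 = ∫⁻ x in E, ‖partialD 1 φ x‖ₑ ^ 2 :=
      setLIntegral_congr_fun hEm fun x hx => by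
        simp only [hφdef, hn1 x (hEK hx) 1 u _ (hu.hasWeakDeriv 1)]
    have e2 : ∫⁻ x in E, ‖mollify n (pd 1 (pd 1 u)) x‖ₑ ^ 2 =
        ∫⁻ x in E, ‖partialD 1 (partialD 1 φ) x‖ₑ ^ 2 :=
      setLIntegral_congr_fun hEm fun x hx => by
        simp only [hφdef, hn2 x (hEK hx) 1 1 u _ _ (hu.hasWeakDeriv 1) (hu.hasWeakDeriv_pd 1 1)]
    rw [e1, e2, ← lintegral_add_left m0, hE,
      setLIntegral_subpeak hP.cont hP.pos measurableSet_Ioo measurableSet_Ioo m1,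
      setLIntegral_subpeak hP.cont hP.pos measurableSet_Ioo measurableSet_Ioo
        (F := fun x => ‖φ x‖ₑ ^ 2 + ‖partialD 1 (partialD 1 φ) x‖ₑ ^ 2) (m0.add m2),
      ← lintegral_const_mul' _ _ (by finiteness)]
    refine setLIntegral_mono' measurableSet_Ioo fun y hy => ?_
    have ml : Measurable fun t => ‖φ (cpt 1 y (h y * t))‖ₑ ^ 2 :=
      (continuous_fiber hφ.continuous y _).measurable.enorm.pow_const 2
    have hma : m ≤ h y := hP.anti hy.2.le
    have hya : h y ≤ h a := hP.anti hy.1.le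
    have hk1 : 1 ≤ k ^ 2 * ENNReal.ofReal (h y) ^ 2 := by
      rw [← mul_pow, hk, ← ENNReal.ofReal_mul (by positivity)]
      refine one_le_pow₀ ?_
      rw [← ENNReal.ofReal_one]
      refine ENNReal.ofReal_le_ofReal ?_
      rw [one_div_mul_eq_div, le_div_iff₀ hm0, one_mul]
      exact hma
    simp_rw [mul_add]
    set D := ∫⁻ t in Ioo (-θ) θ, (‖φ (cpt 1 y (h y * t))‖ₑ ^ 2 +
      ‖partialD 1 (partialD 1 φ) (cpt 1 y (h y * t))‖ₑ ^ 2) with hD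
    have hpt : ∀ t ∈ Ioo (-θ) θ, ‖partialD 1 φ (cpt 1 y (h y * t))‖ₑ ^ 2 ≤
        k ^ 2 * (C * M) * D := by
      intro t ht
      have := hd (-θ) θ (fun t => φ (cpt 1 y (h y * t))) _
        (fun t => (h y : ℂ) * ((h y : ℂ) * partialD 1 (partialD 1 φ) (cpt 1 y (h y * t))))
        (by linarith) (by linarith) (fun t => hasDerivAt_fiber hφ y (h y) t)
        (fun t => (hasDerivAt_fiber hφ1 y (h y) t).const_mul _)
        (by have := continuous_fiber hφ2.continuous y (h y); fun_prop) t (Ioo_subset_Icc_self ht)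
      simp only [enorm_ofReal_mul_sq (hP.pos y).le] at this
      calc _ = 1 * ‖partialD 1 φ (cpt 1 y (h y * t))‖ₑ ^ 2 := (one_mul _).symm
        _ ≤ k ^ 2 * ENNReal.ofReal (h y) ^ 2 * ‖partialD 1 φ (cpt 1 y (h y * t))‖ₑ ^ 2 := by
            gcongr
        _ = k ^ 2 * (ENNReal.ofReal (h y) ^ 2 * ‖partialD 1 φ (cpt 1 y (h y * t))‖ₑ ^ 2) := by
            ring
        _ ≤ _ := by
            rw [mul_assoc (k ^ 2), mul_assoc C]
            refine mul_le_mul_right (this.trans (mul_le_mul_right ?_ _)) _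
            rw [hD, lintegral_add_left ml, mul_add]
            refine add_le_add (le_mul_of_one_le_left' hM1) ?_
            rw [← lintegral_const_mul' _ _ hMt]
            refine lintegral_mono fun t => ?_
            rw [← mul_assoc, ← pow_add]
            refine mul_le_mul_left (le_trans ?_ le_add_self) _
            gcongr
    calc _ ≤ ∫⁻ _ in Ioo (-θ) θ, ENNReal.ofReal (h y) * (k ^ 2 * (C * M) * D) :=
          setLIntegral_mono' measurableSet_Ioo fun t ht => by gcongr; exact hpt t ht
      _ = ENNReal.ofReal (h y) * (k ^ 2 * (C * M) * D) * ENNReal.ofReal (θ - -θ) := by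
          rw [setLIntegral_const, Real.volume_Ioo]
      _ ≤ ENNReal.ofReal (h y) * (k ^ 2 * (C * M) * D) * 2 := by
          gcongr
          rw [← ENNReal.ofReal_ofNat]
          exact ENNReal.ofReal_le_ofReal (by linarith)
      _ = k ^ 2 * (C * M) * 2 * (ENNReal.ofReal (h y) * D) := by ring
      _ = _ := by
          rw [hD, ← lintegral_const_mul' _ _ ENNReal.ofReal_ne_top]
          simp_rw [mul_add])
  refine hlim.trans ?_
  have h1 := (lintegral_mono_set hEΩ).trans (lintegral_sq_le_sqNormH2 u)
  have h2 := (lintegral_mono_set hEΩ).trans (lintegral_pd_sq_le_sqNormH2 u 1 1 (by decide))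
  calc _ ≤ k ^ 2 * (C * M) * 2 * (sqNormH2 u + sqNormH2 u) := by gcongr
    _ = _ := by ring

theorem measurable_subpeak_coord {h : ℝ → ℝ} (hc : Continuous h) {F : Plane → ℝ≥0∞}
    (hF : Measurable F) :
    Measurable fun p : ℝ × ℝ => ENNReal.ofReal (h p.2) * F (cpt 1 p.2 (h p.2 * p.1)) := by
  have h1 : Measurable fun p : ℝ × ℝ => F (cpt 1 p.2 (h p.2 * p.1)) :=
    hF.comp ((continuous_cpt 1).comp
      (by fun_prop : Continuous fun p : ℝ × ℝ => (p.2, h p.2 * p.1))).measurable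
  have h2 : Measurable fun p : ℝ × ℝ => h p.2 := (hc.comp continuous_snd).measurable
  exact h2.ennreal_ofReal.mul h1

/-- In a subpeak one may integrate along the curves `x 1 = t h (x 0)` first. -/
theorem setLIntegral_subpeak_swap {h : ℝ → ℝ} (hc : Continuous h) (hp : ∀ y, 0 < h y)
    {I J : Set ℝ} (hI : MeasurableSet I) (hJ : MeasurableSet J) {F : Plane → ℝ≥0∞}
    (hF : Measurable F) :
    ∫⁻ x in subpeak h I J, F x =
      ∫⁻ t in J, ∫⁻ y in I, ENNReal.ofReal (h y) * F (cpt 1 y (h y * t)) := by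
  rw [setLIntegral_subpeak hc hp hI hJ hF]
  exact lintegral_lintegral_swap
    ((measurable_subpeak_coord hc hF).comp measurable_swap).aemeasurable

/-- The weight of the Hardy inequality in the peak. -/
noncomputable def peakWeight (h Φ : ℝ → ℝ) (x : Plane) : ℝ≥0∞ :=
  ENNReal.ofReal (1 / (h (x 0) ^ 2 * Φ (x 0) ^ 2))

theorem IsRegularPeak.measurable_peakWeight (hP : IsRegularPeak Ω a h h' Φ c) :
    Measurable (peakWeight h Φ) := by
  have h1 := hP.cont.measurable
  have h2 := hP.cont_primitive.measurable
  unfold peakWeight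
  fun_prop

/-- The one-dimensional Hardy inequality along the curves `x 1 = t h (x 0)`, integrated
over `t`. -/
theorem IsRegularPeak.lintegral_hardy_smooth_le (hP : IsRegularPeak Ω a h h' Φ c)
    {ψ : Plane → ℂ} (hψ : ContDiff ℝ ∞ ψ) {b θ : ℝ} (hb : a + 1 ≤ b) (hθ : θ ≤ 1) :
    ∫⁻ x in subpeak h (Ioo (a + 1) b) (Ioo (-θ) θ), peakWeight h Φ x * ‖ψ x‖ₑ ^ 2 ≤
      ENNReal.ofReal (2 / c) * ENNReal.ofReal (1 / h (a + 1)) *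
        (∫⁻ x in subpeak h (Ioo a (a + 1)) (Ioo (-θ) θ), ‖ψ x‖ₑ ^ 2) +
      8 * ∫⁻ x in subpeak h (Ioo a b) (Ioo (-θ) θ),
        (‖partialD 0 ψ x‖ₑ ^ 2 + ‖partialD 1 ψ x‖ₑ ^ 2) := by
  have hψ0 := contDiff_partialD hψ 0
  have hψ1 := contDiff_partialD hψ 1
  have m := measurable_enorm_sq hψ.continuous
  have md : Measurable fun x => ‖partialD 0 ψ x‖ₑ ^ 2 + ‖partialD 1 ψ x‖ₑ ^ 2 :=
    (measurable_enorm_sq hψ0.continuous).add (measurable_enorm_sq hψ1.continuous)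
  have hm0 : 0 < h (a + 1) := hP.pos _
  rw [setLIntegral_subpeak_swap hP.cont hP.pos measurableSet_Ioo measurableSet_Ioo
      (F := fun x => peakWeight h Φ x * ‖ψ x‖ₑ ^ 2) (hP.measurable_peakWeight.mul m),
    setLIntegral_subpeak_swap hP.cont hP.pos measurableSet_Ioo measurableSet_Ioo m,
    setLIntegral_subpeak_swap hP.cont hP.pos measurableSet_Ioo measurableSet_Ioo
      (F := fun x => ‖partialD 0 ψ x‖ₑ ^ 2 + ‖partialD 1 ψ x‖ₑ ^ 2) md,
    ← lintegral_const_mul' _ _ (by finiteness), ← lintegral_const_mul' _ _ (by finiteness),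
    ← lintegral_add_left ((measurable_subpeak_coord hP.cont m).lintegral_prod_right'.const_mul _)]
  refine setLIntegral_mono' measurableSet_Ioo fun t ht => ?_
  have ht1 : |t| ≤ 1 := abs_le.2 ⟨by linarith [ht.1], by linarith [ht.2]⟩
  have hcurve : ContinuousOn (fun y => cpt 1 y (h y * t)) (Icc a b) :=
    ((continuous_cpt 1).comp
      (by have := hP.cont; fun_prop : Continuous fun y : ℝ => (y, h y * t))).continuousOn
  have hder : ∀ y ∈ Icc a b, HasDerivAt (fun y => ψ (cpt 1 y (h y * t)))
      (partialD 0 ψ (cpt 1 y (h y * t)) +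
        ((h' y * t : ℝ) : ℂ) * partialD 1 ψ (cpt 1 y (h y * t))) y := by
    intro y hy
    have := hasDerivAt_comp_cpt hψ zero_ne_one (hasDerivAt_id y)
      ((hP.hasDerivAt y hy.1).mul_const t)
    simpa using this
  have hh' : ContinuousOn (fun y => ((h' y * t : ℝ) : ℂ)) (Icc a b) :=
    Complex.continuous_ofReal.comp_continuousOn
      ((hP.cont_deriv.mono Icc_subset_Ici_self).mul continuousOn_const)
  refine le_trans (le_of_eq_of_le ?_ (lintegral_hardy_le hb hder
    ((hψ0.continuous.comp_continuousOn hcurve).add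
      (hh'.mul (hψ1.continuous.comp_continuousOn hcurve)))
    hP.cont.continuousOn (fun y _ => hP.pos y) (fun y hy => hP.hasDerivAt_primitive y hy.1)
    hP.const_pos fun y _ => hP.le_primitive y)) (add_le_add ?_ ?_)
  · refine lintegral_congr fun y => ?_
    have hy := hP.pos y
    have hz := hP.primitive_pos y
    rw [← mul_assoc, peakWeight, cpt_of_ne zero_ne_one, ← ENNReal.ofReal_mul hy.le]
    congr 2
    field_simp
  · rw [mul_assoc]
    gcongr
    rw [← lintegral_const_mul' _ _ ENNReal.ofReal_ne_top]
    refine setLIntegral_mono' measurableSet_Ioo fun y hy => ?_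
    rw [← mul_assoc, ← ENNReal.ofReal_mul (by positivity)]
    refine le_mul_of_one_le_left' ?_
    rw [← ENNReal.ofReal_one]
    refine ENNReal.ofReal_le_ofReal ?_
    rw [one_div_mul_eq_div, le_div_iff₀ hm0, one_mul]
    exact hP.anti hy.2.le
  · have h8 : (8 : ℝ≥0∞) = 4 * 2 := by norm_num
    rw [h8, mul_assoc 4]
    refine mul_le_mul_right ?_ _
    rw [← lintegral_const_mul' _ _ (by finiteness)]
    refine setLIntegral_mono' measurableSet_Ioo fun y hy => ?_
    rw [mul_left_comm]
    refine mul_le_mul_right ((enorm_add_sq_le _ _).trans ?_) _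
    rw [mul_add]
    refine add_le_add_right (mul_le_mul_right ?_ _) _
    rw [enorm_mul, mul_pow]
    refine mul_le_of_le_one_left' (pow_le_one₀ zero_le ?_)
    rw [← ofReal_norm, Complex.norm_real, ← ENNReal.ofReal_one]
    refine ENNReal.ofReal_le_ofReal ?_
    rw [Real.norm_eq_abs, abs_mul]
    exact mul_le_one₀ (hP.abs_deriv_le y hy.1.le) (abs_nonneg _) ht1

/-- The Hardy inequality in the peak for the transversal derivative of functions in `H²`. -/
theorem IsRegularPeak.exists_hardy_bound (hP : IsRegularPeak Ω a h h' Φ c) :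
    ∃ C : ℝ≥0∞, C ≠ ⊤ ∧ ∀ u : L2 Ω, MemH2 u →
      ∫⁻ x in subpeak h (Ioi (a + 1)) (Ioo (-1) 1), peakWeight h Φ x * ‖pd 1 u x‖ₑ ^ 2 ≤
        C * sqNormH2 u := by
  obtain ⟨C, hC, hini⟩ := hP.exists_initial_bound
  set k := ENNReal.ofReal (2 / c) * ENNReal.ofReal (1 / h (a + 1)) with hk
  have hkt : k ≠ ⊤ := by finiteness
  refine ⟨k * C + 16, by finiteness, fun u hu => ?_⟩
  -- On a compact part of the peak smooth functions approximate.
  have hbd : ∀ b θ, a + 1 ≤ b → 1 / 2 ≤ θ → θ < 1 →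
      ∫⁻ x in subpeak h (Ioo (a + 1) b) (Ioo (-θ) θ), peakWeight h Φ x * ‖pd 1 u x‖ₑ ^ 2 ≤
        (k * C + 16) * sqNormH2 u := by
    intro b θ hb hθ hθ1
    set E := subpeak h (Ioo (a + 1) b) (Ioo (-θ) θ) with hE
    set G := subpeak h (Ioo a b) (Ioo (-θ) θ) with hG
    set S := subpeak h (Ioo a (a + 1)) (Ioo (-θ) θ) with hS
    set K := subpeak h (Icc a b) (Icc (-θ) θ) with hK
    have hKc : IsCompact K := hP.isCompact _ _
    have hKΩ : K ⊆ (Ω : Set Plane) := hP.compact_subset hθ1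
    have hGK : G ⊆ K := columns_mono Ioo_subset_Icc_self Ioo_subset_Icc_self
    have hEG : E ⊆ G := columns_mono (Ioo_subset_Ioo_left (by linarith)) Subset.rfl
    have hSG : S ⊆ G := columns_mono (Ioo_subset_Ioo_right hb) Subset.rfl
    have hGΩ := hGK.trans hKΩ
    have hEm : MeasurableSet E := hP.measurableSet measurableSet_Ioo measurableSet_Ioo
    have hGm : MeasurableSet G := hP.measurableSet measurableSet_Ioo measurableSet_Ioo
    have hwm := hP.measurable_peakWeight
    -- The measure on the left-hand side is dominated by Lebesgue measure.
    set D := ENNReal.ofReal (1 / (h b ^ 2 * c ^ 2)) with hD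
    have hμ : (volume.restrict E).withDensity (peakWeight h Φ) ≤
        D • volume.restrict (Ω : Set Plane) := by
      rw [← withDensity_const]
      refine (withDensity_mono (g := fun _ => D)
        (ae_restrict_of_forall_mem hEm fun x hx => ?_)).trans ?_
      · have hc0 := hP.const_pos
        have hb0 := hP.pos b
        refine ENNReal.ofReal_le_ofReal (one_div_le_one_div_of_le (by positivity) ?_)
        have h1 := hP.anti hx.1.2.le
        have h2 := hP.le_primitive (x 0)
        gcongr
      · rw [withDensity_const, withDensity_const]
        gcongr
        exact hEG.trans hGΩ
    have hint : ∀ v : Plane → ℂ, AEStronglyMeasurable v (volume.restrict E) →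
        ∫⁻ x, ‖v x‖ₑ ^ 2 ∂(volume.restrict E).withDensity (peakWeight h Φ) =
        ∫⁻ x in E, peakWeight h Φ x * ‖v x‖ₑ ^ 2 := fun v hv =>
      lintegral_withDensity_eq_lintegral_mul₀ hwm.aemeasurable (hv.enorm.pow_const 2)
    have hl := tendsto_lintegral_mollify (pd 1 u) (by finiteness : D ≠ ⊤) hμ
    rw [hint _ ((Lp.aestronglyMeasurable _).mono_measure
      (Measure.restrict_mono_set _ (hEG.trans hGΩ)))] at hl
    have hr := (ENNReal.Tendsto.const_mul (tendsto_setLIntegral_mollify (pd 1 u)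
      (hSG.trans hGΩ)) (Or.inr hkt)).add (ENNReal.Tendsto.const_mul
      ((tendsto_setLIntegral_mollify (pd 0 (pd 1 u)) hGΩ).add
        (tendsto_setLIntegral_mollify (pd 1 (pd 1 u)) hGΩ))
      (Or.inr (by finiteness : (8 : ℝ≥0∞) ≠ ⊤)))
    have hlim := le_of_tendsto_of_tendsto hl hr (by
      filter_upwards [eventually_partialD_mollify hKc hKΩ] with n hn
      have hψ : ContDiff ℝ ∞ (mollify n (pd 1 u)) := contDiff_mollify n _
      have e : ∀ i, ∫⁻ x in G, ‖mollify n (pd i (pd 1 u)) x‖ₑ ^ 2 =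
          ∫⁻ x in G, ‖partialD i (mollify n (pd 1 u)) x‖ₑ ^ 2 := fun i =>
        setLIntegral_congr_fun hGm fun x hx => by
          simp only [hn x (hGK hx) i _ _ (hu.hasWeakDeriv_pd i 1)]
      rw [hint _ hψ.continuous.aestronglyMeasurable, e, e,
        ← lintegral_add_left (measurable_enorm_sq (contDiff_partialD hψ 0).continuous)]
      exact hP.lintegral_hardy_smooth_le hψ hb hθ1.le)
    refine hlim.trans ?_
    have h0 := (lintegral_mono_set hGΩ).trans (lintegral_pd_sq_le_sqNormH2 u 0 1 (by decide))
    have h1 := (lintegral_mono_set hGΩ).trans (lintegral_pd_sq_le_sqNormH2 u 1 1 (by decide))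
    calc _ ≤ k * (C * sqNormH2 u) + 8 * (sqNormH2 u + sqNormH2 u) := by
          gcongr
          exact hini θ hθ hθ1 u hu
      _ = _ := by ring
  have hU : subpeak h (Ioi (a + 1)) (Ioo (-1) 1) ⊆ ⋃ n : ℕ, subpeak h
      (Ioo (a + 1) (a + 1 + n)) (Ioo (-(1 - 1 / ((n : ℝ) + 2))) (1 - 1 / ((n : ℝ) + 2))) := by
    intro x hx
    obtain ⟨hx1, hx2⟩ := hx
    rw [mem_iUnion]
    set t := (x 1 - 0) / h (x 0) with ht
    have htt : |t| < 1 := abs_lt.2 hx2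
    obtain ⟨l, hl⟩ := exists_nat_gt (max (x 0 - (a + 1)) (1 / (1 - |t|)))
    have hl1 := (le_max_left _ _).trans_lt hl
    have hl2 := (le_max_right _ _).trans_lt hl
    have hpos : 0 < 1 - |t| := by linarith
    have hlt : |t| < 1 - 1 / ((l : ℝ) + 2) := by
      have : 1 / ((l : ℝ) + 2) < 1 - |t| := by
        rw [div_lt_iff₀ hpos] at hl2
        rw [div_lt_iff₀ (by positivity)]
        nlinarith
      linarith
    exact ⟨l, ⟨hx1, by linarith⟩, abs_lt.1 hlt⟩
  refine (lintegral_mono_set hU).trans (setLIntegral_iUnion_le (fun n l hnl => ?_) fun n => ?_)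
  · have h1 : 1 / ((l : ℝ) + 2) ≤ 1 / ((n : ℝ) + 2) :=
      one_div_le_one_div_of_le (by positivity) (by gcongr)
    refine columns_mono (Ioo_subset_Ioo_right (by gcongr)) (Ioo_subset_Ioo ?_ ?_) <;> linarith
  · have h1 : 1 / ((n : ℝ) + 2) ≤ 1 / 2 := one_div_le_one_div_of_le (by norm_num) (by simp)
    have h2 : 0 < 1 / ((n : ℝ) + 2) := by positivity
    exact hbd _ _ (by simp) (by linarith) (by linarith)

end

/-! ### The trace on one side of the peak -/

section

variable {Ω : TopologicalSpace.Opens Plane} {a c : ℝ} {h h' Φ : ℝ → ℝ}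

/-- Arc length on a graph is at least the length of the projection. -/
theorem setLIntegral_graph_le {i j : Fin 2} (hij : i ≠ j) {γ : ℝ → ℝ} (hγ : Continuous γ)
    {F : Plane → ℝ≥0∞} (hF : Measurable F) (α β : ℝ) :
    ∫⁻ y in Icc α β, F (cpt j y (γ y)) ≤
      ∫⁻ x in (fun y => cpt j y (γ y)) '' Icc α β, F x ∂Measure.hausdorffMeasure 1 := by
  set g : ℝ → Plane := fun y => cpt j y (γ y) with hg
  have hgc : Continuous g :=
    (continuous_cpt j).comp (by fun_prop : Continuous fun y : ℝ => (y, γ y))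
  set K := g '' Icc α β with hK
  have hKm : MeasurableSet K := (isCompact_Icc.image hgc).measurableSet
  set π : Plane → ℝ := fun x => x i with hπ
  have hπm : Measurable π := by fun_prop
  have hπg : ∀ y, π (g y) = y := fun y => cpt_of_ne hij _ _
  have hLip : LipschitzWith 1 π := LipschitzWith.of_dist_le_mul fun x y => by
    rw [NNReal.coe_one, one_mul, Real.dist_eq, EuclideanSpace.dist_eq]
    refine Real.le_sqrt_of_sq_le ?_
    rw [sq_abs]
    have := Finset.single_le_sum (f := fun k => dist (x k) (y k) ^ 2)
      (fun k _ => sq_nonneg _) (Finset.mem_univ i)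
    simpa [Real.dist_eq, sq_abs] using this
  have hle : volume.restrict (Icc α β) ≤
      ((Measure.hausdorffMeasure 1 : Measure Plane).restrict K).map π := by
    refine Measure.le_iff.2 fun s hs => ?_
    rw [Measure.restrict_apply hs, Measure.map_apply hπm hs,
      Measure.restrict_apply (hπm hs), ← hausdorffMeasure_real]
    have hsub : s ∩ Icc α β ⊆ π '' (π ⁻¹' s ∩ K) := by
      rintro y ⟨hy, hy'⟩
      exact ⟨g y, ⟨by rwa [mem_preimage, hπg], mem_image_of_mem _ hy'⟩, hπg y⟩
    refine (measure_mono hsub).trans ((hLip.hausdorffMeasure_image_le zero_le_one _).trans ?_)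
    simp
  calc ∫⁻ y in Icc α β, F (g y)
      ≤ ∫⁻ y, F (g y) ∂((Measure.hausdorffMeasure 1 : Measure Plane).restrict K).map π :=
        lintegral_mono' hle le_rfl
    _ = ∫⁻ x in K, F (g (π x)) ∂Measure.hausdorffMeasure 1 :=
        lintegral_map (hF.comp hgc.measurable) hπm
    _ = _ := by
        refine setLIntegral_congr_fun hKm ?_
        rintro _ ⟨y, -, rfl⟩
        simp only [hπg]

/-- The one-dimensional Friedrichs inequality on the fibres of the peak. -/
theorem IsRegularPeak.lintegral_smooth_le (hP : IsRegularPeak Ω a h h' Φ c) {φ : Plane → ℂ}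
    (hφ : ContDiff ℝ ∞ φ) {σ : ℝ} (hσ : σ = 1 ∨ σ = -1) {α β : ℝ} (hα : a ≤ α) :
    ∫⁻ x in subpeak h (Ioo α β) (Ioo (-1) 1), ‖φ x‖ₑ ^ 2 ≤
      4 * ENNReal.ofReal (h a) * (∫⁻ y in Icc α β, ‖φ (cpt 1 y (σ * h y))‖ₑ ^ 2) +
      8 * ∫⁻ x in subpeak h (Ioo α β) (Ioo (-1) 1),
        ENNReal.ofReal (h (x 0)) ^ 2 * ‖partialD 1 φ x‖ₑ ^ 2 := by
  have hφ1 := contDiff_partialD hφ 1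
  have m0 := measurable_enorm_sq hφ.continuous
  have m1 := measurable_enorm_sq hφ1.continuous
  have mh : Measurable fun x : Plane => ENNReal.ofReal (h (x 0)) ^ 2 := by
    have := hP.cont.measurable
    fun_prop
  have mb : Measurable fun y => ‖φ (cpt 1 y (σ * h y))‖ₑ ^ 2 :=
    m0.comp ((continuous_cpt 1).comp
      (by have := hP.cont; fun_prop : Continuous fun y : ℝ => (y, σ * h y))).measurable
  have hIcc : ∫⁻ y in Ioo α β, ‖φ (cpt 1 y (σ * h y))‖ₑ ^ 2 ≤
      ∫⁻ y in Icc α β, ‖φ (cpt 1 y (σ * h y))‖ₑ ^ 2 := lintegral_mono_set Ioo_subset_Icc_self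
  refine le_trans ?_ (add_le_add_left (mul_le_mul_right hIcc _) _)
  rw [setLIntegral_subpeak hP.cont hP.pos measurableSet_Ioo measurableSet_Ioo m0,
    setLIntegral_subpeak hP.cont hP.pos measurableSet_Ioo measurableSet_Ioo
      (F := fun x => ENNReal.ofReal (h (x 0)) ^ 2 * ‖partialD 1 φ x‖ₑ ^ 2) (mh.mul m1),
    ← lintegral_const_mul' _ _ (by finiteness), ← lintegral_const_mul' _ _ (by finiteness),
    ← lintegral_add_left (mb.const_mul _)]
  refine setLIntegral_mono' measurableSet_Ioo fun y hy => ?_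
  simp only [cpt_of_ne (zero_ne_one : (0 : Fin 2) ≠ 1)]
  set k := ENNReal.ofReal (h y) with hk
  have hka : k ≤ ENNReal.ofReal (h a) := ENNReal.ofReal_le_ofReal (hP.anti (hα.trans hy.1.le))
  have hkt : k ≠ ⊤ := ENNReal.ofReal_ne_top
  set D := ∫⁻ t in Ioo (-1 : ℝ) 1, k ^ 2 * ‖partialD 1 φ (cpt 1 y (h y * t))‖ₑ ^ 2 with hD
  set B := ‖φ (cpt 1 y (σ * h y))‖ₑ ^ 2 with hB
  have hσ1 : σ ∈ Icc (-1 : ℝ) 1 := by rcases hσ with rfl | rfl <;> norm_num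
  have hpt : ∀ t ∈ Ioo (-1 : ℝ) 1, k * ‖φ (cpt 1 y (h y * t))‖ₑ ^ 2 ≤
      k * (2 * (2 * D) + 2 * B) := by
    intro t ht
    refine mul_le_mul_right ?_ _
    have h1 := enorm_sub_sq_le (fun t => hasDerivAt_fiber hφ y (h y) t)
      (by have := continuous_fiber hφ1.continuous y (h y); fun_prop)
      (Ioo_subset_Icc_self ht) hσ1
    simp only [enorm_ofReal_mul_sq (hP.pos y).le] at h1
    have h2 : |t - σ| ≤ 2 := by
      rw [abs_le]
      constructor <;> linarith [ht.1, ht.2, hσ1.1, hσ1.2]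
    have h3 := enorm_add_sq_le (φ (cpt 1 y (h y * t)) - φ (cpt 1 y (h y * σ)))
      (φ (cpt 1 y (h y * σ)))
    rw [sub_add_cancel] at h3
    refine h3.trans (add_le_add (mul_le_mul_right (h1.trans (mul_le_mul_left ?_ _)) _) ?_)
    · rw [← ENNReal.ofReal_ofNat]
      exact ENNReal.ofReal_le_ofReal h2
    · rw [hB, mul_comm σ]
  calc _ ≤ ∫⁻ _ in Ioo (-1 : ℝ) 1, k * (2 * (2 * D) + 2 * B) :=
        setLIntegral_mono' measurableSet_Ioo hpt
    _ = k * (2 * (2 * D) + 2 * B) * 2 := by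
        rw [setLIntegral_const, Real.volume_Ioo]
        norm_num
    _ = 4 * k * B + 8 * (k * D) := by ring
    _ ≤ 4 * ENNReal.ofReal (h a) * B + 8 * (k * D) := by gcongr
    _ = _ := by rw [hD, lintegral_const_mul' _ _ hkt]

theorem tendsto_lintegral_sub_sq {φ : ℕ → Plane → ℂ} {u : Plane → ℂ} {μ : Measure Plane}
    {ε : ℕ → ℝ≥0∞} (hε : Tendsto ε atTop (𝓝 0))
    (hn : ∀ n, eLpNorm (fun x => u x - φ n x) 2 μ < ε n) :
    Tendsto (fun n => ∫⁻ x, ‖φ n x - u x‖ₑ ^ 2 ∂μ) atTop (𝓝 0) := by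
  have h0 : Tendsto (fun n => ε n ^ 2) atTop (𝓝 0) := by
    simpa [Function.comp_def] using ((ENNReal.continuous_pow 2).tendsto 0).comp hε
  refine tendsto_of_tendsto_of_tendsto_of_le_of_le tendsto_const_nhds h0
    (fun _ => zero_le) fun n => ?_
  simp only [enorm_sub_rev (φ n _)]
  rw [← eLpNorm_two_sq]
  gcongr
  exact (hn n).le

/-- If `u` vanishes on one side of the peak, the mass of `u` is controlled by the transversal
derivative with the factor `h ^ 2`. -/
theorem IsRegularPeak.lintegral_le_of_zeroTrace (hP : IsRegularPeak Ω a h h' Φ c)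
    {Γ : Set Plane} {σ : ℝ} (hσ : σ = 1 ∨ σ = -1) (hΓ : ∀ y, a ≤ y → cpt 1 y (σ * h y) ∈ Γ)
    {u : L2 Ω} (hu : ZeroTrace Γ u) {α β : ℝ} (hα : a ≤ α) :
    ∫⁻ x in subpeak h (Ioo α β) (Ioo (-1) 1), ‖u x‖ₑ ^ 2 ≤
      8 * ∫⁻ x in subpeak h (Ioo α β) (Ioo (-1) 1),
        ENNReal.ofReal (h (x 0)) ^ 2 * ‖pd 1 u x‖ₑ ^ 2 := by
  set P := subpeak h (Ioo α β) (Ioo (-1) 1) with hPdef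
  have hPΩ : P ⊆ (Ω : Set Plane) :=
    (columns_mono (fun y hy => hα.trans hy.1.le) Subset.rfl).trans hP.subset
  have hPm : MeasurableSet P := hP.measurableSet measurableSet_Ioo measurableSet_Ioo
  have hγ : Continuous fun y => σ * h y := continuous_const.mul hP.cont
  set K := (fun y => cpt 1 y (σ * h y)) '' Icc α β with hK
  have hKc : IsCompact K := isCompact_Icc.image
    ((continuous_cpt 1).comp (by fun_prop : Continuous fun y : ℝ => (y, σ * h y)))
  have hKΓ : K ⊆ Γ := by
    rintro _ ⟨y, hy, rfl⟩
    exact hΓ y (hα.trans hy.1)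
  have hε : ∀ n : ℕ, 0 < ((n : ℝ≥0∞) + 1)⁻¹ := fun n => by simp
  have hε0 : Tendsto (fun n : ℕ => ((n : ℝ≥0∞) + 1)⁻¹) atTop (𝓝 0) := by
    have := (tendsto_add_atTop_iff_nat (f := fun n : ℕ => (n : ℝ≥0∞)⁻¹) 1).2
      ENNReal.tendsto_inv_nat_nhds_zero
    simpa using this
  choose φ hφ h0 h1 h2 using fun n => hu K hKΓ hKc _ (hε n)
  have hφc : ∀ n, ContDiff ℝ ∞ (φ n) := fun n => (hφ n).smooth
  have l0 := tendsto_lintegral_sq (u := u) (fun n => (hφc n).continuous)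
    (tendsto_lintegral_sub_sq hε0 h0) (μ := volume.restrict P) ENNReal.one_ne_top
    (by rw [one_smul]; exact Measure.restrict_mono_set _ hPΩ)
  -- The weight is bounded, so that the weighted measure is dominated by Lebesgue measure.
  have mh : Measurable fun x : Plane => ENNReal.ofReal (h (x 0)) ^ 2 := by
    have := hP.cont.measurable
    fun_prop
  set D := ENNReal.ofReal (h a) ^ 2 with hD
  have hμ : (volume.restrict P).withDensity (fun x => ENNReal.ofReal (h (x 0)) ^ 2) ≤
      D • volume.restrict (Ω : Set Plane) := by
    rw [← withDensity_const]
    refine (withDensity_mono (g := fun _ => D)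
      (ae_restrict_of_forall_mem hPm fun x hx => ?_)).trans ?_
    · refine pow_le_pow_left₀ zero_le (ENNReal.ofReal_le_ofReal ?_) 2
      exact hP.anti (hα.trans hx.1.1.le)
    · rw [withDensity_const, withDensity_const]
      gcongr
  have hint : ∀ v : Plane → ℂ, AEStronglyMeasurable v (volume.restrict P) →
      ∫⁻ x, ‖v x‖ₑ ^ 2 ∂(volume.restrict P).withDensity
        (fun x => ENNReal.ofReal (h (x 0)) ^ 2) =
      ∫⁻ x in P, ENNReal.ofReal (h (x 0)) ^ 2 * ‖v x‖ₑ ^ 2 := fun v hv =>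
    lintegral_withDensity_eq_lintegral_mul₀ mh.aemeasurable (hv.enorm.pow_const 2)
  have l1 := tendsto_lintegral_sq (u := pd 1 u)
    (fun n => (contDiff_partialD (hφc n) 1).continuous)
    (tendsto_lintegral_sub_sq hε0 fun n => h1 n 1) (by finiteness : D ≠ ⊤) hμ
  rw [hint _ ((Lp.aestronglyMeasurable _).mono_measure (Measure.restrict_mono_set _ hPΩ))] at l1
  have l2 : Tendsto (fun n => ∫⁻ x in K, ‖φ n x‖ₑ ^ 2 ∂Measure.hausdorffMeasure 1) atTop
      (𝓝 0) := by
    have := tendsto_lintegral_sub_sq (u := fun _ => 0) hε0 (φ := fun n x => - φ n x)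
      (μ := (Measure.hausdorffMeasure 1).restrict K) (by simpa using h2)
    simpa using this
  have lr := (ENNReal.Tendsto.const_mul l2
    (Or.inr (by finiteness : 4 * ENNReal.ofReal (h a) ≠ ⊤))).add
    (ENNReal.Tendsto.const_mul l1 (Or.inr (by finiteness : (8 : ℝ≥0∞) ≠ ⊤)))
  rw [mul_zero, zero_add] at lr
  refine le_of_tendsto_of_tendsto' l0 lr fun n => ?_
  rw [hint _ (contDiff_partialD (hφc n) 1).continuous.aestronglyMeasurable]
  refine (hP.lintegral_smooth_le (hφc n) hσ hα).trans (add_le_add_left ?_ _)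
  exact mul_le_mul_right (setLIntegral_graph_le zero_ne_one hγ
    (measurable_enorm_sq (hφc n).continuous) α β) _

end

/-! ### The tail of the peak carries little mass -/

section

variable {Ω : TopologicalSpace.Opens Plane} {a c : ℝ} {h h' Φ : ℝ → ℝ}

theorem IsPeakProfile.hasDerivAt {R : ℝ} {H : ℝ → ℝ} (hH : IsPeakProfile R H) {y : ℝ}
    (hy : R < y) : HasDerivAt H (deriv H y) y :=
  ((hH.smooth.differentiableOn (by simp)).differentiableAt (Ioi_mem_nhds hy)).hasDerivAt

theorem IsPeakProfile.intervalIntegrable_inv {R : ℝ} {H : ℝ → ℝ} (hH : IsPeakProfile R H) {y : ℝ}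
    (hy : R < y) : IntervalIntegrable (fun τ => (H τ)⁻¹) volume R y := by
  rw [intervalIntegrable_iff_integrableOn_Ioc_of_le hy.le]
  refine IntegrableOn.of_bound (C := (H y)⁻¹) (by simp) ?_ ?_
  · have hc : ContinuousOn (fun τ => (H τ)⁻¹) (Ioc R y) := fun τ hτ =>
      ((hH.hasDerivAt hτ.1).continuousAt.inv₀ (hH.pos τ hτ.1).ne').continuousWithinAt
    exact hc.aestronglyMeasurable measurableSet_Ioc
  · refine ae_restrict_of_forall_mem measurableSet_Ioc fun τ hτ => ?_
    have h1 := hH.pos τ hτ.1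
    have h2 := hH.pos y hy
    rw [Real.norm_of_nonneg (by positivity)]
    exact inv_anti₀ h2 (hH.antitone hτ.1 hy hτ.2)

theorem IsPeakProfile.hasDerivAt_integral_inv {R : ℝ} {H : ℝ → ℝ} (hH : IsPeakProfile R H) {y : ℝ}
    (hy : R < y) : HasDerivAt (fun y => ∫ τ in R..y, (H τ)⁻¹) (1 / H y) y := by
  rw [one_div]
  refine intervalIntegral.integral_hasDerivAt_right (hH.intervalIntegrable_inv hy) ?_
    ((hH.hasDerivAt hy).continuousAt.inv₀ (hH.pos y hy).ne')
  refine ContinuousOn.stronglyMeasurableAtFilter isOpen_Ioi (fun τ hτ => ?_) y hy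
  exact ((hH.hasDerivAt hτ).continuousAt.inv₀ (hH.pos τ hτ).ne').continuousWithinAt

theorem IsPeakProfile.integral_inv_pos {R : ℝ} {H : ℝ → ℝ} (hH : IsPeakProfile R H) {y : ℝ}
    (hy : R < y) : 0 < ∫ τ in R..y, (H τ)⁻¹ :=
  intervalIntegral.intervalIntegral_pos_of_pos_on (hH.intervalIntegrable_inv hy)
    (fun τ hτ => inv_pos.2 (hH.pos τ hτ.1)) hy

theorem IsPeakProfile.integral_inv_mono {R : ℝ} {H : ℝ → ℝ} (hH : IsPeakProfile R H) {y z : ℝ}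
    (hy : R < y) (hyz : y ≤ z) : ∫ τ in R..y, (H τ)⁻¹ ≤ ∫ τ in R..z, (H τ)⁻¹ := by
  refine intervalIntegral.integral_mono_interval le_rfl hy.le hyz
    (ae_restrict_of_forall_mem measurableSet_Ioc fun τ hτ => ?_)
    (hH.intervalIntegrable_inv (hy.trans_le hyz))
  exact (inv_pos.2 (hH.pos τ hτ.1)).le

/-- Far out, the peak is regular. -/
theorem IsPeakProfile.exists_isRegularPeak {R : ℝ} {H : ℝ → ℝ} (hH : IsPeakProfile R H)
    (hΩ : IsPeakDomain R H Ω) (b : ℝ) : ∃ (a : ℝ) (h h' Φ : ℝ → ℝ) (c : ℝ), b < a ∧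
      IsRegularPeak Ω a h h' Φ c ∧ ∀ y, a ≤ y → h y = H y ∧ Φ y = ∫ τ in R..y, (H τ)⁻¹ := by
  obtain ⟨s₀, hs₀⟩ := eventually_atTop.1
    ((tendsto_order.1 hH.deriv_tendsto.abs).2 1 (by simp))
  set s := max s₀ (max R b) + 1 with hs
  have hss : s₀ ≤ s := by linarith [le_max_left s₀ (max R b)]
  have hsR : R < s := by linarith [le_max_right s₀ (max R b), le_max_left R b]
  have hsb : b < s := by linarith [le_max_right s₀ (max R b), le_max_right R b]
  have hm : ∀ y, R < max y s := fun y => lt_max_of_lt_right hsR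
  have hmc : Continuous fun y => max y s := by fun_prop
  have heq : ∀ y, s + 1 ≤ y → max y s = y := fun y hy => max_eq_left (by linarith)
  have hev : ∀ y, s + 1 ≤ y → ∀ᶠ z in 𝓝 y, max z s = z := fun y hy => by
    filter_upwards [Ioi_mem_nhds (show s < y by linarith)] with z hz
    exact max_eq_left (le_of_lt hz)
  have hcomp : ∀ {g g' : ℝ → ℝ}, (∀ y, R < y → HasDerivAt g (g' y) y) →
      Continuous fun y => g (max y s) := fun {g g'} hg =>
    continuous_iff_continuousAt.2 fun y =>
      (hg _ (hm y)).continuousAt.comp (f := fun y => max y s) hmc.continuousAt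
  refine ⟨s + 1, fun y => H (max y s), deriv H, fun y => ∫ τ in R..max y s, (H τ)⁻¹,
    ∫ τ in R..s, (H τ)⁻¹, by linarith, ?_, fun y hy => by simp only [heq y hy, and_self]⟩
  have hdc : ContinuousOn (deriv H) (Ioi R) :=
    hH.smooth.continuousOn_deriv_of_isOpen isOpen_Ioi (by simp)
  exact
    { cont := hcomp fun y hy => hH.hasDerivAt hy
      pos := fun y => hH.pos _ (hm y)
      anti := fun y z hyz => hH.antitone (hm y) (hm z) (max_le_max_right s hyz)
      hasDerivAt := fun y hy => (hH.hasDerivAt (by linarith)).congr_of_eventuallyEq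
        ((hev y hy).mono fun z hz => by simp only [hz])
      cont_deriv := hdc.mono fun y hy => hsR.trans (lt_of_lt_of_le (by linarith) hy)
      abs_deriv_le := fun y hy => (hs₀ y (by linarith)).le
      cont_primitive := hcomp fun y hy => hH.hasDerivAt_integral_inv hy
      hasDerivAt_primitive := fun y hy => by
        rw [heq y hy]
        exact (hH.hasDerivAt_integral_inv (by linarith)).congr_of_eventuallyEq
          ((hev y hy).mono fun z hz => by simp only [hz])
      const_pos := hH.integral_inv_pos hsR
      le_primitive := fun y => hH.integral_inv_mono hsR (le_max_right _ _)
      subset := by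
        rintro x ⟨hx1, hx2⟩
        have hx0 : R < x 0 := hsR.trans (lt_of_lt_of_le (by linarith) hx1)
        have hp := hH.pos _ hx0
        simp only [heq _ hx1, sub_zero, mem_Ioo, lt_div_iff₀ hp, div_lt_iff₀ hp, neg_mul,
          one_mul] at hx2
        have : x ∈ peak R H := ⟨hx0, hx2⟩
        rw [← hΩ.peak_eq] at this
        exact this.1 }

theorem IsFiniteUnionOfCurves.exists_isOpen {S Γ : Set Plane} (h : IsFiniteUnionOfCurves S Γ) :
    ∃ U : Set Plane, IsOpen U ∧ Γ = U ∩ frontier S := by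
  obtain ⟨F, -, rfl, hF⟩ := h
  choose! U hU using fun c hc => (hF c hc).2
  refine ⟨⋃ c ∈ F, U c, isOpen_biUnion fun c hc => (hU c hc).1, ?_⟩
  rw [sUnion_eq_biUnion, iUnion₂_inter]
  exact iUnion₂_congr fun c hc => (hU c hc).2

/-- A connected part of the boundary that is contained in the union of two of the boundary
pieces is contained in one of them. -/
theorem IsBoundaryDecomposition.subset_or_subset {S ΓD ΓN ΓM s : Set Plane}
    (hΓ : IsBoundaryDecomposition S ΓD ΓN ΓM) (hs : IsPreconnected s) (h : s ⊆ ΓD ∪ ΓM) :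
    s ⊆ ΓD ∨ s ⊆ ΓM := by
  obtain ⟨U, hU, hUD⟩ := hΓ.curvesD.exists_isOpen
  obtain ⟨V, hV, hVM⟩ := hΓ.curvesM.exists_isOpen
  have hsF : s ⊆ frontier S := h.trans (union_subset hΓ.subset_frontier.1 hΓ.subset_frontier.2)
  have hsUV : s ⊆ U ∪ V := h.trans (union_subset_union (hUD ▸ inter_subset_left)
    (hVM ▸ inter_subset_left))
  have hdis : s ∩ (U ∩ V) = ∅ := by
    refine eq_empty_of_forall_notMem fun x hx => ?_
    have hxD : x ∈ ΓD := by
      rw [hUD]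
      exact ⟨hx.2.1, hsF hx.1⟩
    have hxM : x ∈ ΓM := by
      rw [hVM]
      exact ⟨hx.2.2, hsF hx.1⟩
    exact disjoint_left.1 hΓ.disjointDM hxD hxM
  rcases isPreconnected_iff_subset_of_disjoint.1 hs U V hU hV hsUV hdis with h1 | h1
  · exact Or.inl (hUD ▸ subset_inter h1 hsF)
  · exact Or.inr (hVM ▸ subset_inter h1 hsF)

/-- If `u = 0` on one side of the peak, the Hardy inequality for the transversal derivative and
the one-dimensional Friedrichs inequality on the fibres show that the tail of the peak carries
little of the mass. -/
theorem exists_tail_bound {R ρ : ℝ} {H : ℝ → ℝ} (hH : IsPeakProfile R H)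
    (hΩ : IsPeakDomain R H Ω) {ΓD ΓN ΓM : Set Plane}
    (hΓ : IsBoundaryDecomposition (Ω : Set Plane) ΓD ΓN ΓM)
    (hside : upperSide ρ H ⊆ ΓD ∪ ΓM ∨ lowerSide ρ H ⊆ ΓD ∪ ΓM)
    (hlim : Tendsto (fun y => (H y ^ 3)⁻¹ * hardyWeight R H y) atTop atTop) {ε : ℝ≥0∞}
    (hε : 0 < ε) : ∃ b : ℝ, ∀ u ∈ energySpace Ω ΓD ΓM,
      ∫⁻ x in (Ω : Set Plane) ∩ {x | b < x 0}, ‖u x‖ₑ ^ 2 ≤ ε * sqNormH2 u := by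
  obtain ⟨a, h, h', Φ, c, hab, hP, hPH⟩ := hH.exists_isRegularPeak hΩ (max R ρ)
  have haR : R < a := (le_max_left _ _).trans_lt hab
  have haρ : ρ < a := (le_max_right _ _).trans_lt hab
  obtain ⟨σ, hσ, hΓσ⟩ : ∃ σ : ℝ, (σ = 1 ∨ σ = -1) ∧
      ∀ y, a ≤ y → cpt 1 y (σ * h y) ∈ ΓD ∪ ΓM := by
    rcases hside with hs | hs
    · refine ⟨1, Or.inl rfl, fun y hy => hs ⟨?_, ?_⟩⟩ <;>
        rw [cpt_of_ne (zero_ne_one : (0 : Fin 2) ≠ 1)]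
      · linarith
      · rw [cpt_self, (hPH y hy).1, one_mul]
    · refine ⟨-1, Or.inr rfl, fun y hy => hs ⟨?_, ?_⟩⟩ <;>
        rw [cpt_of_ne (zero_ne_one : (0 : Fin 2) ≠ 1)]
      · linarith
      · rw [cpt_self, (hPH y hy).1, neg_one_mul]
  obtain ⟨Γ, hΓu, hΓ'⟩ : ∃ Γ : Set Plane, (∀ u ∈ energySpace Ω ΓD ΓM, ZeroTrace Γ u) ∧
      ∀ y, a ≤ y → cpt 1 y (σ * h y) ∈ Γ := by
    have hc : Continuous fun y => cpt 1 y (σ * h y) := (continuous_cpt 1).comp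
      (by have := hP.cont; fun_prop : Continuous fun y : ℝ => (y, σ * h y))
    have hpre : IsPreconnected ((fun y => cpt 1 y (σ * h y)) '' Ici a) :=
      isPreconnected_Ici.image _ hc.continuousOn
    rcases hΓ.subset_or_subset hpre (image_subset_iff.2 hΓσ) with h1 | h1
    · exact ⟨ΓD, fun u hu => hu.2.1, image_subset_iff.1 h1⟩
    · exact ⟨ΓM, fun u hu => hu.2.2.2, image_subset_iff.1 h1⟩
  obtain ⟨C, hC, hhardy⟩ := hP.exists_hardy_bound
  obtain ⟨δ, hδ, hδε⟩ := exists_ofReal_mul_le (by finiteness : 8 * C ≠ ⊤) hε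
  -- Beyond `b` the factor `h ^ 2` of the Friedrichs inequality is small against the weight.
  obtain ⟨b₀, hb₀⟩ := eventually_atTop.1 (hlim.eventually_ge_atTop (1 / δ))
  set b := max b₀ (a + 1) with hb
  have hweight : ∀ y, b ≤ y → h y ^ 2 ≤ δ * (1 / (h y ^ 2 * Φ y ^ 2)) := by
    intro y hy
    have hya : a ≤ y := by linarith [(le_max_right b₀ (a + 1)).trans hy]
    have h1 := hb₀ y ((le_max_left _ _).trans hy)
    rw [hardyWeight, ← (hPH y hya).2, ← (hPH y hya).1] at h1
    have hp := hP.pos y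
    have hq := hP.primitive_pos y
    have e : (h y ^ 3)⁻¹ * (1 / (4 * h y) * (Φ y ^ 2)⁻¹) = 1 / (4 * (h y ^ 4 * Φ y ^ 2)) := by
      field_simp
    rw [e, div_le_div_iff₀ hδ (by positivity), one_mul] at h1
    rw [mul_one_div, le_div_iff₀ (by positivity)]
    have h2 : 0 ≤ h y ^ 4 * Φ y ^ 2 := by positivity
    calc _ = h y ^ 4 * Φ y ^ 2 := by ring
      _ ≤ δ := by linarith
  refine ⟨b, fun u hu => ?_⟩
  have hsub : (Ω : Set Plane) ∩ {x | b < x 0} ⊆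
      ⋃ n : ℕ, subpeak h (Ioo b (b + n)) (Ioo (-1) 1) := by
    rintro x ⟨hxΩ, hxb⟩
    have hxb' : b < x 0 := hxb
    have hxa : a ≤ x 0 := by linarith [le_max_right b₀ (a + 1)]
    have hxp : x ∈ peak R H := by
      rw [← hΩ.peak_eq]
      exact ⟨hxΩ, haR.trans_le hxa⟩
    obtain ⟨n, hn⟩ := exists_nat_gt (x 0 - b)
    have hp := hH.pos (x 0) hxp.1
    refine mem_iUnion.2 ⟨n, ⟨hxb', by linarith⟩, ?_⟩
    simp only [sub_zero, mem_Ioo, (hPH _ hxa).1, lt_div_iff₀ hp, div_lt_iff₀ hp, neg_mul, one_mul]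
    exact hxp.2
  refine (lintegral_mono_set hsub).trans (setLIntegral_iUnion_le (fun n l hnl =>
    columns_mono (Ioo_subset_Ioo_right (by gcongr)) Subset.rfl) fun n => ?_)
  have hba : a + 1 ≤ b := le_max_right _ _
  have hm : MeasurableSet (subpeak h (Ioo b (b + n)) (Ioo (-1) 1)) :=
    hP.measurableSet measurableSet_Ioo measurableSet_Ioo
  refine (hP.lintegral_le_of_zeroTrace hσ hΓ' (hΓu u hu) (by linarith)).trans ?_
  calc _ ≤ 8 * ∫⁻ x in subpeak h (Ioo b (b + n)) (Ioo (-1) 1),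
          ENNReal.ofReal δ * (peakWeight h Φ x * ‖pd 1 u x‖ₑ ^ 2) := by
        refine mul_le_mul_right (setLIntegral_mono' hm fun x hx => ?_) _
        rw [← mul_assoc]
        refine mul_le_mul_left ?_ _
        rw [peakWeight, ← ENNReal.ofReal_pow (hP.pos _).le, ← ENNReal.ofReal_mul hδ.le]
        exact ENNReal.ofReal_le_ofReal (hweight _ hx.1.1.le)
    _ = 8 * (ENNReal.ofReal δ * ∫⁻ x in subpeak h (Ioo b (b + n)) (Ioo (-1) 1),
          peakWeight h Φ x * ‖pd 1 u x‖ₑ ^ 2) := by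
        rw [lintegral_const_mul' _ _ ENNReal.ofReal_ne_top]
    _ ≤ 8 * (ENNReal.ofReal δ * (C * sqNormH2 u)) := by
        refine mul_le_mul_right (mul_le_mul_right ((lintegral_mono_set ?_).trans
          (hhardy u hu.1)) _) _
        exact columns_mono (fun y hy => lt_of_le_of_lt hba hy.1) Subset.rfl
    _ = ENNReal.ofReal δ * (8 * C) * sqNormH2 u := by ring
    _ ≤ _ := by gcongr

end

/-! ### Compactness of the energy ball -/

section

variable {Ω : TopologicalSpace.Opens Plane}

theorem setLIntegral_biUnion_le {β : Type*} {t : Finset β} {s : β → Set Plane}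
    {f : Plane → ℝ≥0∞} {η : ℝ≥0∞} (h : ∀ i ∈ t, ∫⁻ x in s i, f x ≤ η / (t.card + 1)) :
    ∫⁻ x in ⋃ i ∈ t, s i, f x ≤ η := by
  have h1 : ∫⁻ x in ⋃ i ∈ t, s i, f x ≤ ∑ i ∈ t, ∫⁻ x in s i, f x := by
    have := lintegral_iUnion_le (μ := volume) (fun i : t => s i) f
    rwa [tsum_fintype, Finset.sum_coe_sort t (fun i => ∫⁻ x in s i, f x),
      iUnion_subtype (· ∈ t) (fun i => s i)] at this
  calc _ ≤ ∑ i ∈ t, η / (t.card + 1) := h1.trans (Finset.sum_le_sum h)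
    _ = t.card * (η / (t.card + 1)) := by rw [Finset.sum_const, nsmul_eq_mul]
    _ ≤ (t.card + 1) * (η / (t.card + 1)) := by
        gcongr
        exact le_self_add
    _ ≤ η := ENNReal.mul_div_le

theorem lintegral_enorm_sq_eq (u : L2 Ω) :
    ∫⁻ x in (Ω : Set Plane), ‖u x‖ₑ ^ 2 = ENNReal.ofReal (‖u‖ ^ 2) := by
  rw [← eLpNorm_two_sq, Lp.norm_def, ENNReal.ofReal_pow ENNReal.toReal_nonneg,
    ENNReal.ofReal_toReal (Lp.eLpNorm_ne_top u)]

/-- The energy controls the second derivatives, because `ν < 1 / 2`. -/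
theorem sqNormH2_le {ν : ℝ} (hν : ν ∈ Ico (0 : ℝ) (1 / 2)) (u : L2 Ω) :
    sqNormH2 u ≤ ENNReal.ofReal (2 * (energy ν u + ‖u‖ ^ 2)) := by
  rw [sqNormH2, lintegral_enorm_sq_eq, lintegral_enorm_sq_eq, lintegral_enorm_sq_eq,
    lintegral_enorm_sq_eq, ← ENNReal.ofReal_add (by positivity) (by positivity),
    ← ENNReal.ofReal_add (by positivity) (by positivity),
    ← ENNReal.ofReal_add (by positivity) (by positivity)]
  refine ENNReal.ofReal_le_ofReal ?_
  rw [energy_eq]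
  have h := (abs_le.1 ((Complex.abs_re_le_norm _).trans
    (norm_inner_le_norm (𝕜 := ℂ) (pd 0 (pd 0 u)) (pd 1 (pd 1 u))))).1
  have h1 : 2 * ν * -(‖pd 0 (pd 0 u)‖ * ‖pd 1 (pd 1 u)‖) ≤
      2 * ν * (inner ℂ (pd 0 (pd 0 u)) (pd 1 (pd 1 u))).re :=
    mul_le_mul_of_nonneg_left h (by linarith [hν.1])
  have h2 : ‖pd 0 (pd 1 u)‖ ^ 2 ≤ 2 * (1 - ν) * ‖pd 0 (pd 1 u)‖ ^ 2 :=
    le_mul_of_one_le_left (sq_nonneg _) (by linarith [hν.2])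
  have h3 : ν * (2 * (‖pd 0 (pd 0 u)‖ * ‖pd 1 (pd 1 u)‖)) ≤
      1 / 2 * (‖pd 0 (pd 0 u)‖ ^ 2 + ‖pd 1 (pd 1 u)‖ ^ 2) := by
    refine mul_le_mul hν.2.le ?_ (by positivity) (by norm_num)
    nlinarith [sq_nonneg (‖pd 0 (pd 0 u)‖ - ‖pd 1 (pd 1 u)‖)]
  have h4 : 0 ≤ ‖u‖ ^ 2 := sq_nonneg _
  have h5 : 0 ≤ ‖pd 0 (pd 1 u)‖ ^ 2 := sq_nonneg _
  linarith

theorem exists_closedSquare_subset {S : Set Plane} (hS : IsOpen S) {x : Plane} (hx : x ∈ S) :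
    ∃ r > 0, closedSquare x r ⊆ S := by
  obtain ⟨δ, hδ, hb⟩ := Metric.isOpen_iff.1 hS x hx
  refine ⟨δ / 3, by positivity, fun y hy => hb ?_⟩
  rw [Metric.mem_ball]
  linarith [dist_le_of_plane y x, hy.1, hy.2]

/-- A profile is bounded, also near `R`, because its second derivative is bounded. -/
theorem IsPeakProfile.exists_le {R : ℝ} {H : ℝ → ℝ} (hH : IsPeakProfile R H) :
    ∃ M, ∀ y, R < y → H y ≤ M := by
  obtain ⟨C, hC⟩ := hH.deriv2_bounded
  have hd : ∀ y, R < y → HasDerivAt (deriv H) (deriv (deriv H) y) y := fun y hy =>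
    (((contDiffOn_infty_iff_deriv_of_isOpen isOpen_Ioi).1 hH.smooth).2.differentiableOn
      (by simp) |>.differentiableAt (Ioi_mem_nhds hy)).hasDerivAt
  have hR1 : R < R + 1 := by linarith
  have h1 : ∀ y ∈ Ioc R (R + 1), |deriv H y| ≤ |deriv H (R + 1)| + C := by
    intro y hy
    have := (convex_Ioc R (R + 1)).norm_image_sub_le_of_norm_hasDerivWithin_le (f := deriv H)
      (fun z hz => (hd z hz.1).hasDerivWithinAt) (fun z hz => hC z hz.1)
      (right_mem_Ioc.2 hR1) hy
    rw [Real.norm_eq_abs, Real.norm_eq_abs] at this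
    have hC0 : 0 ≤ C := (abs_nonneg _).trans (hC _ hR1)
    have h2 : |y - (R + 1)| ≤ 1 := abs_le.2 ⟨by linarith [hy.1], by linarith [hy.2]⟩
    have h3 := abs_sub_abs_le_abs_sub (deriv H y) (deriv H (R + 1))
    nlinarith
  refine ⟨H (R + 1) + (|deriv H (R + 1)| + C), fun y hy => ?_⟩
  have hC0 : 0 ≤ C := (abs_nonneg _).trans (hC _ hR1)
  rcases le_total y (R + 1) with hle | hle
  · have := (convex_Ioc R (R + 1)).norm_image_sub_le_of_norm_hasDerivWithin_le (f := H)
      (fun z hz => (hH.hasDerivAt hz.1).hasDerivWithinAt) (fun z hz => h1 z hz)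
      (right_mem_Ioc.2 hR1) ⟨hy, hle⟩
    rw [Real.norm_eq_abs, Real.norm_eq_abs] at this
    have h2 : |y - (R + 1)| ≤ 1 := abs_le.2 ⟨by linarith, by linarith⟩
    have h3 := le_abs_self (H y - H (R + 1))
    nlinarith [abs_nonneg (deriv H (R + 1))]
  · have := hH.antitone hR1 hy hle
    linarith [abs_nonneg (deriv H (R + 1))]

theorem IsPeakDomain.isCompact_closure {R : ℝ} {H : ℝ → ℝ} (hH : IsPeakProfile R H)
    (hΩ : IsPeakDomain R H Ω) (b : ℝ) :
    IsCompact (closure ((Ω : Set Plane) ∩ {x | x 0 ≤ b})) := by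
  obtain ⟨M, hM⟩ := hH.exists_le
  refine Metric.isCompact_of_isClosed_isBounded isClosed_closure (Bornology.IsBounded.closure ?_)
  have h1 : Bornology.IsBounded {x : Plane | R < x 0 ∧ x 0 ≤ b ∧ |x 1| ≤ M} := by
    refine (Metric.isBounded_closedBall (x := (0 : Plane)) (r := (|R| + |b|) + M)).subset
      fun x hx => ?_
    rw [Metric.mem_closedBall]
    refine (dist_le_of_plane x 0).trans (add_le_add ?_ ?_)
    · rw [PiLp.zero_apply, sub_zero, abs_le]
      constructor
      · linarith [neg_abs_le R, abs_nonneg b, hx.1]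
      · linarith [le_abs_self b, abs_nonneg R, hx.2.1]
    · rw [PiLp.zero_apply, sub_zero]
      exact hx.2.2
  refine (hΩ.bounded.union h1).subset fun x hx => ?_
  rcases le_or_gt (x 0) R with hle | hgt
  · exact Or.inl ⟨hx.1, hle⟩
  · have hp : x ∈ peak R H := by
      rw [← hΩ.peak_eq]
      exact ⟨hx.1, hgt⟩
    exact Or.inr ⟨hgt, hx.2, (abs_le.2 ⟨hp.2.1.le, hp.2.2.le⟩).trans (hM _ hgt)⟩

/-- The energy ball is totally bounded in `L²(Ω)`: the tail of the peak and a thin layer along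
the rest of the boundary carry little mass, and what remains is compactly contained in `Ω`. -/
theorem totallyBounded_energyBall {R ρ : ℝ} {H : ℝ → ℝ} (hH : IsPeakProfile R H)
    (hΩ : IsPeakDomain R H Ω) {ΓD ΓN ΓM : Set Plane}
    (hΓ : IsBoundaryDecomposition (Ω : Set Plane) ΓD ΓN ΓM)
    (hside : upperSide ρ H ⊆ ΓD ∪ ΓM ∨ lowerSide ρ H ⊆ ΓD ∪ ΓM)
    (hlim : Tendsto (fun y => (H y ^ 3)⁻¹ * hardyWeight R H y) atTop atTop) {ν : ℝ}
    (hν : ν ∈ Ico (0 : ℝ) (1 / 2)) :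
    TotallyBounded {u : L2 Ω | u ∈ energySpace Ω ΓD ΓM ∧ energy ν u + ‖u‖ ^ 2 ≤ 1} := by
  set B := {u : L2 Ω | u ∈ energySpace Ω ΓD ΓM ∧ energy ν u + ‖u‖ ^ 2 ≤ 1} with hB
  -- Differences of elements of the ball have bounded `H²` norm.
  have hdiff : ∀ u ∈ B, ∀ w ∈ B, sqNormH2 (u - w) ≤ 8 := by
    intro u hu w hw
    refine (sqNormH2_le hν _).trans ?_
    refine (ENNReal.ofReal_le_ofReal (q := 8) ?_).trans_eq (ENNReal.ofReal_ofNat 8)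
    have h1 := energy_add_le hν hu.1.1 (hw.1.1.smul (-1))
    rw [energy_smul hw.1.1, neg_one_smul, ← sub_eq_add_neg, norm_neg, norm_one] at h1
    have h2 : ‖u - w‖ ^ 2 ≤ 2 * ‖u‖ ^ 2 + 2 * ‖w‖ ^ 2 := by
      nlinarith [norm_sub_le u w, norm_nonneg (u - w), sq_nonneg (‖u‖ - ‖w‖), norm_nonneg u,
        norm_nonneg w]
    linarith [hu.2, hw.2]
  rw [totallyBounded_iff_ultrafilter]
  intro f hf
  rw [Metric.cauchy_iff]
  refine ⟨f.neBot, fun ε hε => ?_⟩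
  have hBf : B ∈ f := le_principal_iff.1 hf
  set η := ENNReal.ofReal (ε ^ 2) / 4 with hη
  have hη0 : 0 < η := ENNReal.div_pos (by simpa using hε.ne') (by norm_num)
  have hη8 : 0 < η / 8 := ENNReal.div_pos hη0.ne' (by norm_num)
  have h88 : ∀ κ : ℝ≥0∞, κ / 8 * 8 = κ := fun κ =>
    ENNReal.div_mul_cancel (by norm_num) (by norm_num)
  -- The tail of the peak.
  obtain ⟨b, hb⟩ := exists_tail_bound hH hΩ hΓ hside hlim hη8
  set F := closure ((Ω : Set Plane) ∩ {x | x 0 ≤ b}) with hF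
  have hFc : IsCompact F := hΩ.isCompact_closure hH b
  -- A layer along the boundary.
  choose! W hWo hpW hW using fun p (hp : p ∈ frontier (Ω : Set Plane)) =>
    exists_boundary_layer hΩ.smooth_boundary hp
  obtain ⟨t, htF, ht⟩ := (hFc.inter_left isClosed_frontier).elim_nhds_subcover W
    fun p hp => (hWo p hp.1).mem_nhds (hpW p hp.1)
  have hηt : 0 < η / (t.card + 1) / 8 :=
    ENNReal.div_pos (ENNReal.div_pos hη0.ne' (by finiteness)).ne' (by norm_num)
  choose! N hNo hWN hN using fun p (hp : p ∈ t) => hW p (htF p hp).1 _ hηt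
  -- The compact remainder.
  set K := F \ ⋃ p ∈ t, N p with hK
  have hKc : IsCompact K := hFc.diff (isOpen_biUnion fun p hp => hNo p hp)
  have hKΩ : K ⊆ (Ω : Set Plane) := by
    rintro x ⟨hxF, hxN⟩
    by_contra hx
    have hxfr : x ∈ frontier (Ω : Set Plane) := by
      rw [Ω.isOpen.frontier_eq]
      exact ⟨closure_mono inter_subset_left hxF, hx⟩
    obtain ⟨p, hp, hxp⟩ := mem_iUnion₂.1 (ht ⟨hxfr, hxF⟩)
    exact hxN (mem_iUnion₂.2 ⟨p, hp, hWN p hp ⟨hxfr, hxp⟩⟩)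
  choose! r hr0 hr using fun x (hx : x ∈ (Ω : Set Plane)) =>
    exists_closedSquare_subset Ω.isOpen hx
  obtain ⟨q, hqK, hq⟩ := hKc.elim_nhds_subcover (fun x => square x (r x)) fun x hx =>
    (isOpen_square _ _).mem_nhds ⟨by simpa using hr0 x (hKΩ hx), by simpa using hr0 x (hKΩ hx)⟩
  have hηq : 0 < η / (q.card + 1) := ENNReal.div_pos hη0.ne' (by finiteness)
  have hfH : ∀ᶠ u in (f : Filter (L2 Ω)), MemH2 u ∧ sqNormH2 u < 3 := by
    filter_upwards [hBf] with u hu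
    refine ⟨hu.1.1, ((sqNormH2_le hν u).trans (ENNReal.ofReal_le_ofReal (q := 2) ?_)).trans_lt ?_⟩
    · linarith [hu.2]
    · rw [ENNReal.ofReal_ofNat]
      norm_num
  choose! s hsf hs using fun x (hx : x ∈ q) => exists_mem_ultrafilter_square
    (hr0 x (hKΩ (hqK x hx))) (hr x (hKΩ (hqK x hx))) f (by finiteness : (3 : ℝ≥0∞) ≠ ⊤) hfH hηq
  refine ⟨B ∩ ⋂ x ∈ q, s x, inter_mem hBf ((Filter.biInter_finset_mem q).2 hsf),
    fun u hu w hw => ?_⟩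
  rw [mem_inter_iff, mem_iInter₂] at hu hw
  have hmem : u - w ∈ energySpace Ω ΓD ΓM := sub_mem hu.1.1 hw.1.1
  have hd8 := hdiff u hu.1 w hw.1
  set F₂ : Plane → ℝ≥0∞ := fun x => ‖(u - w : L2 Ω) x‖ₑ ^ 2 with hF₂
  have h1 : ∫⁻ x in (Ω : Set Plane) ∩ {x | b < x 0}, F₂ x ≤ η :=
    (hb _ hmem).trans ((mul_le_mul_right hd8 _).trans (h88 η).le)
  have h2 : ∫⁻ x in ⋃ p ∈ t, (Ω : Set Plane) ∩ N p, F₂ x ≤ η :=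
    setLIntegral_biUnion_le fun p hp =>
      (hN p hp _ hmem.1).trans ((mul_le_mul_right hd8 _).trans (h88 _).le)
  have h3 : ∫⁻ x in ⋃ x ∈ q, square x (r x), F₂ x ≤ η := by
    refine setLIntegral_biUnion_le fun x hx => le_of_eq_of_le ?_
      (hs x hx u (hu.2 x hx) w (hw.2 x hx))
    have hsub : square x (r x) ⊆ (Ω : Set Plane) :=
      (square_subset_closedSquare _ _).trans (hr x (hKΩ (hqK x hx)))
    refine lintegral_congr_ae ?_
    filter_upwards [ae_restrict_of_ae_restrict_of_subset hsub (Lp.coeFn_sub u w)] with z hz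
    simp only [hF₂, hz, Pi.sub_apply]
  have hcover : (Ω : Set Plane) ⊆ ((Ω : Set Plane) ∩ {x | b < x 0}) ∪
      ((⋃ p ∈ t, (Ω : Set Plane) ∩ N p) ∪ ⋃ x ∈ q, square x (r x)) := by
    intro x hx
    rcases lt_or_ge b (x 0) with hlt | hle
    · exact Or.inl ⟨hx, hlt⟩
    · by_cases hxN : x ∈ ⋃ p ∈ t, N p
      · obtain ⟨p, hp, hxp⟩ := mem_iUnion₂.1 hxN
        exact Or.inr (Or.inl (mem_iUnion₂.2 ⟨p, hp, hx, hxp⟩))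
      · exact Or.inr (Or.inr (hq ⟨subset_closure ⟨hx, hle⟩, hxN⟩))
  have hfin : η ≠ ⊤ := ENNReal.div_ne_top ENNReal.ofReal_ne_top (by norm_num)
  have htot : ENNReal.ofReal (‖u - w‖ ^ 2) < ENNReal.ofReal (ε ^ 2) := by
    rw [← lintegral_enorm_sq_eq]
    calc ∫⁻ x in (Ω : Set Plane), F₂ x ≤ η + (η + η) :=
          (lintegral_mono_set hcover).trans ((lintegral_union_le _ _ _).trans
            (add_le_add h1 ((lintegral_union_le _ _ _).trans (add_le_add h2 h3))))
      _ < η + (η + η) + η := ENNReal.lt_add_right (by finiteness) hη0.ne'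
      _ = η * 4 := by ring
      _ = _ := ENNReal.div_mul_cancel (by norm_num) (by norm_num)
  rw [dist_eq_norm]
  exact lt_of_pow_lt_pow_left₀ 2 hε.le ((ENNReal.ofReal_lt_ofReal_iff (by positivity)).1 htot)

end

/-! ### Power profiles -/

theorem hasDerivAt_rpow_pos {y : ℝ} (hy : 0 < y) (p : ℝ) :
    HasDerivAt (fun y : ℝ => y ^ p) (p * y ^ (p - 1)) y :=
  Real.hasDerivAt_rpow_const (Or.inl hy.ne')

theorem isPeakProfile_rpow {α R : ℝ} (hα : 0 < α) (hR : 0 < R) :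
    IsPeakProfile R (fun y : ℝ => y ^ (-1 - α)) := by
  have hd : ∀ y : ℝ, 0 < y → deriv (fun y : ℝ => y ^ (-1 - α)) y =
      (-1 - α) * y ^ (-1 - α - 1) := fun y hy => (hasDerivAt_rpow_pos hy _).deriv
  have hd2 : ∀ y : ℝ, 0 < y → deriv (deriv fun y : ℝ => y ^ (-1 - α)) y =
      (-1 - α) * ((-1 - α - 1) * y ^ (-1 - α - 1 - 1)) := by
    intro y hy
    have he : deriv (fun y : ℝ => y ^ (-1 - α)) =ᶠ[𝓝 y] fun y => (-1 - α) * y ^ (-1 - α - 1) := by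
      filter_upwards [Ioi_mem_nhds hy] with z hz
      exact hd z hz
    rw [he.deriv_eq]
    exact ((hasDerivAt_rpow_pos hy _).const_mul _).deriv
  constructor
  · intro y hy
    exact (Real.contDiffAt_rpow_const_of_ne (hR.trans hy).ne').contDiffWithinAt
  · exact fun y hy => Real.rpow_pos_of_pos (hR.trans hy) _
  · intro y hy z _ hyz
    exact Real.rpow_le_rpow_of_nonpos (hR.trans hy) hyz (by linarith)
  · have h1 : Tendsto (fun y : ℝ => (-1 - α) * y ^ (-(1 + α + 1))) atTop (𝓝 0) := by
      simpa using (tendsto_rpow_neg_atTop (by linarith : 0 < 1 + α + 1)).const_mul (-1 - α)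
    refine h1.congr' ?_
    filter_upwards [eventually_gt_atTop 0] with y hy
    rw [hd y hy]
    ring_nf
  · refine ⟨|-1 - α| * (|-1 - α - 1| * R ^ (-1 - α - 1 - 1)), fun y hy => ?_⟩
    have hy0 : 0 < y := hR.trans hy
    rw [hd2 y hy0, abs_mul, abs_mul, abs_of_pos (Real.rpow_pos_of_pos hy0 _)]
    refine mul_le_mul_of_nonneg_left (mul_le_mul_of_nonneg_left ?_ (abs_nonneg _)) (abs_nonneg _)
    exact Real.rpow_le_rpow_of_nonpos hR hy.le (by linarith)

theorem tendsto_hardyWeight_rpow {α R : ℝ} (hα : 0 < α) (hR : 0 < R) :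
    Tendsto (fun y : ℝ => ((y ^ (-1 - α)) ^ 3)⁻¹ *
      hardyWeight R (fun y : ℝ => y ^ (-1 - α)) y) atTop atTop := by
  have hl : Tendsto (fun y : ℝ => (2 + α) ^ 2 / 4 * y ^ (2 * α)) atTop atTop :=
    (tendsto_rpow_atTop (by linarith : 0 < 2 * α)).const_mul_atTop (by positivity)
  refine tendsto_atTop_mono' _ ?_ hl
  filter_upwards [eventually_gt_atTop R] with y hy
  have hy0 : 0 < y := hR.trans hy
  set Φ := ∫ τ in R..y, (τ ^ (-1 - α))⁻¹ with hΦ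
  have hΦ0 : 0 < Φ := (isPeakProfile_rpow hα hR).integral_inv_pos hy
  have hΦle : Φ ≤ y ^ (2 + α) / (2 + α) := by
    have e : Φ = ∫ τ in R..y, τ ^ (1 + α) := by
      refine intervalIntegral.integral_congr fun τ hτ => ?_
      rw [uIcc_of_le hy.le] at hτ
      have hτ0 : 0 ≤ τ := hR.le.trans hτ.1
      rw [← Real.rpow_neg hτ0]
      ring_nf
    rw [e, integral_rpow (Or.inl (by linarith)), show 1 + α + 1 = 2 + α by ring]
    gcongr
    linarith [Real.rpow_nonneg hR.le (2 + α)]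
  have hH0 : 0 < y ^ (-1 - α) := Real.rpow_pos_of_pos hy0 _
  have hpow : (y ^ (-1 - α)) ^ 4 * (y ^ (2 + α)) ^ 2 * y ^ (2 * α) = 1 := by
    rw [← Real.rpow_natCast, ← Real.rpow_natCast, ← Real.rpow_mul hy0.le, ← Real.rpow_mul hy0.le,
      ← Real.rpow_add hy0, ← Real.rpow_add hy0]
    push_cast
    ring_nf
    exact Real.rpow_zero y
  have e : ((y ^ (-1 - α)) ^ 3)⁻¹ * hardyWeight R (fun y : ℝ => y ^ (-1 - α)) y =
      1 / (4 * ((y ^ (-1 - α)) ^ 4 * Φ ^ 2)) := by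
    rw [hardyWeight, ← hΦ]
    field_simp
  rw [e, le_div_iff₀ (by positivity)]
  have h1 : Φ ^ 2 ≤ (y ^ (2 + α) / (2 + α)) ^ 2 := by gcongr
  have h2 : 0 < y ^ (2 * α) := Real.rpow_pos_of_pos hy0 _
  calc (2 + α) ^ 2 / 4 * y ^ (2 * α) * (4 * ((y ^ (-1 - α)) ^ 4 * Φ ^ 2))
      ≤ (2 + α) ^ 2 / 4 * y ^ (2 * α) * (4 * ((y ^ (-1 - α)) ^ 4 *
        (y ^ (2 + α) / (2 + α)) ^ 2)) := by gcongr
    _ = (y ^ (-1 - α)) ^ 4 * (y ^ (2 + α)) ^ 2 * y ^ (2 * α) := by field_simp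
    _ = 1 := hpow

end Plate

theorem theorem3 :
    (∀ (R : ℝ) (H : ℝ → ℝ), Plate.IsPeakProfile R H →
      ∀ Ω : TopologicalSpace.Opens Plate.Plane, Plate.IsPeakDomain R H Ω →
      ∀ (ΓD ΓN ΓM : Set Plate.Plane)
        (hΓ : Plate.IsBoundaryDecomposition (Ω : Set Plate.Plane) ΓD ΓN ΓM)
        (ν : ℝ) (hν : ν ∈ Ico (0 : ℝ) (1 / 2)),
      ∀ ρ : ℝ, R ≤ ρ →
        (Plate.upperSide ρ H ⊆ ΓD ∪ ΓM ∨ Plate.lowerSide ρ H ⊆ ΓD ∪ ΓM) →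
        Tendsto (fun y => (H y ^ 3)⁻¹ * Plate.hardyWeight R H y) atTop atTop →
        Plate.HasDiscreteSpectrum (Plate.plateOperator hΓ hν)) ∧
    (∀ α R : ℝ, 0 < α → 0 < R →
      Plate.IsPeakProfile R (fun y : ℝ => y ^ (-1 - α)) ∧
      Tendsto (fun y : ℝ => ((y ^ (-1 - α)) ^ 3)⁻¹ *
        Plate.hardyWeight R (fun y : ℝ => y ^ (-1 - α)) y) atTop atTop) := by
  refine ⟨fun R H hH Ω hΩ ΓD ΓN ΓM hΓ ν hν ρ _ hside hlim => ?_, fun α R hα hR => ?_⟩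
  · exact Plate.hasDiscreteSpectrum_plateOperator hΓ hν
      (Plate.totallyBounded_energyBall hH hΩ hΓ hside hlim hν)
  · exact ⟨Plate.isPeakProfile_rpow hα hR, Plate.tendsto_hardyWeight_rpow hα hR⟩
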